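/- Let $D(K)$ be a prime, twist-reduced diagram of a link $K\subset S^3$ with at least two twist regions $R_1,\dots,R_t$ (maximal rows of bigons arranged end to end; a crossing adjacent to no bigon is also a twist region). Let $a_i$ be the number of crossings of $R_i$. Let $J$ be the augmented link obtained by adding to $K$ a crossing circle $C_i$ around each twist region $R_i$ and then removing full twists, so that $r_i\in\{0,\pm1\}$ signed crossings with $r_i\equiv a_i \pmod 2$ remain at $C_i$ (for a twist region consisting of a single crossing, either of the two directions may be chosen for the crossing circle). The exterior $E(J)$ is decomposed into two right-angled ideal polyhedra $P_1,P_2$: cut along the projection plane and along the halves of the twice-punctured disks bounded by the crossing circles. Truncating the ideal vertices tiles every torus of $\partial E(J)$ by rectangles. For an admissible (immersed) disk $D$ in a truncated polyhedron $P\in\{P_1,P_2\}$, let $$a(D)=\tfrac{\pi}{2}\,\#\{\text{interior edges crossed by }\partial D\}+\pi\,|\partial D\cap\partial E(J)|-2\pi+3\pi\,|\partial D\setminus\partial P|,$$ and let $\ell(\gamma,D)=a(D)/|\partial D\cap\partial E(J)|$ for each segment $\gamma$ of $\partial D$ in a boundary rectangle. The combinatorial length of a closed simplicial curve $\gamma\subset\partial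 E(J)$ made of segments $\gamma_1,\dots,\gamma_m$ is the infimum of $\sum_i\ell(\gamma_i,D_i)$ over all inward extensions of $\gamma$, i.e. all cyclic sequences of admissible disks $D_i$ with $\gamma_i\subset\partial D_i$ whose boundaries agree on the shared faces of consecutive polyhedra. The combinatorial length $\ell_{\rm comb}(s)$ of a slope $s$ is the infimum of the combinatorial lengths of the closed simplicial curves that represent non-zero multiples of $s$. Then: (1) If $T$ is the boundary torus coming from a component $K_j$ of $K$, and $n$ is the number of twist regions visited by $K_j$, counted with multiplicity, then every slope $s$ on $T$ other than the meridian satisfies $$\ell_{\rm comb}(s)\ge \frac{n\pi}{3}.$$ (2) If $T$ is the boundary torus of a crossing circle $C_i$, and $s$ is the surgery slope $1/q$ on $C_i$ ($q\in\mathbb Z$; one meridian and $q$ longitudes), whose filling leaves $n=|r_i+2q|$ crossings in the twist region, then $$\ell_{\rm comb}(s)> \frac{n\pi}{3}.$$ In particular, when the crossings of $R_i$ all twist in the same direction, the slope on $C_i$ that recovers $R_i$ has combinatorial length strictly greater than $a_i\pi/3$. -/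

import Mathlib

/-!
Conventions.  Planar diagrams and polyhedra are given by combinatorial maps.  All pictures are
drawn with the counterclockwise orientation.
-/

noncomputable section

open Classical

namespace AugLink

/-! ## Graphs on the sphere and truncated ideal polyhedra -/

/-- A combinatorial map: `X` is the set of darts (half-edges, pointing away from their vertex),
`σ` sends a dart to the next dart counterclockwise around the same vertex, and `α` sends a dart to
the other dart of the same edge.  The *corner* `x` is the corner between the darts `x` and `σ x`. -/
structure CombMap (X : Type*) where
  σ : Equiv.Perm X
  α : Equiv.Perm X
  α_invol : ∀ x, α (α x) = x
  α_ne : ∀ x, α x ≠ x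

namespace CombMap

variable {X : Type*} (M : CombMap X)

/-- The face permutation: the next dart along the boundary of the face to the left of `x`.
That face contains the corners `x, φ x, φ (φ x), …`. -/
def φ : Equiv.Perm X := M.σ⁻¹ * M.α

/-- `x` and `y` leave the same vertex. -/
def SameVertex (x y : X) : Prop := M.σ.SameCycle x y

/-- The corners `x` and `y` lie in the same face. -/
def SameFace (x y : X) : Prop := M.φ.SameCycle x y

/-- The set of vertices. -/
abbrev Vertex : Type _ := Quotient (Equiv.Perm.SameCycle.setoid M.σ)

/-- The set of edges. -/
abbrev Edge : Type _ := Quotient (Equiv.Perm.SameCycle.setoid M.α)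

/-- The set of faces. -/
abbrev Face : Type _ := Quotient (Equiv.Perm.SameCycle.setoid M.φ)

/-- The graph is connected. -/
def Connected : Prop := ∀ x y : X, Relation.EqvGen (fun u v => v = M.σ u ∨ v = M.α u) x y

/-- The surface carrying the (connected) graph is a sphere. -/
def Spherical : Prop :=
  Nat.card M.Vertex + Nat.card M.Face = Nat.card M.Edge + 2

end CombMap

/-- The sides of the faces of a truncated ideal polyhedron.
* `edge x`: the interior edge carrying the dart `x`, seen from the interior face to its left;
* `corner x`: the boundary edge that truncates the corner `x`, seen from the interior face
  containing that corner;
* `bdry x`: the same boundary edge, seen from the boundary face at the vertex of `x`. -/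
inductive Side (X : Type*)
  | edge (x : X)
  | corner (x : X)
  | bdry (x : X)

/-- The side belongs to an interior face. -/
def Side.Interior {X : Type*} : Side X → Prop
  | .edge _ => True
  | .corner _ => True
  | .bdry _ => False

namespace CombMap

variable {X : Type*} (M : CombMap X)

/-- The same edge of the truncated polyhedron, seen from the face on the other side. -/
def flip : Side X → Side X
  | .edge x => .edge (M.α x)
  | .corner x => .bdry x
  | .bdry x => .corner x

/-- Two sides belong to the same face of the truncated polyhedron. -/
def OnFace : Side X → Side X → Prop
  | .edge x, .edge y => M.SameFace x y
  | .edge x, .corner y => M.SameFace x y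
  | .corner x, .edge y => M.SameFace x y
  | .corner x, .corner y => M.SameFace x y
  | .bdry x, .bdry y => M.SameVertex x y
  | _, _ => False

/-- An interior edge and a boundary edge that share an endpoint. -/
def Adjacent : Side X → Side X → Prop
  | .edge x, .corner y =>
      y = x ∨ y = M.σ⁻¹ x ∨ y = M.α x ∨ y = M.σ⁻¹ (M.α x)
  | _, _ => False

/-- A segment inside one face, running from the side `s` to the side `t`, whose endpoints are
neither on the same edge nor on an interior edge and an adjacent boundary edge. -/
def IsSegment (s t : Side X) : Prop :=
  M.OnFace s t ∧ t ≠ s ∧ t ≠ M.flip s ∧ ¬ M.Adjacent s t ∧ ¬ M.Adjacent t s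

/-- Compatibility of two consecutive steps of the boundary of an admissible disk.  A step `some s`
crosses an edge of the truncated polyhedron, leaving a face through its side `s`; a step `none`
leaves the surface of the polyhedron at an interior point of an interior face, runs through the
interior of the polyhedron, and comes back at an interior point of an interior face. -/
def Follows : Option (Side X) → Option (Side X) → Prop
  | some s, some t => M.IsSegment (M.flip s) t
  | some s, none => (M.flip s).Interior
  | none, some t => t.Interior
  | none, none => True

/-- An admissible disk in the truncated ideal polyhedron, recorded through its oriented boundary
`∂D`: the cyclic sequence of the edges that `∂D` crosses and of the arcs of `∂D` that run through
the interior of the polyhedron.  The curve may be merely immersed: edges and faces may be visited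
repeatedly. -/
structure AdmDisk where
  k : ℕ
  step : Fin (k + 1) → Option (Side X)
  follows : ∀ i, M.Follows (step i) (step (i + 1))

namespace AdmDisk

variable {M}
variable (D : M.AdmDisk)

/-- The number of interior edges crossed by `∂D`, with multiplicity. -/
def numEdges : ℕ :=
  (Finset.univ.filter fun i : Fin (D.k + 1) => ∃ x, D.step i = some (.edge x)).card

/-- The number of segments of `∂D` in boundary faces, i.e. of components of `∂D ∩ ∂M`; each is
entered exactly once. -/
def numBdry : ℕ :=
  (Finset.univ.filter fun i : Fin (D.k + 1) => ∃ x, D.step i = some (.corner x)).card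

/-- The number of components of `∂D \ ∂P`. -/
def numFree : ℕ :=
  (Finset.univ.filter fun i : Fin (D.k + 1) => D.step i = none).card

/-- The combinatorial area, for a right-angled polyhedron: every external dihedral angle
is `π / 2`. -/
def area : ℝ :=
  D.numEdges * (Real.pi / 2) + Real.pi * D.numBdry - 2 * Real.pi + 3 * Real.pi * D.numFree

/-- The length, relative to `D`, of any one of the boundary segments of `∂D`. -/
def relLength : ℝ := D.area / D.numBdry

/-- Suppose that `∂D` enters a boundary face at step `p`.  This is the other end of the segment of
`∂D` that leads there, as a side of its interior face (`none`: an interior point of the face). -/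
def before (p : Fin (D.k + 1)) : Option (Side X) := (D.step (p - 1)).map M.flip

/-- Suppose that `∂D` enters a boundary face at step `p`, and so leaves it at step `p + 1`.  This
is the other end of the segment of `∂D` that follows, as a side of its interior face
(`none`: an interior point of the face). -/
def after (p : Fin (D.k + 1)) : Option (Side X) := D.step (p + 1 + 1)

end AdmDisk

end CombMap

/-! ## Link diagrams -/

/-- A link diagram on the sphere: a connected 4-valent graph with over-under information.
`isOver d` says that the strand through the dart `d` is the upper one at its crossing. -/
structure LinkDiagram (D : Type*) extends CombMap D where
  four : ∀ d, σ (σ (σ (σ d))) = d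
  two_ne : ∀ d, σ (σ d) ≠ d
  connected : toCombMap.Connected
  spherical : toCombMap.Spherical
  isOver : D → Prop
  over_next : ∀ d, isOver (σ d) ↔ ¬ isOver d

namespace LinkDiagram

variable {D : Type*} (L : LinkDiagram D)

/-- The face to the left of `d` is a bigon. -/
def IsBigon (d : D) : Prop := L.φ (L.φ d) = d ∧ L.φ d ≠ d

/-- The edge of `d` is not on the boundary of any bigon. -/
def External (d : D) : Prop := ¬ L.IsBigon d ∧ ¬ L.IsBigon (L.α d)

/-- The diagram is prime.  A simple closed curve that meets the graph transversely in two points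
crosses the edges of two darts `d` and `d'` that have the same face on their left and the same face
on their right.  If these edges are distinct, there are crossings on both sides of the curve;
if they coincide, one side contains only a piece of that edge. -/
def IsPrime : Prop :=
  ∀ d d', L.SameFace d d' → L.SameFace (L.α d) (L.α d') → d = d'

/-- Pass from the bigon at the corner `d` through the crossing at its other end, to the opposite
corner there. -/
def nextInRow (d : D) : D := L.σ (L.σ (L.φ d))

/-- The corner `d` starts a row of bigons arranged end to end that leads to the crossing
of `d'`. -/
def BigonRow (d d' : D) : Prop :=
  ∃ k : ℕ, (∀ i ≤ k, L.IsBigon (L.nextInRow^[i] d)) ∧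
    L.SameVertex (L.φ (L.nextInRow^[k] d)) d'

/-- The diagram is twist-reduced.  A simple closed curve that crosses the edges of `d` and `σ d`
next to one crossing, and the edges of `d'` and `σ d'` next to another one, exists when the faces
between these two pairs of points agree; then the two crossings are joined by a row of bigons,
which starts at the corner `d` or at the opposite corner.  (Replacing `d'` by `σ (σ d')` gives the
curves that pass the two crossings on different sides.) -/
def IsTwistReduced : Prop :=
  ∀ d d', ¬ L.SameVertex d d' →
    L.SameFace (L.σ⁻¹ d) (L.σ d') → L.SameFace (L.σ d) (L.σ⁻¹ d') →
    L.BigonRow d d' ∨ L.BigonRow (L.σ (L.σ d)) d'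

/-- The crossings of `d` and `d'` are in the same twist region: they are connected through
bigons. -/
def SameRegion : D → D → Prop :=
  Relation.EqvGen fun u v => v = L.σ u ∨ (L.IsBigon u ∧ v = L.α u)

/-- There are at least two twist regions. -/
def TwoRegions : Prop := ∃ d d', ¬ L.SameRegion d d'

/-- The number of crossings in the twist region of `d`. -/
def crossings (d : D) : ℕ :=
  Set.ncard ((Quotient.mk (Equiv.Perm.SameCycle.setoid L.σ)) '' {d' | L.SameRegion d d'})

/-- Follow a component of the link: along the edge of `d`, then straight through the crossing. -/
def walk : Equiv.Perm D := L.σ * L.σ * L.α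

/-- The number of twist regions visited, with multiplicity, by the component of the link through
the edge of `d`.  In one turn around the component, every visit ends with its leaving the twist
region along an edge that is on no bigon, and it passes each of its edges once. -/
def visits (d : D) : ℕ := Set.ncard {d' | L.walk.SameCycle d d' ∧ L.External d'}

/-- The direction of every twist region: `ends` is the set of the corners that face the two ends
of the twist region.  At each crossing these are two opposite corners, and they contain all bigons,
so there is a choice only at a crossing adjacent to no bigons.  The crossing circle passes through
the faces at the two other corners, and encircles the two strands that leave through one end. -/
structure Direction where
  ends : Set D
  ends_next : ∀ d, L.σ d ∈ ends ↔ d ∉ ends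
  bigon_mem : ∀ d, L.IsBigon d → d ∈ ends

theorem bigon_face {d : D} (h : L.IsBigon d) : L.IsBigon (L.φ d) :=
  ⟨by rw [h.1], by rw [h.1]; exact h.2.symm⟩

theorem α_eq (d : D) : L.α d = L.σ (L.φ d) := by
  simp [CombMap.φ]

/-- Cross a bigon to the opposite corner of the bigon; other corners are fixed. -/
def crossBigon : Equiv.Perm D :=
  Function.Involutive.toPerm (fun d => if L.IsBigon d then L.φ d else d) (by
    intro d
    by_cases h : L.IsBigon d
    · have h' := L.bigon_face h
      simp [h, h', h.1]
    · simp [h])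

end LinkDiagram

/-! ## First return maps -/

/-- The first point after `c` of the `g`-orbit of `c` at which `S` holds. -/
def firstReturn {X : Type*} [Finite X] (g : Equiv.Perm X) (S : X → Prop) (c : {c // S c}) :
    {c // S c} :=
  have h : ∃ k, 0 < k ∧ S ((g ^ k) c.1) :=
    ⟨orderOf g, orderOf_pos g, by rw [pow_orderOf_eq_one]; exact c.2⟩
  ⟨(g ^ Nat.find h) c.1, (Nat.find_spec h).2⟩

theorem firstReturn_spec {X : Type*} [Finite X] (g : Equiv.Perm X) (S : X → Prop)
    (c : {c // S c}) : ∃ k, 0 < k ∧ (firstReturn g S c).1 = (g ^ k) c.1 ∧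
      ∀ j, 0 < j → j < k → ¬ S ((g ^ j) c.1) := by
  have h : ∃ k, 0 < k ∧ S ((g ^ k) c.1) :=
    ⟨orderOf g, orderOf_pos g, by rw [pow_orderOf_eq_one]; exact c.2⟩
  exact ⟨Nat.find h, (Nat.find_spec h).1, rfl, fun j hj hlt hS => Nat.find_min h hlt ⟨hj, hS⟩⟩

theorem firstReturn_injective {X : Type*} [Finite X] (g : Equiv.Perm X) (S : X → Prop) :
    Function.Injective (firstReturn g S) := by
  have key : ∀ (a b : {c // S c}) (k l : ℕ), k ≤ l → 0 < k → (g ^ k) a.1 = (g ^ l) b.1 →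
      (∀ j, 0 < j → j < l → ¬ S ((g ^ j) b.1)) → a = b := by
    intro a b k l hkl hk he hmin
    obtain ⟨m, rfl⟩ := Nat.exists_eq_add_of_le hkl
    have h1 : a.1 = (g ^ m) b.1 := by
      apply (g ^ k).injective
      rw [he, pow_add]; rfl
    rcases Nat.eq_zero_or_pos m with h0 | h0
    · subst h0; exact Subtype.ext (by simpa using h1)
    · exact absurd (h1 ▸ a.2) (hmin m h0 (by omega))
  intro a b hab
  obtain ⟨k, hk, hka, hkm⟩ := firstReturn_spec g S a
  obtain ⟨l, hl, hlb, hlm⟩ := firstReturn_spec g S b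
  have he : (g ^ k) a.1 = (g ^ l) b.1 := by rw [← hka, ← hlb, hab]
  rcases le_total k l with h | h
  · exact key a b k l h hk he hlm
  · exact (key b a l k h hl he.symm hkm).symm

/-! ## The polyhedron of the augmented link -/

/-- The three ideal vertices of a shaded triangle: the crossing circle and two strands. -/
inductive Pos
  | circ
  | fst
  | snd

/-- Counterclockwise rotation of a shaded triangle. -/
def Pos.next : Pos → Pos
  | .circ => .fst
  | .fst => .snd
  | .snd => .circ

/-- Clockwise rotation of a shaded triangle. -/
def Pos.prev : Pos → Pos
  | .circ => .snd
  | .fst => .circ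
  | .snd => .fst

/-- The reflection of a shaded triangle that fixes the crossing circle. -/
def Pos.mirror : Pos → Pos
  | .circ => .circ
  | .fst => .snd
  | .snd => .fst

namespace LinkDiagram

namespace Direction

variable {D : Type*} {L : LinkDiagram D} (A : L.Direction)

/-- The outer end of a twist region, at the corner `c`. -/
def IsTip (c : D) : Prop := c ∈ A.ends ∧ ¬ L.IsBigon c

/-- The outer ends of the twist regions, two for each of them.  They index the shaded triangles:
the half of the crossing disk above the projection plane gives one shaded triangle for each of its
two sides, one facing each end of the twist region. -/
abbrev Tip : Type _ := {c : D // A.IsTip c}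

/-- The corners of the shaded triangles. -/
abbrev Shaded : Type _ := A.Tip × Pos

/-- The other end of the same twist region: walk along the row of bigons. -/
def otherTip [Finite D] : Equiv.Perm A.Tip :=
  Equiv.ofBijective (firstReturn (L.σ * L.σ * L.crossBigon) A.IsTip)
    (Finite.injective_iff_bijective.mp (firstReturn_injective _ _))

/-- The dart on which a strand vertex of a shaded triangle lies (junk at crossing circles). -/
def dartOf : A.Shaded → D
  | (c, .circ) => c.1
  | (c, .fst) => c.1
  | (c, .snd) => L.σ c.1

theorem not_bigon_of_not_mem {d : D} (h : d ∉ A.ends) : ¬ L.IsBigon d :=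
  fun hb => h (A.bigon_mem d hb)

theorem bigon_prev_iff (d : D) : L.IsBigon (L.σ⁻¹ d) ↔ L.IsBigon (L.α d) := by
  have h : L.φ (L.α d) = L.σ⁻¹ d := by
    simp [CombMap.φ, L.α_invol]
  constructor
  · intro hb
    rw [← h] at hb
    have h1 := hb.1
    have h2 : L.φ (L.φ (L.α d)) = L.α d := L.φ.injective h1
    refine ⟨h2, fun h3 => hb.2 ?_⟩
    rw [h3, h3]
  · intro hb
    rw [← h]
    exact L.bigon_face hb

theorem external_dartOf (q : A.Shaded) : L.External (A.dartOf q) := by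
  obtain ⟨⟨c, hc⟩, p⟩ := q
  have hfst : L.External c := by
    refine ⟨hc.2, fun hb => ?_⟩
    have h1 := A.bigon_mem _ ((bigon_prev_iff c).mpr hb)
    have h2 := (A.ends_next (L.σ⁻¹ c)).mp (by simpa using hc.1)
    exact h2 h1
  cases p
  · exact hfst
  · exact hfst
  · refine ⟨fun hb => ?_, fun hb => ?_⟩
    · exact (A.ends_next c).mp (A.bigon_mem _ hb) hc.1
    · have h1 := (bigon_prev_iff (L.σ c)).mpr hb
      exact hc.2 (by simpa using h1)

/-- The strand vertex of a shaded triangle that lies on an external dart. -/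
def locate (d : D) (hd : L.External d) : A.Shaded :=
  if h : d ∈ A.ends then (⟨d, h, hd.1⟩, .fst)
  else (⟨L.σ⁻¹ d, by
    constructor
    · by_contra h'
      exact h (by simpa using (A.ends_next (L.σ⁻¹ d)).mpr h')
    · exact fun hb => hd.2 ((bigon_prev_iff d).mp hb)⟩, .snd)

theorem external_α {d : D} (h : L.External d) : L.External (L.α d) :=
  ⟨h.2, by rw [L.α_invol]; exact h.1⟩

theorem dartOf_locate (d : D) (hd : L.External d) : A.dartOf (A.locate d hd) = d := by
  unfold locate
  split_ifs <;> simp [dartOf]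

theorem locate_ne_circ (d : D) (hd : L.External d) : (A.locate d hd).2 ≠ .circ := by
  unfold locate
  split_ifs <;> simp

/-- The shaded corner on the other side of the same ideal vertex: at a crossing circle, the
corner of the triangle at the other end of the twist region; at a strand, the corner at the other
end of the same edge of the diagram. -/
def oppositeFun [Finite D] : A.Shaded → A.Shaded
  | (c, .circ) => (A.otherTip c, .circ)
  | (c, .fst) => A.locate (L.α c.1) (external_α (A.external_dartOf (c, .fst)))
  | (c, .snd) => A.locate (L.α (L.σ c.1)) (external_α (A.external_dartOf (c, .snd)))

theorem oppositeFun_injective [Finite D] : Function.Injective A.oppositeFun := by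
  have hloc : ∀ d d' hd hd', A.locate (L.α d) hd = A.locate (L.α d') hd' → d = d' := by
    intro d d' hd hd' h
    have := congrArg A.dartOf h
    rw [dartOf_locate, dartOf_locate] at this
    exact L.α.injective this
  rintro ⟨c, p⟩ ⟨c', p'⟩ h
  cases p <;> cases p' <;> simp only [oppositeFun] at h
  · have := (Prod.ext_iff.mp h).1
    rw [A.otherTip.injective this]
  · exact absurd (congrArg Prod.snd h).symm (A.locate_ne_circ _ _)
  · exact absurd (congrArg Prod.snd h).symm (A.locate_ne_circ _ _)
  · exact absurd (congrArg Prod.snd h) (A.locate_ne_circ _ _)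
  · rw [Subtype.ext (hloc _ _ _ _ h)]
  · have h1 := hloc _ _ _ _ h
    exact absurd c'.2.1 ((A.ends_next c'.1).mp (h1 ▸ c.2.1))
  · exact absurd (congrArg Prod.snd h) (A.locate_ne_circ _ _)
  · have h1 := hloc _ _ _ _ h
    exact absurd c.2.1 ((A.ends_next c.1).mp (h1 ▸ c'.2.1))
  · rw [Subtype.ext (L.σ.injective (hloc _ _ _ _ h))]

/-- `oppositeFun` as a permutation. -/
def opposite [Finite D] : Equiv.Perm A.Shaded :=
  haveI : Finite Pos :=
    Finite.of_injective (β := Fin 3)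
      (fun p => match p with | .circ => 0 | .fst => 1 | .snd => 2)
      (by intro a b; cases a <;> cases b <;> simp)
  Equiv.ofBijective A.oppositeFun
    (Finite.injective_iff_bijective.mp A.oppositeFun_injective)

/-- The darts of the polyhedron.  At its ideal vertex, the corner `q` of a shaded triangle lies
between the darts `(q, false)` and `(q, true)`, in counterclockwise order.  So the corner
`(q, false)` of the polyhedron is the shaded corner `q`, and the corner `(q, true)` is the white
corner that comes next at this ideal vertex. -/
abbrev Dart : Type _ := A.Shaded × Bool

/-- The ideal polyhedron `P₁` above the projection plane (`P₂` is its mirror image).  Its shaded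
faces are triangles.  Every edge is a side of exactly one of them; the dart `(q, false)` runs along
the side from the corner `q` to the next corner of the triangle.  Around an ideal vertex, shaded
and white corners alternate. -/
def poly [Finite D] : CombMap A.Dart where
  σ :=
    { toFun := fun x => match x with
        | (q, false) => (q, true)
        | (q, true) => (A.opposite q, false)
      invFun := fun x => match x with
        | (q, true) => (q, false)
        | (q, false) => (A.opposite.symm q, true)
      left_inv := by rintro ⟨q, _ | _⟩ <;> simp
      right_inv := by rintro ⟨q, _ | _⟩ <;> simp }
  α :=
    Function.Involutive.toPerm
      (fun x => match x with
        | ((c, p), false) => ((c, p.next), true)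
        | ((c, p), true) => ((c, p.prev), false))
      (by rintro ⟨⟨c, _ | _ | _⟩, _ | _⟩ <;> rfl)
  α_invol := by rintro ⟨⟨c, _ | _ | _⟩, _ | _⟩ <;> rfl
  α_ne := by rintro ⟨⟨c, _ | _ | _⟩, _ | _⟩ <;> simp [Function.Involutive.toPerm]

/-! ## Gluing the two polyhedra to the exterior of the augmented link

The levels `true` and `false` stand for `P₁` and `P₂`; both use the labels of `P₁`. -/

/-- In `J` there is a half-twist (a single crossing) at the crossing circle. -/
def HalfTwist (c : A.Tip) : Prop := Odd (L.crossings c.1)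

/-- The gluing of the sides of interior faces, as far as the labels are concerned.  White faces are
glued by the identity.  The shaded triangle at one end of a twist region is glued to the one at the
other end, matching the crossing circles: without a half-twist by the reflection that joins the
strands running along the same side of the twist region, with a half-twist by the rotation that
joins strands at opposite corners of the twist region. -/
def glueSide [Finite D] : Side A.Dart → Side A.Dart
  | .edge ((c, p), false) =>
      if A.HalfTwist c then .edge ((A.otherTip c, p), false)
      else .edge ((A.otherTip c, p.next.mirror), false)
  | .corner ((c, p), false) =>
      if A.HalfTwist c then .corner ((A.otherTip c, p), false)
      else .corner ((A.otherTip c, p.mirror), false)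
  | .bdry ((c, p), false) =>
      if A.HalfTwist c then .bdry ((A.otherTip c, p), false)
      else .bdry ((A.otherTip c, p.mirror), false)
  | s => s

/-- The gluing of the boundary edges of the truncated polyhedra, with their levels.  White faces of
one polyhedron are glued to white faces of the other one; shaded faces are glued within one
polyhedron, except at half-twists. -/
def glue [Finite D] : A.Dart × Bool → A.Dart × Bool
  | (((c, p), false), l) =>
      if A.HalfTwist c then (((A.otherTip c, p), false), !l)
      else (((A.otherTip c, p.mirror), false), l)
  | ((q, true), l) => ((q, true), !l)

/-- The edges `x` and `y` of boundary faces (with their levels) lie on the same boundary torus of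
the exterior of `J`. -/
def SameTorus [Finite D] : A.Dart × Bool → A.Dart × Bool → Prop :=
  Relation.EqvGen fun x y => y = (A.poly.σ x.1, x.2) ∨ y = A.glue x

/-! ## Curves on the boundary tori -/

/-- A segment in a boundary face: it runs in the polyhedron `level` from the boundary edge that
truncates the corner `enter` to the one that truncates the corner `exit`. -/
structure Seg where
  level : Bool
  enter : A.Dart
  exit : A.Dart

/-- A cyclic sequence of segments in boundary faces. -/
structure Curve where
  m : ℕ
  seg : Fin (m + 1) → A.Seg

/-- The segments fit together to a closed simplicial curve. -/
def IsSimplicial [Finite D] (γ : A.Curve) : Prop :=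
  ∀ i, A.poly.IsSegment (.bdry (γ.seg i).enter) (.bdry (γ.seg i).exit) ∧
    A.glue ((γ.seg i).exit, (γ.seg i).level)
      = ((γ.seg (i + 1)).enter, (γ.seg (i + 1)).level)

/-- The curve lies on the boundary torus that contains the boundary face edge `z`. -/
def OnTorus [Finite D] (z : A.Dart × Bool) (γ : A.Curve) : Prop :=
  ∀ i, A.SameTorus z ((γ.seg i).enter, (γ.seg i).level)

/-- The change of direction along a segment, in quarter turns to the left.  The four sides of a
boundary rectangle of `P₁` are in counterclockwise order, those of `P₂` in clockwise order. -/
def turn [Finite D] (g : A.Seg) : ZMod 4 :=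
  (if g.exit = A.poly.σ g.enter then -1 else if g.exit = A.poly.σ⁻¹ g.enter then 1 else 0) *
    (if g.level then 1 else -1)

/-- The unit steps of the square lattice with basis `𝐬 = (1, 0)`, `𝐰 = (0, 1)`, in the directions
`𝐰`, `𝐬`, `-𝐰`, `-𝐬`. -/
def unitStep (e : ZMod 4) : ℤ × ℤ :=
  if e = 0 then (0, 1) else if e = 1 then (1, 0) else if e = 2 then (0, -1) else (-1, 0)

/-- The direction in which the lift of the curve to the universal cover enters its first
rectangle: `𝐰` if it crosses an edge on a shaded face, `𝐬` if it crosses an edge on a white face. -/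
def startDir (γ : A.Curve) : ZMod 4 := if (γ.seg 0).enter.2 then 1 else 0

/-- The translation `(a, b) = a 𝐬 + b 𝐰` of the universal cover of the torus that belongs to the
closed curve, where `𝐬` is a step parallel to a shaded face (from one white face to the next) and
`𝐰` is a step parallel to a white face.  The lift of the curve runs through a square lattice, and
each time it leaves a rectangle it takes a unit step.  (As the directions of `𝐬` and `𝐰` are
fixed by the beginning of the curve, `(a, b)` depends on the free homotopy class only up to a
common sign.) -/
def disp [Finite D] (γ : A.Curve) : ℤ × ℤ :=
  ∑ i, unitStep (A.startDir γ + ∑ j ∈ Finset.univ.filter (· ≤ i), A.turn (γ.seg j))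

/-- The fundamental group of a boundary torus, as a group of translations `a 𝐬 + b 𝐰` of its
universal cover. -/
def lattice [Finite D] (z : A.Dart × Bool) : Set (ℤ × ℤ) :=
  {x | ∃ γ, A.IsSimplicial γ ∧ A.OnTorus z γ ∧ (A.disp γ = x ∨ A.disp γ = -x)}

/-- A slope on a boundary torus: a primitive element of the fundamental group (up to sign). -/
def IsSlope [Finite D] (z : A.Dart × Bool) (x : ℤ × ℤ) : Prop :=
  x ∈ A.lattice z ∧ x ≠ 0 ∧ ∀ y ∈ A.lattice z, ∀ k : ℤ, x = k • y → k = 1 ∨ k = -1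

/-! ## Combinatorial length -/

/-- An inward extension of a closed simplicial curve: for every segment of the curve an admissible
disk whose boundary contains the segment (entering the boundary face at step `pos i`), such that
the boundaries of consecutive disks agree on the shared face. -/
structure InwardExtension [Finite D] (γ : A.Curve) where
  disk : Fin (γ.m + 1) → A.poly.AdmDisk
  pos : ∀ i, Fin ((disk i).k + 1)
  enter : ∀ i, (disk i).step (pos i) = some (.corner (γ.seg i).enter)
  exit : ∀ i, (disk i).step (pos i + 1) = some (.bdry (γ.seg i).exit)
  agree : ∀ i, (disk (i + 1)).before (pos (i + 1))
    = ((disk i).after (pos i)).map A.glueSide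

/-- The combinatorial length of a closed simplicial curve. -/
def curveLength [Finite D] (γ : A.Curve) : ℝ :=
  sInf {r | ∃ H : A.InwardExtension γ, r = ∑ i, (H.disk i).relLength}

/-- The combinatorial length of a slope: the infimum over all closed simplicial curves that
represent non-zero multiples of the slope. -/
def slopeLength [Finite D] (z : A.Dart × Bool) (x : ℤ × ℤ) : ℝ :=
  sInf {r | ∃ γ, A.IsSimplicial γ ∧ A.OnTorus z γ ∧
    (∃ k : ℤ, k ≠ 0 ∧ A.disp γ = k • x) ∧ r = A.curveLength γ}

/-! ## Meridians, longitudes and surgery slopes -/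

/-- A place on the torus around the strand of the link that contains the external dart `d`. -/
def strandTorus (d : D) (hd : L.External d) : A.Dart × Bool := ((A.locate d hd, true), true)

/-- The meridian of this strand: it crosses the boundary face of `P₁` at the edge of `d` from one
white face to the other one, and comes back through `P₂`. -/
def strandMeridian [Finite D] (d : D) (hd : L.External d) : A.Curve where
  m := 1
  seg := ![⟨true, (A.locate d hd, true), (A.opposite (A.locate d hd), true)⟩,
    ⟨false, (A.opposite (A.locate d hd), true), (A.locate d hd, true)⟩]

/-- A non-trivial surgery slope on this torus: any slope other than the meridian. -/
def IsNontrivialSlope [Finite D] (d : D) (hd : L.External d) (x : ℤ × ℤ) : Prop :=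
  A.IsSlope (A.strandTorus d hd) x ∧
    x ≠ A.disp (A.strandMeridian d hd) ∧ x ≠ -A.disp (A.strandMeridian d hd)

/-- A place on the torus of the crossing circle around the twist region with the end `c`. -/
def circleTorus (c : A.Tip) : A.Dart × Bool := (((c, .circ), true), true)

/-- The longitude of the crossing circle: once along the circle, through `P₁` and `P₂`. -/
def circleLongitude [Finite D] (c : A.Tip) : A.Curve where
  m := 1
  seg := ![⟨true, ((c, .circ), true), ((A.otherTip c, .circ), true)⟩,
    ⟨false, ((A.otherTip c, .circ), true), ((c, .circ), true)⟩]

/-- The signed number of crossings of `J` at the crossing circle: `0` without a half-twist, and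
otherwise `1` or `-1` according to the direction of the twist.  (Draw the twist region horizontally
with `c` at its left end, so that the dart `c` points to the upper left.  The sign is `-1` if the
strand that runs to the upper left is the upper one at its crossing.) -/
def residue (c : A.Tip) : ℤ :=
  if A.HalfTwist c then (if L.isOver c.1 then -1 else 1) else 0

/-- The meridian of the crossing circle in `J`.  It passes once through the crossing disk.  With a
half-twist, passing through the crossing disk changes between `P₁` and `P₂`, and the loop closes up
after running along half of the crossing circle, in the direction given by the twist. -/
def circleMeridian [Finite D] (c : A.Tip) : A.Curve :=
  if A.HalfTwist c then
    if L.isOver c.1 then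
      { m := 1
        seg := ![⟨false, ((A.otherTip c, .circ), false), ((c, .circ), true)⟩,
          ⟨true, ((c, .circ), true), ((c, .circ), false)⟩] }
    else
      { m := 1
        seg := ![⟨false, ((A.otherTip c, .circ), false), ((A.otherTip c, .circ), true)⟩,
          ⟨true, ((A.otherTip c, .circ), true), ((c, .circ), false)⟩] }
  else
    { m := 0
      seg := ![⟨true, ((A.otherTip c, .circ), false), ((c, .circ), false)⟩] }

/-- The surgery slope `1 / q` on the crossing circle: one meridian and `q` longitudes. -/
def circleSlope [Finite D] (c : A.Tip) (q : ℤ) : ℤ × ℤ :=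
  A.disp (A.circleMeridian c) + q • A.disp (A.circleLongitude c)

/-- The number of crossings in the twist region after surgery along the slope `1 / q` on the
crossing circle, which inserts `q` full twists, i.e. `2 q` signed crossings. -/
def crossingsAfter (c : A.Tip) (q : ℤ) : ℕ := (A.residue c + 2 * q).natAbs

/-- Some surgery slope `1 / q` restores the number of crossings of the diagram. -/
theorem exists_crossingsAfter (c : A.Tip) : ∃ q, A.crossingsAfter c q = L.crossings c.1 := by
  unfold crossingsAfter residue HalfTwist
  rcases Nat.even_or_odd' (L.crossings c.1) with ⟨k, hk | hk⟩
  · refine ⟨k, ?_⟩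
    rw [hk, if_neg (Nat.not_odd_iff_even.mpr (even_two_mul k))]
    omega
  · by_cases ho : L.isOver c.1
    · refine ⟨-k, ?_⟩
      rw [hk, if_pos ⟨k, rfl⟩, if_pos ho]
      omega
    · refine ⟨k, ?_⟩
      rw [hk, if_pos ⟨k, rfl⟩, if_neg ho]
      omega

end Direction

end LinkDiagram

end AugLink

end

noncomputable section

open Classical

namespace AugLink

/-! ### Combinatorial maps: edges and connectedness -/

namespace CombMap

variable {X : Type*} (M : CombMap X)

/-! The geometry of the polyhedron enters only through a short list of rules relating shaded
triangles and white faces (`Incidence`). White faces are faces of the diagram. An ideal vertex lies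
between two of them: the faces on both sides of an edge of the diagram (at a strand), or the faces
at two opposite corners of a crossing (at a crossing circle). The essential rule, `eq_of_white`, is
that this ordered pair of faces determines the shaded corner. Primeness proves it for two strands
and twist-reducedness for two crossing circles. A checkerboard colouring separates strands from
circles: faces across an edge have different colours, opposite corners of a crossing have equal
ones.

A disk with `E` edges, `B` boundary segments and `F` arcs through the interior has relative length
at least `π / 2` as soon as `E + B + 6 * F ≥ 4`. Of the remaining types, the incidence rules leave
only two (`disk_cases`). Either `E = 0` and `B = 2`: the disk runs around one interior edge and has
length `0`. Or `E = 0` and `B = 3`: it is an ideal triangle of relative length `π / 3`.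

Disks of length zero let a curve turn corners for free, so counting rectangles is useless. Instead a
point is tracked. Where the curve crosses a side of a boundary rectangle, mark an end of that side
if the disk continues in the interior face there to the neighbouring ideal vertex at that end, and
mark the midpoint otherwise. The mark depends only on the arc in a shared interior face, so
consecutive disks agree on it (`offset_glue`). A disk of length zero cuts off a corner of the
rectangle, and both of its marks are that corner: the point stays put (`offset_zero`). At an ideal
triangle the point moves parallel to a side, by at most one side length (`offset_triangle`). At any
other disk each coordinate changes by at most one side length. In coordinates where a side has
length 2, every disk of relative length `ℓ` that moves the point by `(u, v)` satisfies `(2|u| + |v|)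
* π / 12 ≤ ℓ` and `|v| * π / 6 ≤ ℓ`. Summing around a closed curve of displacement `a 𝐬 + b 𝐰` gives
the two bounds of `total_le`: the length is at least `|a| * π / 3 + |b| * π / 6`, and at least `|b|
* π / 3`.

On a crossing circle the slope `1 / q` has displacement `(r + 2 q, 1)` (`circleSlope_eq`), so the
first bound gives `n * π / 3 + π / 6`; the last term makes the inequality strict. On the torus of a
strand, a closed curve with `b ≠ 0` must climb through every rectangle level of the component, one
for each visit to a twist region, so `|b| ≥ n`. If `b = 0`, the curve returns to its polyhedron only
when `a` is even, so its displacement is a multiple of the meridian `(2, 0)` (`strand_total`). Hence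
a slope other than the meridian has `b ≠ 0`, and the second bound applies. -/

theorem φ_α (x : X) : M.φ (M.α x) = M.σ⁻¹ x := by
  simp [CombMap.φ, M.α_invol]

theorem φ_apply (x : X) : M.φ x = M.σ⁻¹ (M.α x) := rfl

theorem σ_φ (x : X) : M.σ (M.φ x) = M.α x := by
  simp [CombMap.φ]

theorem sameCycle_α {x y : X} (h : M.α.SameCycle x y) : y = x ∨ y = M.α x := by
  obtain ⟨k, rfl⟩ := h
  have h2 : M.α ^ (2 : ℤ) = 1 := by
    rw [zpow_ofNat, pow_two]
    ext x
    simp [M.α_invol]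
  rcases Int.even_or_odd' k with ⟨j, rfl | rfl⟩
  · left; rw [zpow_mul, h2]; simp
  · right; rw [zpow_add, zpow_mul, h2]; simp

/-- Functions on darts that are constant on the orbits of `σ` and `α` are constant. -/
theorem Connected.eq_of_invariant {M : CombMap X} (h : M.Connected) {β : Type*} {f : X → β}
    (hσ : ∀ x, f (M.σ x) = f x) (hα : ∀ x, f (M.α x) = f x) (x y : X) : f x = f y := by
  induction h x y with
  | rel x y h => rcases h with rfl | rfl <;> simp [hσ, hα]
  | refl x => rfl
  | symm x y _ ih => exact ih.symm
  | trans x y z _ _ ih1 ih2 => exact ih1.trans ih2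

/-! ### Checkerboard colourings by linear algebra modulo 2 -/

section Colouring

/-- The coboundary of a function on the orbits of a permutation: the sum of its values at the two
ends of an edge. -/
def coboundary (π : Equiv.Perm X) :
    (Quotient (Equiv.Perm.SameCycle.setoid π) → ZMod 2) →ₗ[ZMod 2] (M.Edge → ZMod 2) where
  toFun h e := Quotient.lift (s := Equiv.Perm.SameCycle.setoid M.α)
    (fun d => h (Quotient.mk _ d) + h (Quotient.mk _ (M.α d)))
    (by
      intro a b hab
      rcases M.sameCycle_α hab with rfl | rfl
      · rfl
      · simp only [M.α_invol]; rw [add_comm]) e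
  map_add' h h' := by
    ext e
    induction e using Quotient.inductionOn with | h d => ?_
    simp only [Quotient.lift_mk, Pi.add_apply]; ring
  map_smul' c h := by
    ext e
    induction e using Quotient.inductionOn with | h d => ?_
    simp only [Quotient.lift_mk, Pi.smul_apply, smul_eq_mul, RingHom.id_apply]; ring

theorem coboundary_mk (π : Equiv.Perm X) (h) (d : X) :
    M.coboundary π h (Quotient.mk _ d) = h (Quotient.mk _ d) + h (Quotient.mk _ (M.α d)) := rfl

/-- The kernel consists of the functions that agree across every edge. By connectedness these are
the constants, so it has dimension at most one. Used both for vertices and for faces. -/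
theorem finrank_range_coboundary [Finite X] (hc : M.Connected) (π : Equiv.Perm X)
    (hπ : ∀ {f : X → ZMod 2}, (∀ x, f (π x) = f x) → (∀ x, f (M.α x) = f x) →
      ∀ x, f (M.σ x) = f x) :
    Nat.card (Quotient (Equiv.Perm.SameCycle.setoid π)) ≤
      Module.finrank (ZMod 2) (LinearMap.range (M.coboundary π)) + 1 := by
  have := Fintype.ofFinite (Quotient (Equiv.Perm.SameCycle.setoid π))
  have h1 := LinearMap.finrank_range_add_finrank_ker (M.coboundary π)
  rw [Module.finrank_fintype_fun_eq_card] at h1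
  have h2 : Module.finrank (ZMod 2) (LinearMap.ker (M.coboundary π)) ≤ 1 := by
    refine finrank_le_one_iff.mpr ?_
    by_cases hne : Nonempty X
    · obtain ⟨x0⟩ := hne
      refine ⟨⟨fun _ => 1, ?_⟩, ?_⟩
      · ext e
        induction e using Quotient.inductionOn with | h d => ?_
        rw [coboundary_mk]; exact CharTwo.add_self_eq_zero _
      · rintro ⟨f, hf⟩
        refine ⟨f (Quotient.mk _ x0), Subtype.ext ?_⟩
        ext v
        induction v using Quotient.inductionOn with | h d => ?_
        have ha : ∀ x, f (Quotient.mk _ (M.α x)) = f (Quotient.mk _ x) := by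
          intro x
          have := congrFun hf (Quotient.mk _ x)
          rw [coboundary_mk] at this
          exact (CharTwo.add_eq_zero.mp this).symm
        have hp : ∀ x, f (Quotient.mk _ (π x)) = f (Quotient.mk _ x) := by
          intro x
          congr 1
          exact Quotient.sound (s := Equiv.Perm.SameCycle.setoid π)
            ((Equiv.Perm.sameCycle_apply_left).mpr (Equiv.Perm.SameCycle.refl _ _))
        have := hc.eq_of_invariant (f := fun x => f (Quotient.mk _ x))
          (hπ (f := fun x => f (Quotient.mk _ x)) hp ha) ha x0 d
        simpa using this
    · refine ⟨0, fun w => ⟨0, Subtype.ext ?_⟩⟩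
      ext v
      induction v using Quotient.inductionOn with | h d => exact absurd ⟨d⟩ hne
  rw [Nat.card_eq_fintype_card]
  omega

theorem sum_edges [Fintype X] [Fintype M.Edge] (f : X → ZMod 2) (g : M.Edge → ZMod 2)
    (h : ∀ d, g (Quotient.mk _ d) = f d + f (M.α d)) : ∑ e, g e = ∑ d, f d := by
  rw [← Finset.sum_fiberwise (s := Finset.univ) (g := fun d : X => (Quotient.mk _ d : M.Edge))]
  refine Finset.sum_congr rfl fun e _ => ?_
  induction e using Quotient.inductionOn with | h d => ?_
  have : (Finset.univ.filter fun x : X => (Quotient.mk _ x : M.Edge) = Quotient.mk _ d)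
      = {d, M.α d} := by
    ext x
    simp only [Finset.mem_filter, Finset.mem_univ, true_and, Finset.mem_insert,
      Finset.mem_singleton]
    constructor
    · intro hx
      exact M.sameCycle_α (Quotient.exact (s := Equiv.Perm.SameCycle.setoid M.α) hx).symm
    · rintro (rfl | rfl)
      · rfl
      · exact Quotient.sound (s := Equiv.Perm.SameCycle.setoid M.α)
          ((Equiv.Perm.sameCycle_apply_left).mpr (Equiv.Perm.SameCycle.refl _ _))
  rw [this, Finset.sum_pair (M.α_ne d).symm, h]

/-- The faces of a connected graph on the sphere all of whose vertices have even degree have a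
checkerboard colouring. -/
theorem exists_checkerboard [Finite X] (hc : M.Connected) (hs : M.Spherical)
    (ι : X → X) (hι : ∀ x, ι (ι x) = x) (hne : ∀ x, ι x ≠ x) (hv : ∀ x, M.SameVertex x (ι x)) :
    ∃ ε : X → ZMod 2, (∀ x, ε (M.φ x) = ε x) ∧ ∀ x, ε (M.α x) = ε x + 1 := by
  have := Fintype.ofFinite X
  have := Fintype.ofFinite M.Edge
  have := Fintype.ofFinite M.Vertex
  have := Fintype.ofFinite M.Face
  set a := M.coboundary M.σ
  set b := M.coboundary M.φ
  have hmkσ : ∀ x, (Quotient.mk _ (M.σ x) : M.Vertex) = Quotient.mk _ x := fun x =>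
    Quotient.sound (s := Equiv.Perm.SameCycle.setoid M.σ)
      ((Equiv.Perm.sameCycle_apply_left).mpr (Equiv.Perm.SameCycle.refl _ _))
  have hmkφ : ∀ x, (Quotient.mk _ (M.φ x) : M.Face) = Quotient.mk _ x := fun x =>
    Quotient.sound (s := Equiv.Perm.SameCycle.setoid M.φ)
      ((Equiv.Perm.sameCycle_apply_left).mpr (Equiv.Perm.SameCycle.refl _ _))
  have hra := M.finrank_range_coboundary hc M.σ (fun h _ => h)
  have hrb := M.finrank_range_coboundary hc M.φ (fun {f} h h' x => by
    have h1 := h (M.α (M.σ x))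
    rw [M.φ_α, h'] at h1
    simpa using h1.symm)
  -- the annihilator of the vertex coboundaries
  set c : (M.Edge → ZMod 2) →ₗ[ZMod 2] (M.Vertex → ZMod 2) :=
    (LinearMap.toMatrix' a).transpose.mulVecLin with hcdef
  -- `c` is the transpose of `a`, so its kernel is the annihilator of the vertex coboundaries, that
  -- is, the mod 2 cycle space.
  have hker : ∀ g, (∀ h, ∑ e, a h e * g e = 0) → c g = 0 := by
    intro g hg
    ext v
    have := hg (Pi.single v 1)
    rw [hcdef, Matrix.mulVecLin_apply, Matrix.mulVec, dotProduct]
    simpa [LinearMap.toMatrix'_apply] using this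
  have hrc : Module.finrank (ZMod 2) (LinearMap.range c)
      = Module.finrank (ZMod 2) (LinearMap.range a) := by
    have h1 : Module.finrank (ZMod 2) (LinearMap.range c)
        = (LinearMap.toMatrix' a).transpose.rank := rfl
    have h2 : Module.finrank (ZMod 2) (LinearMap.range a) = (LinearMap.toMatrix' a).rank := by
      rw [Matrix.rank, ← Matrix.toLin'_apply', Matrix.toLin'_toMatrix']
    rw [h1, h2, Matrix.rank_transpose]
  have hpair : ∀ (h : M.Vertex → ZMod 2) (g : M.Edge → ZMod 2),
      ∑ e, a h e * g e = ∑ d : X, h (Quotient.mk _ d) * g (Quotient.mk _ d) := by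
    intro h g
    refine M.sum_edges (fun d => h (Quotient.mk _ d) * g (Quotient.mk _ d)) _ fun d => ?_
    have : (Quotient.mk _ (M.α d) : M.Edge) = Quotient.mk _ d :=
      Quotient.sound (s := Equiv.Perm.SameCycle.setoid M.α)
        ((Equiv.Perm.sameCycle_apply_left).mpr (Equiv.Perm.SameCycle.refl _ _))
    simp only [a, coboundary_mk, this]; ring
  -- Boundaries of faces are cycles: around a vertex every corner is counted once from each of its
  -- two darts, which `σ` interchanges in the sum.
  have hle : LinearMap.range b ≤ LinearMap.ker c := by
    rintro _ ⟨f, rfl⟩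
    refine LinearMap.mem_ker.mpr (hker _ fun h => ?_)
    rw [hpair]
    simp only [b, coboundary_mk, mul_add, Finset.sum_add_distrib]
    have : ∑ d : X, h (Quotient.mk _ d) * f (Quotient.mk _ (M.α d))
        = ∑ d : X, h (Quotient.mk _ d) * f (Quotient.mk _ d) := by
      rw [← Equiv.sum_comp M.σ]
      refine Finset.sum_congr rfl fun d _ => ?_
      rw [hmkσ, ← hmkφ (M.α (M.σ d)), M.φ_α]; simp
    rw [this]; exact CharTwo.add_self_eq_zero _
  -- Euler's formula makes the first homology vanish: `rank b ≥ F - 1 = E - (V - 1) ≥ dim (ker c)`.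
  have heq : LinearMap.range b = LinearMap.ker c := by
    refine Submodule.eq_of_le_of_finrank_le hle ?_
    have h1 := LinearMap.finrank_range_add_finrank_ker c
    rw [Module.finrank_fintype_fun_eq_card] at h1
    have h2 := hs
    unfold CombMap.Spherical at h2
    rw [Nat.card_eq_fintype_card (α := M.Edge)] at h2
    have h3 : Nat.card M.Vertex ≤ Module.finrank (ZMod 2) (LinearMap.range a) + 1 := hra
    have h4 : Nat.card M.Face ≤ Module.finrank (ZMod 2) (LinearMap.range b) + 1 := hrb
    omega
  -- The set of all edges is a cycle because `ι` pairs up the darts at each vertex. A set of faces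
  -- bounded by it is one colour class.
  have hone : (fun _ => 1 : M.Edge → ZMod 2) ∈ LinearMap.ker c := by
    refine LinearMap.mem_ker.mpr (hker _ fun h => ?_)
    rw [hpair]
    refine Finset.sum_involution (fun d _ => ι d) ?_ (fun d _ _ => hne d) (fun _ _ => Finset.mem_univ _)
      (fun d _ => hι d)
    intro d _
    have : (Quotient.mk _ (ι d) : M.Vertex) = Quotient.mk _ d :=
      Quotient.sound (s := Equiv.Perm.SameCycle.setoid M.σ) (hv d).symm
    rw [this]; exact CharTwo.add_self_eq_zero _
  rw [← heq] at hone
  obtain ⟨f, hf⟩ := hone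
  refine ⟨fun x => f (Quotient.mk _ x), fun x => congrArg f (hmkφ x), fun x => ?_⟩
  have := congrFun hf (Quotient.mk _ x)
  simp only [b, coboundary_mk] at this
  rw [← this, ← add_assoc, CharTwo.add_self_eq_zero, zero_add]

end Colouring

end CombMap

end AugLink

namespace AugLink

theorem firstReturn_eq {X : Type*} [Finite X] (g : Equiv.Perm X) (S : X → Prop) (c : {c // S c})
    (k : ℕ) (hk : 0 < k) (hS : S ((g ^ k) c.1)) (hlt : ∀ j, 0 < j → j < k → ¬ S ((g ^ j) c.1)) :
    (firstReturn g S c).1 = (g ^ k) c.1 := by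
  obtain ⟨l, hl, he, hmin⟩ := firstReturn_spec g S c
  have : l = k := by
    rcases lt_trichotomy l k with h | h | h
    · exact absurd (he ▸ (firstReturn g S c).2) (hlt l hl h)
    · exact h
    · exact absurd hS (hmin k hk h)
  rw [he, this]

/-! ### Faces of a prime diagram -/

namespace LinkDiagram

variable {D : Type*} (L : LinkDiagram D)

/-- The face to the left of a dart. -/
def face (d : D) : L.Face := Quotient.mk _ d

theorem face_eq_iff {d d' : D} : L.face d = L.face d' ↔ L.SameFace d d' :=
  Quotient.eq (r := Equiv.Perm.SameCycle.setoid L.φ)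

theorem face_φ (d : D) : L.face (L.φ d) = L.face d :=
  L.face_eq_iff.mpr ((Equiv.Perm.sameCycle_apply_left).mpr (Equiv.Perm.SameCycle.refl _ _))

theorem face_α (d : D) : L.face (L.α d) = L.face (L.σ⁻¹ d) := by
  rw [← L.φ_α, face_φ]

theorem face_α_σ (d : D) : L.face (L.α (L.σ d)) = L.face d := by
  rw [face_α]; simp

theorem σ_inv (d : D) : L.σ⁻¹ d = L.σ (L.σ (L.σ d)) := by
  rw [Equiv.Perm.inv_eq_iff_eq, L.four]

theorem σ_inv_σ (d : D) : L.σ⁻¹ (L.σ d) = d := by simp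

theorem sameVertex_σ (d : D) : L.SameVertex d (L.σ d) :=
  (Equiv.Perm.sameCycle_apply_right).mpr (Equiv.Perm.SameCycle.refl _ _)

theorem sameVertex_cases {x y : D} (h : L.SameVertex x y) :
    y = x ∨ y = L.σ x ∨ y = L.σ (L.σ x) ∨ y = L.σ (L.σ (L.σ x)) := by
  obtain ⟨k, rfl⟩ := h
  have h4 : L.σ ^ (4 : ℤ) = 1 := by
    rw [zpow_ofNat]; ext x
    simp [pow_succ, L.four]
  have hk : L.σ ^ k = L.σ ^ (k % 4) := by
    conv_lhs => rw [← Int.mul_ediv_add_emod k 4, zpow_add, zpow_mul, h4]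
    simp
  rw [hk]
  have h0 := Int.emod_nonneg k (show (4 : ℤ) ≠ 0 by norm_num)
  have h1 := Int.emod_lt_of_pos k (show (0 : ℤ) < 4 by norm_num)
  generalize k % 4 = m at *
  interval_cases m
  · left; simp
  · right; left; simp
  · right; right; left; rw [zpow_ofNat]; simp [pow_succ]
  · right; right; right; rw [zpow_ofNat]; simp [pow_succ]

theorem IsPrime.eq {L : LinkDiagram D} (hp : L.IsPrime) {d d' : D} (h : L.face d = L.face d')
    (h' : L.face (L.α d) = L.face (L.α d')) : d = d' :=
  hp d d' (L.face_eq_iff.mp h) (L.face_eq_iff.mp h')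

theorem IsPrime.face_ne {L : LinkDiagram D} (hp : L.IsPrime) (d : D) :
    L.face d ≠ L.face (L.α d) := fun h =>
  L.α_ne d (hp.eq h (by rw [L.α_invol]; exact h.symm)).symm

/-- If opposite corners of a crossing lay in one face, primeness would turn the four darts there
into two loops. By connectedness the diagram would then have a single crossing, hence a single twist
region. -/
theorem face_side_ne (hp : L.IsPrime) (ht : L.TwoRegions) (d : D) :
    L.face (L.σ d) ≠ L.face (L.σ⁻¹ d) := by
  intro h
  have h1 : d = L.α (L.σ d) := hp.eq (by rw [face_α_σ]) (by rw [L.α_invol, face_α, h])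
  have h2 : L.σ (L.σ d) = L.α (L.σ (L.σ (L.σ d))) :=
    hp.eq (by rw [face_α_σ]) (by rw [L.α_invol, face_α, σ_inv_σ, h, σ_inv])
  have hα : ∀ x, L.SameVertex d x → L.SameVertex d (L.α x) := by
    have s1 := L.sameVertex_σ d
    have s2 := s1.trans (L.sameVertex_σ _)
    have s3 := s2.trans (L.sameVertex_σ _)
    intro x hx
    rcases L.sameVertex_cases hx with rfl | rfl | rfl | rfl
    · rw [h1, L.α_invol]; rw [← h1]; exact s1
    · rw [← h1]; exact Equiv.Perm.SameCycle.refl _ _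
    · rw [h2, L.α_invol]; exact s3
    · rw [← h2]; exact s2
  obtain ⟨a, b, hab⟩ := ht
  have key : ∀ x, L.SameVertex d x := by
    intro x
    have := L.connected.eq_of_invariant (f := fun x => L.SameVertex d x)
      (fun x => propext Equiv.Perm.sameCycle_apply_right)
      (fun x => propext ⟨fun h => by simpa [L.α_invol] using hα _ h, hα x⟩) d x
    exact this ▸ Equiv.Perm.SameCycle.refl _ _
  have hr : ∀ x, L.SameRegion d x := by
    intro x
    have e1 : L.SameRegion d (L.σ d) := .rel _ _ (.inl rfl)
    have e2 : L.SameRegion d (L.σ (L.σ d)) := e1.trans _ _ _ (.rel _ _ (.inl rfl))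
    rcases L.sameVertex_cases (key x) with rfl | rfl | rfl | rfl
    · exact .refl _
    · exact e1
    · exact e2
    · exact e2.trans _ _ _ (.rel _ _ (.inl rfl))
  exact hab (((hr a).symm).trans _ _ _ (hr b))

theorem exists_colouring [Finite D] :
    ∃ ε : D → ZMod 2, (∀ x y, L.face x = L.face y → ε x = ε y) ∧ ∀ x, ε (L.α x) = ε x + 1 := by
  obtain ⟨ε, h1, h2⟩ := L.exists_checkerboard L.connected L.spherical (fun x => L.σ (L.σ x))
    L.four L.two_ne (fun x => (L.sameVertex_σ x).trans (L.sameVertex_σ _))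
  refine ⟨ε, fun x y h => ?_, h2⟩
  have hσ : ∀ z, ε (L.φ⁻¹ z) = ε z := fun z => by
    have := h1 (L.φ⁻¹ z)
    rw [← this]; simp
  obtain ⟨k, rfl⟩ := L.face_eq_iff.mp h
  induction k using Int.induction_on with
  | zero => rfl
  | succ n ih =>
    rw [add_comm, zpow_add, zpow_one, Equiv.Perm.mul_apply, h1]
    exact ih (L.face_eq_iff.mpr ⟨_, rfl⟩)
  | pred n ih =>
    rw [sub_eq_add_neg, add_comm, zpow_add, zpow_neg_one, Equiv.Perm.mul_apply, hσ]
    exact ih (L.face_eq_iff.mpr ⟨_, rfl⟩)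

/-- The two faces along an edge have different colours, those at opposite corners of a crossing have
the same colour. So a strand vertex and a circle vertex never lie between the same white faces. -/
theorem face_strand_ne_circle [Finite D] (d c : D) (h : L.face (L.α d) = L.face (L.σ c))
    (h' : L.face d = L.face (L.σ⁻¹ c)) : False := by
  obtain ⟨ε, h1, h2⟩ := L.exists_colouring
  have e1 := h1 _ _ h
  have e2 := h1 _ _ h'
  have e3 := h1 _ _ (L.face_α c)
  have e4 := h1 _ _ (L.face_α_σ c)
  rw [h2] at e1 e3 e4
  rw [e2, ← e3, ← e4] at e1
  have := e1.symm
  generalize ε (L.σ c) = z at this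
  revert z; decide

/-! ### Rows of bigons -/

theorem crossBigon_of {d : D} (h : L.IsBigon d) : L.crossBigon d = L.φ d := by
  simp [crossBigon, Function.Involutive.toPerm, h]

theorem crossBigon_of_not {d : D} (h : ¬ L.IsBigon d) : L.crossBigon d = d := by
  simp [crossBigon, Function.Involutive.toPerm, h]

theorem crossBigon_crossBigon (d : D) : L.crossBigon (L.crossBigon d) = d := by
  by_cases h : L.IsBigon d
  · rw [L.crossBigon_of h, L.crossBigon_of (L.bigon_face h), h.1]
  · rw [L.crossBigon_of_not h, L.crossBigon_of_not h]

theorem isBigon_crossBigon {d : D} : L.IsBigon (L.crossBigon d) ↔ L.IsBigon d := by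
  by_cases h : L.IsBigon d
  · rw [L.crossBigon_of h]; exact ⟨fun _ => h, L.bigon_face⟩
  · rw [L.crossBigon_of_not h]

/-- One step along a row of bigons. -/
def row : Equiv.Perm D := L.σ * L.σ * L.crossBigon

theorem row_apply (d : D) : L.row d = L.σ (L.σ (L.crossBigon d)) := rfl

/-- `row` is a product of two involutions, so conjugation by one of them inverts it: a row of bigons
can be walked backwards. -/
theorem crossBigon_row_zpow (k : ℤ) (d : D) :
    L.crossBigon ((L.row ^ k) d) = (L.row ^ (-k)) (L.crossBigon d) := by
  have h1 : L.crossBigon * L.row * L.crossBigon⁻¹ = L.row⁻¹ := by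
    rw [eq_inv_iff_mul_eq_one]
    ext x
    have hi : L.crossBigon⁻¹ = L.crossBigon := by
      ext y; rw [Equiv.Perm.inv_eq_iff_eq, crossBigon_crossBigon]
    simp [hi, row_apply, crossBigon_crossBigon, L.four]
  have h2 : L.crossBigon * L.row ^ k * L.crossBigon⁻¹ = L.row ^ (-k) := by
    rw [← conj_zpow, h1, inv_zpow']
  have := congrArg (fun f : Equiv.Perm D => f (L.crossBigon d)) h2
  simpa using this

theorem crossBigon_row_pow (k : ℕ) (d : D) :
    (L.row ^ k) (L.crossBigon ((L.row ^ k) d)) = L.crossBigon d := by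
  have := L.crossBigon_row_zpow k d
  rw [zpow_natCast, zpow_neg, zpow_natCast] at this
  rw [this]; simp

/-! ### Ends of twist regions, and the white faces at an ideal vertex -/

namespace Direction

variable {L} (A : L.Direction)

theorem ends_next_next (d : D) : L.σ (L.σ d) ∈ A.ends ↔ d ∈ A.ends := by
  rw [A.ends_next, A.ends_next, not_not]

theorem eq_of_sameVertex {c c' : D} (hc : c ∈ A.ends) (hc' : c' ∈ A.ends)
    (h : L.SameVertex c c') : c' = c ∨ c' = L.σ (L.σ c) := by
  rcases L.sameVertex_cases h with rfl | rfl | rfl | rfl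
  · exact .inl rfl
  · exact absurd hc ((A.ends_next _).mp hc')
  · exact .inr rfl
  · rw [A.ends_next_next, A.ends_next] at hc'; exact absurd hc hc'

theorem row_mem {d : D} (h : d ∈ A.ends) : L.row d ∈ A.ends := by
  rw [L.row_apply, A.ends_next_next]
  by_cases hb : L.IsBigon d
  · exact A.bigon_mem _ (L.isBigon_crossBigon.mpr hb)
  · rwa [L.crossBigon_of_not hb]

theorem row_pow_mem {d : D} (h : d ∈ A.ends) (k : ℕ) : (L.row ^ k) d ∈ A.ends := by
  induction k with
  | zero => exact h
  | succ k ih => rw [pow_succ']; exact A.row_mem ih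

/-- The next corner of the same shaded triangle. -/
def nxt (q : A.Shaded) : A.Shaded := (q.1, q.2.next)

/-- The previous corner of the same shaded triangle. -/
def prv (q : A.Shaded) : A.Shaded := (q.1, q.2.prev)

/-- The white face next to a shaded corner, in counterclockwise direction, as a face of the
diagram. -/
def white : A.Shaded → L.Face
  | (c, .circ) => L.face (L.σ c.1)
  | (c, .fst) => L.face (L.α c.1)
  | (c, .snd) => L.face c.1

theorem white_strand (q : A.Shaded) (h : q.2 ≠ .circ) :
    A.white q = L.face (L.α (A.dartOf q)) := by
  obtain ⟨c, _ | _ | _⟩ := q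
  · exact absurd rfl h
  · rfl
  · exact (L.face_α_σ _).symm

theorem white_nxt_strand (q : A.Shaded) (h : q.2 ≠ .circ) :
    A.white (A.nxt q) = L.face (A.dartOf q) := by
  obtain ⟨c, _ | _ | _⟩ := q
  · exact absurd rfl h
  · rfl
  · rfl

theorem white_nxt_circ (c : A.Tip) : A.white (A.nxt (c, .circ)) = L.face (L.σ⁻¹ c.1) :=
  L.face_α _

theorem locate_dartOf (q : A.Shaded) (h : q.2 ≠ .circ) :
    A.locate (A.dartOf q) (A.external_dartOf q) = q := by
  obtain ⟨⟨c, hc⟩, _ | _ | _⟩ := q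
  · exact absurd rfl h
  · simp [locate, dartOf, hc.1]
  · have : L.σ c ∉ A.ends := fun h => (A.ends_next c).mp h hc.1
    simp [locate, dartOf, this]

theorem eq_of_dartOf {q q' : A.Shaded} (h : q.2 ≠ .circ) (h' : q'.2 ≠ .circ)
    (hd : A.dartOf q = A.dartOf q') : q = q' := by
  rw [← A.locate_dartOf q h, ← A.locate_dartOf q' h']
  congr 1

/-- The same two faces run along the two long sides of the row. They appear exchanged because after
the first crossing the corners point the other way. -/
theorem face_row (c : A.Tip) (a : ℕ) (h : ∀ j, 0 < j → j < a → L.IsBigon ((L.row ^ j) c.1)) :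
    ∀ j, 0 < j → j ≤ a → L.face (L.σ ((L.row ^ j) c.1)) = L.face (L.σ⁻¹ c.1) ∧
      L.face (L.σ⁻¹ ((L.row ^ j) c.1)) = L.face (L.σ c.1) := by
  intro j h0
  induction j, h0 using Nat.le_induction with
  | base =>
    intro _
    rw [pow_one, L.row_apply, L.crossBigon_of_not c.2.2]
    simp [L.σ_inv, L.four]
  | succ j hj ih =>
    intro hja
    obtain ⟨h1, h2⟩ := ih (by omega)
    have hb := h j hj (by omega)
    set x := (L.row ^ j) c.1 with hx
    have e : (L.row ^ (j + 1)) c.1 = L.σ (L.σ (L.φ x)) := by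
      rw [pow_succ', Equiv.Perm.mul_apply, L.row_apply, L.crossBigon_of hb]
    rw [e]
    have e1 : L.α (L.φ x) = L.σ x := by rw [L.α_eq, hb.1]
    have e2 : L.σ (L.φ x) = L.α x := L.σ_φ x
    constructor
    · rw [← h1, ← e1, L.face_α, ← L.σ_inv]
    · rw [L.σ_inv_σ, e2, L.face_α, h2]

theorem white_ne_nxt (hp : L.IsPrime) (ht : L.TwoRegions) (q : A.Shaded) :
    A.white q ≠ A.white (A.nxt q) := by
  by_cases h : q.2 = .circ
  · obtain ⟨c, p⟩ := q
    simp only at h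
    subst h
    rw [white_nxt_circ]
    exact L.face_side_ne hp ht c.1
  · rw [white_strand _ _ h, white_nxt_strand _ _ h]
    exact (hp.face_ne _).symm

variable [Finite D]

/-- The number of crossings in the row of bigons that starts at a tip. -/
theorem exists_row (c : A.Tip) : ∃ a : ℕ, 0 < a ∧ (A.otherTip c).1 = (L.row ^ a) c.1 ∧
    ∀ j, 0 < j → j < a → L.IsBigon ((L.row ^ j) c.1) := by
  obtain ⟨k, hk, he, hmin⟩ := firstReturn_spec L.row A.IsTip c
  refine ⟨k, hk, he, fun j h0 h1 => ?_⟩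
  by_contra hb
  exact hmin j h0 h1 ⟨A.row_pow_mem c.2.1 j, hb⟩

theorem otherTip_eq (c : A.Tip) (a : ℕ) (ha : 0 < a) (c' : A.Tip) (hc' : c'.1 = (L.row ^ a) c.1)
    (h : ∀ j, 0 < j → j < a → L.IsBigon ((L.row ^ j) c.1)) : A.otherTip c = c' :=
  Subtype.ext ((firstReturn_eq L.row A.IsTip c a ha (hc' ▸ c'.2)
    (fun j h0 h1 ht => ht.2 (h j h0 h1))).trans hc'.symm)

theorem otherTip_otherTip (c : A.Tip) : A.otherTip (A.otherTip c) = c := by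
  obtain ⟨a, ha, he, hb⟩ := A.exists_row c
  have hι := L.crossBigon_of_not c.2.2
  have hι' := L.crossBigon_of_not (A.otherTip c).2.2
  have key : ∀ i j : ℕ, i + j = a → (L.row ^ j) (A.otherTip c).1
      = L.crossBigon ((L.row ^ i) c.1) := by
    intro i j hij
    have h1 := L.crossBigon_row_pow j ((L.row ^ i) c.1)
    rw [← Equiv.Perm.mul_apply (L.row ^ j) (L.row ^ i), ← pow_add, add_comm j i, hij, ← he, hι'] at h1
    exact h1
  refine A.otherTip_eq _ a ha _ ?_ ?_
  · rw [key 0 a (by omega)]; simp [hι]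
  · intro j h0 h1
    rw [key (a - j) j (by omega), L.isBigon_crossBigon]
    exact hb _ (by omega) (by omega)

/-- A row leading back to its own tip would be folded in the middle: at a bigon, which would equal
its opposite corner, or at a crossing, where `σ * σ` would have a fixed point. -/
theorem otherTip_ne (c : A.Tip) : A.otherTip c ≠ c := by
  intro heq
  obtain ⟨a, ha, he, hb⟩ := A.exists_row c
  rw [heq] at he
  have hι := L.crossBigon_of_not c.2.2
  have key : ∀ i j : ℕ, i + j = a → (L.row ^ j) c.1 = L.crossBigon ((L.row ^ i) c.1) := by
    intro i j hij
    have h1 := L.crossBigon_row_pow j ((L.row ^ i) c.1)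
    rw [← Equiv.Perm.mul_apply (L.row ^ j) (L.row ^ i), ← pow_add, add_comm j i, hij, ← he, hι] at h1
    exact h1
  rcases Nat.even_or_odd' a with ⟨b, rfl | rfl⟩
  · have h1 := key b b (by omega)
    have h2 := hb b (by omega) (by omega)
    rw [L.crossBigon_of h2] at h1
    exact h2.2 h1.symm
  · have h1 := key b (b + 1) (by omega)
    rw [pow_succ', Equiv.Perm.mul_apply, L.row_apply] at h1
    exact L.two_ne _ h1

theorem face_otherTip (c : A.Tip) : L.face (L.σ (A.otherTip c).1) = L.face (L.σ⁻¹ c.1) := by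
  obtain ⟨a, ha, he, hb⟩ := A.exists_row c
  rw [he]
  exact (A.face_row c a hb a ha le_rfl).1

/-- Tips at one crossing are equal or opposite, and opposite ones see the side faces in the other
order. At different crossings, twist-reducedness puts the tips at the two ends of one row, where the
side faces are again exchanged. `face_side_ne` excludes both exchanges. -/
theorem tip_eq_of_face (hp : L.IsPrime) (hw : L.IsTwistReduced) (ht : L.TwoRegions)
    (c c' : A.Tip) (h : L.face (L.σ c.1) = L.face (L.σ c'.1))
    (h' : L.face (L.σ⁻¹ c.1) = L.face (L.σ⁻¹ c'.1)) : c = c' := by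
  by_cases hv : L.SameVertex c.1 c'.1
  · rcases A.eq_of_sameVertex c.2.1 c'.2.1 hv with h1 | h1
    · exact Subtype.ext h1.symm
    · rw [h1, ← L.σ_inv] at h
      exact absurd h (L.face_side_ne hp ht _)
  have hv2 : ¬ L.SameVertex c.1 (L.σ (L.σ c'.1)) := fun h0 =>
    hv ((h0.trans (L.sameVertex_σ _)).trans ((L.sameVertex_σ _).trans (by
      rw [L.four])))
  -- The opposite dart at the second crossing is used so that the two side faces match in the order
  -- required by `IsTwistReduced`.
  rcases hw c.1 (L.σ (L.σ c'.1)) hv2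
    (L.face_eq_iff.mp (by rw [h', L.σ_inv c'.1]))
    (L.face_eq_iff.mp (by rw [h, L.σ_inv_σ])) with ⟨k, hk, _⟩ | ⟨k, hk, hkv⟩
  · exact absurd (hk 0 (Nat.zero_le _)) c.2.2
  · have hrow : ∀ i ≤ k, L.nextInRow^[i] (L.σ (L.σ c.1)) = (L.row ^ (i + 1)) c.1 := by
      intro i
      induction i with
      | zero =>
        intro _; rw [zero_add, pow_one, L.row_apply, L.crossBigon_of_not c.2.2, Function.iterate_zero_apply]
      | succ i ih =>
        intro hi
        have hb := hk i (by omega)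
        rw [ih (by omega)] at hb
        rw [Function.iterate_succ_apply', ih (by omega), pow_succ' _ (i + 1),
          Equiv.Perm.mul_apply, L.row_apply, L.crossBigon_of hb]; rfl
    have hb := hk k le_rfl
    rw [hrow k le_rfl] at hb hkv
    have hlast : (L.row ^ (k + 2)) c.1 = L.σ (L.σ (L.φ ((L.row ^ (k + 1)) c.1))) := by
      rw [pow_succ' _ (k + 1), Equiv.Perm.mul_apply, L.row_apply, L.crossBigon_of hb]
    have hv3 : L.SameVertex (L.φ ((L.row ^ (k + 1)) c.1)) c'.1 :=
      hkv.trans (((L.sameVertex_σ c'.1).trans (L.sameVertex_σ _)).symm)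
    have hbf := L.bigon_face hb
    have hc' : c'.1 = (L.row ^ (k + 2)) c.1 := by
      rcases A.eq_of_sameVertex (A.bigon_mem _ hbf) c'.2.1 hv3 with h1 | h1
      · exact absurd (h1 ▸ hbf) c'.2.2
      · rw [h1, hlast]
    have := A.otherTip_eq c (k + 2) (by omega) c' hc' (fun j h0 h1 => by
      have := hk (j - 1) (by omega)
      rwa [hrow (j - 1) (by omega), Nat.sub_add_cancel h0] at this)
    have h2 := A.face_otherTip c
    rw [this, ← h] at h2
    exact absurd h2 (L.face_side_ne hp ht _)

theorem opposite_circ (c : A.Tip) : A.opposite (c, .circ) = (A.otherTip c, .circ) := rfl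

theorem opposite_strand (q : A.Shaded) (h : q.2 ≠ .circ) :
    A.opposite q = A.locate (L.α (A.dartOf q)) (external_α (A.external_dartOf q)) := by
  obtain ⟨c, _ | _ | _⟩ := q
  · exact absurd rfl h
  · rfl
  · rfl

theorem opposite_snd_circ (q : A.Shaded) : (A.opposite q).2 = .circ ↔ q.2 = .circ := by
  by_cases h : q.2 = .circ
  · obtain ⟨c, p⟩ := q
    simp only at h
    subst h
    simp [opposite_circ]
  · simp only [h, iff_false]
    rw [A.opposite_strand q h]
    exact A.locate_ne_circ _ _

theorem dartOf_opposite (q : A.Shaded) (h : q.2 ≠ .circ) :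
    A.dartOf (A.opposite q) = L.α (A.dartOf q) := by
  rw [A.opposite_strand q h, dartOf_locate]

theorem opposite_opposite (q : A.Shaded) : A.opposite (A.opposite q) = q := by
  by_cases h : q.2 = .circ
  · obtain ⟨c, p⟩ := q
    simp only at h
    subst h
    rw [opposite_circ, opposite_circ, otherTip_otherTip]
  · have h1 := mt (A.opposite_snd_circ q).mp h
    have h2 := mt (A.opposite_snd_circ (A.opposite q)).mp h1
    exact A.eq_of_dartOf h2 h (by rw [dartOf_opposite _ _ h1, dartOf_opposite _ _ h, L.α_invol])

theorem white_opposite (q : A.Shaded) : A.white (A.opposite q) = A.white (A.nxt q) := by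
  by_cases h : q.2 = .circ
  · obtain ⟨c, p⟩ := q
    simp only at h
    subst h
    rw [opposite_circ, white_nxt_circ]
    exact A.face_otherTip c
  · rw [white_strand _ _ (mt (A.opposite_snd_circ q).mp h), dartOf_opposite _ _ h, L.α_invol,
      white_nxt_strand _ _ h]

/-- Strand against strand is primeness, circle against circle is `tip_eq_of_face`, and the mixed
case is impossible by colours. -/
theorem eq_of_white (hp : L.IsPrime) (hw : L.IsTwistReduced) (ht : L.TwoRegions)
    {q q' : A.Shaded} (h : A.white q = A.white q')
    (h' : A.white (A.nxt q) = A.white (A.nxt q')) : q = q' := by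
  have key : ∀ (c : A.Tip) (q : A.Shaded), q.2 ≠ .circ → A.white (c, .circ) = A.white q →
      A.white (A.nxt (c, .circ)) = A.white (A.nxt q) → False := by
    intro c q hq h1 h2
    rw [white_strand _ _ hq] at h1
    rw [white_nxt_strand _ _ hq, white_nxt_circ] at h2
    exact L.face_strand_ne_circle (A.dartOf q) c.1 h1.symm h2.symm
  by_cases hq : q.2 = .circ <;> by_cases hq' : q'.2 = .circ
  · obtain ⟨c, p⟩ := q
    obtain ⟨c', p'⟩ := q'
    simp only at hq hq'
    subst hq hq'
    rw [white_nxt_circ, white_nxt_circ] at h'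
    rw [A.tip_eq_of_face hp hw ht c c' h h']
  · obtain ⟨c, p⟩ := q
    simp only at hq
    subst hq
    exact (key c q' hq' h h').elim
  · obtain ⟨c, p⟩ := q'
    simp only at hq'
    subst hq'
    exact (key c q hq h.symm h'.symm).elim
  · rw [white_strand _ _ hq, white_strand _ _ hq'] at h
    rw [white_nxt_strand _ _ hq, white_nxt_strand _ _ hq'] at h'
    exact A.eq_of_dartOf hq hq' (hp.eq h' h)

end Direction

end LinkDiagram

end AugLink

/-! ### Incidence rules for shaded triangles and white faces -/

namespace AugLink

theorem Pos.eq_or (p p' : Pos) : p' = p ∨ p' = p.next ∨ p' = p.prev := by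
  cases p <;> cases p' <;> simp [Pos.next, Pos.prev]

theorem eq_of_sameCycle {X β : Type*} {π : Equiv.Perm X} {f : X → β} (hf : ∀ x, f (π x) = f x)
    {x y : X} (h : π.SameCycle x y) : f y = f x := by
  have hσ : ∀ z, f (π⁻¹ z) = f z := fun z => by
    have := hf (π⁻¹ z)
    rw [← this]; simp
  obtain ⟨k, rfl⟩ := h
  induction k using Int.induction_on with
  | zero => rfl
  | succ n ih => rw [add_comm, zpow_add, zpow_one, Equiv.Perm.mul_apply, hf, ih]
  | pred n ih =>
    rw [sub_eq_add_neg, add_comm, zpow_add, zpow_neg_one, Equiv.Perm.mul_apply, hσ, ih]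

/-- The incidence rules between the shaded triangles and the white faces of an ideal polyhedron.
Elements of `S` are corners of shaded triangles, `nxt` and `prv` rotate a triangle, `opp` passes to
the other shaded corner at the same ideal vertex, and `w` is the white face that comes next at this
vertex. -/
structure Incidence {S F : Type*} (nxt prv opp : S → S) (w : S → F) : Prop where
  nxt_prv : ∀ q, nxt (prv q) = q
  prv_nxt : ∀ q, prv (nxt q) = q
  nxt_nxt : ∀ q, nxt (nxt q) = prv q
  prv_prv : ∀ q, prv (prv q) = nxt q
  opp_opp : ∀ q, opp (opp q) = q
  w_opp : ∀ q, w (opp q) = w (nxt q)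
  w_ne : ∀ q, w q ≠ w (nxt q)
  w_inj : ∀ q q', w q = w q' → w (nxt q) = w (nxt q') → q = q'
  no_bigon : ∀ q q', opp (prv q) = q' → opp q = prv q' → False

namespace LinkDiagram.Direction

variable {D : Type*} {L : LinkDiagram D} (A : L.Direction)

theorem nxt_prv (q : A.Shaded) : A.nxt (A.prv q) = q := by
  obtain ⟨c, _ | _ | _⟩ := q <;> rfl

theorem prv_nxt (q : A.Shaded) : A.prv (A.nxt q) = q := by
  obtain ⟨c, _ | _ | _⟩ := q <;> rfl

theorem nxt_nxt (q : A.Shaded) : A.nxt (A.nxt q) = A.prv q := by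
  obtain ⟨c, _ | _ | _⟩ := q <;> rfl

theorem prv_prv (q : A.Shaded) : A.prv (A.prv q) = A.nxt q := by
  obtain ⟨c, _ | _ | _⟩ := q <;> rfl

theorem eq_of_tip_eq {q q' : A.Shaded} (h : q.1 = q'.1) :
    q' = q ∨ q' = A.nxt q ∨ q' = A.prv q := by
  obtain ⟨c, p⟩ := q
  obtain ⟨c', p'⟩ := q'
  simp only at h
  subst h
  rcases Pos.eq_or p p' with rfl | rfl | rfl
  · exact .inl rfl
  · exact .inr (.inl rfl)
  · exact .inr (.inr rfl)

variable [Finite D]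

/-- Two triangles joined by a white bigon would share all three vertices. Their circle corners would
match, and the two matched strands would bound a bigon of the diagram at a tip. -/
theorem no_white_bigon (hp : L.IsPrime) (hw : L.IsTwistReduced) (ht : L.TwoRegions)
    (q q' : A.Shaded) (h : A.opposite (A.prv q) = q') (h' : A.opposite q = A.prv q') : False := by
  -- The third vertices of the two triangles lie between the same two white faces.
  have h3 : A.opposite (A.nxt q) = A.nxt q' := by
    refine (A.eq_of_white hp hw ht ?_ ?_)
    · rw [A.white_opposite, A.nxt_nxt, ← A.white_opposite q', ← h, A.opposite_opposite]
    · rw [← A.white_opposite, A.opposite_opposite, A.nxt_nxt, ← A.white_opposite q, h']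
  have key : ∀ c c' : A.Tip, A.opposite (c, .circ) = (c', .circ) →
      A.opposite (c, .fst) = (c', .snd) → A.opposite (c, .snd) = (c', .fst) → False := by
    intro c c' h1 h2 h3
    have e2 := A.dartOf_opposite (c, .fst) (by simp)
    have e3 := A.dartOf_opposite (c, .snd) (by simp)
    rw [h2] at e2
    rw [h3] at e3
    simp only [dartOf] at e2 e3
    have f1 : L.φ c.1 = c'.1 := by rw [L.φ_apply, ← e2]; simp
    have f2 : L.φ c'.1 = c.1 := by rw [e3, L.φ_α]; simp
    refine c.2.2 ⟨by rw [f1, f2], fun h => ?_⟩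
    have : c' = c := Subtype.ext (f1.symm.trans h)
    subst this
    rw [opposite_circ] at h1
    exact A.otherTip_ne _ (Prod.ext_iff.mp h1).1
  have hc : ∀ {q q' : A.Shaded}, A.opposite q = q' → (q'.2 = .circ ↔ q.2 = .circ) := by
    rintro q _ rfl
    exact A.opposite_snd_circ q
  have c1 := hc h
  have c2 := hc h'
  have c3 := hc h3
  obtain ⟨c, _ | _ | _⟩ := q <;> obtain ⟨c', _ | _ | _⟩ := q' <;>
    simp [nxt, prv, Pos.next, Pos.prev] at c1 c2 c3
  · exact key c c' h' h3 h
  · exact key c c' h h' h3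
  · exact key c c' h3 h h'

theorem incidence (hp : L.IsPrime) (hw : L.IsTwistReduced) (ht : L.TwoRegions) :
    Incidence A.nxt A.prv A.opposite A.white where
  nxt_prv := A.nxt_prv
  prv_nxt := A.prv_nxt
  nxt_nxt := A.nxt_nxt
  prv_prv := A.prv_prv
  opp_opp := A.opposite_opposite
  w_opp := A.white_opposite
  w_ne := A.white_ne_nxt hp ht
  w_inj := fun _ _ => A.eq_of_white hp hw ht
  no_bigon := A.no_white_bigon hp hw ht

/-! ### The permutations of the polyhedron -/

theorem poly_σ_false (q : A.Shaded) : A.poly.σ (q, false) = (q, true) := rfl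

theorem poly_σ_true (q : A.Shaded) : A.poly.σ (q, true) = (A.opposite q, false) := rfl

theorem poly_σ_inv_true (q : A.Shaded) : A.poly.σ⁻¹ (q, true) = (q, false) := rfl

theorem poly_σ_inv_false (q : A.Shaded) : A.poly.σ⁻¹ (q, false) = (A.opposite q, true) := by
  rw [Equiv.Perm.inv_eq_iff_eq, poly_σ_true, opposite_opposite]

theorem poly_α_true (q : A.Shaded) : A.poly.α (q, true) = (A.prv q, false) := rfl

theorem poly_φ_false (q : A.Shaded) : A.poly.φ (q, false) = (A.nxt q, false) := rfl

theorem poly_φ_true (q : A.Shaded) : A.poly.φ (q, true) = (A.opposite (A.prv q), true) := by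
  rw [CombMap.φ_apply, poly_α_true, poly_σ_inv_false]

/-- The face of the polyhedron that contains a corner: a shaded triangle or a white face. -/
def faceLabel (x : A.Dart) : A.Tip ⊕ L.Face :=
  if x.2 then .inr (A.white x.1) else .inl x.1.1

theorem faceLabel_eq {x y : A.Dart} (h : A.poly.SameFace x y) :
    A.faceLabel y = A.faceLabel x := by
  refine eq_of_sameCycle (π := A.poly.φ) ?_ h
  rintro ⟨q, _ | _⟩
  · rw [poly_φ_false]; rfl
  · rw [poly_φ_true]
    simp only [faceLabel, if_true]
    rw [white_opposite, nxt_prv]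

/-- Only this direction is needed: a face of the polyhedron has a well-defined label, and disks are
excluded by comparing labels. -/
theorem sameFace_cases {x y : A.Dart} (h : A.poly.SameFace x y) :
    (∃ q r, x = (q, false) ∧ y = (r, false) ∧ (r = q ∨ r = A.nxt q ∨ r = A.prv q)) ∨
    (∃ q r, x = (q, true) ∧ y = (r, true) ∧ A.white q = A.white r) := by
  have h1 := A.faceLabel_eq h
  obtain ⟨q, _ | _⟩ := x <;> obtain ⟨r, _ | _⟩ := y <;> simp [faceLabel] at h1
  · exact .inl ⟨q, r, rfl, rfl, A.eq_of_tip_eq h1.symm⟩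
  · exact .inr ⟨q, r, rfl, rfl, h1.symm⟩

theorem sameVertex_cases {x y : A.Dart} (h : A.poly.SameVertex x y) :
    y.1 = x.1 ∨ y.1 = A.opposite x.1 := by
  have h1 := eq_of_sameCycle (π := A.poly.σ)
    (f := fun x : A.Dart => ({x.1, A.opposite x.1} : Set A.Shaded)) (by
      rintro ⟨q, _ | _⟩
      · rfl
      · rw [poly_σ_true]
        simp only [opposite_opposite]
        exact Set.pair_comm _ _) h
  have : y.1 ∈ ({x.1, A.opposite x.1} : Set A.Shaded) := by
    rw [← h1]; exact Set.mem_insert _ _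
  exact this

/-! ### Segments -/

theorem segment_bdry {x y : A.Dart} (h : A.poly.IsSegment (.bdry x) (.bdry y)) :
    (y.1 = x.1 ∨ y.1 = A.opposite x.1) ∧ y ≠ x :=
  ⟨A.sameVertex_cases h.1, fun e => h.2.1 (by rw [e])⟩

theorem segment_corner {x y : A.Dart} (h : A.poly.IsSegment (.corner x) (.corner y)) :
    (∃ q r, x = (q, false) ∧ y = (r, false) ∧ (r = A.nxt q ∨ r = A.prv q)) ∨
    (∃ q r, x = (q, true) ∧ y = (r, true) ∧ A.white q = A.white r ∧ q ≠ r) := by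
  have hne : y ≠ x := fun e => h.2.1 (by rw [e])
  rcases A.sameFace_cases h.1 with ⟨q, r, rfl, rfl, rfl | h1 | h1⟩ | ⟨q, r, rfl, rfl, h1⟩
  · exact absurd rfl hne
  · exact .inl ⟨q, r, rfl, rfl, .inl h1⟩
  · exact .inl ⟨q, r, rfl, rfl, .inr h1⟩
  · exact .inr ⟨q, r, rfl, rfl, h1, fun e => hne (by rw [e])⟩

theorem not_adjacent {e y : A.Dart} (h : ¬ A.poly.Adjacent (.edge e) (.corner y)) :
    y ≠ e ∧ y ≠ A.poly.φ e := by
  simp only [CombMap.Adjacent, not_or] at h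
  exact ⟨h.1, h.2.2.2⟩

theorem edge_corner_cases {e y : A.Dart} (hf : A.poly.SameFace e y)
    (h : ¬ A.poly.Adjacent (.edge e) (.corner y)) :
    (∃ q, y = (q, false) ∧ e = (A.nxt q, false)) ∨
    (∃ q r, y = (q, true) ∧ e = (r, true) ∧ A.white q = A.white r ∧ q ≠ r ∧
      q ≠ A.opposite (A.prv r)) := by
  obtain ⟨h1, h2⟩ := A.not_adjacent h
  rcases A.sameFace_cases hf with ⟨q, r, rfl, rfl, rfl | rfl | rfl⟩ | ⟨q, r, rfl, rfl, h3⟩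
  · exact absurd rfl h1
  · exact absurd rfl h2
  · exact .inl ⟨_, rfl, by rw [nxt_prv]⟩
  · rw [poly_φ_true] at h2
    exact .inr ⟨r, q, rfl, rfl, h3.symm, fun e => h1 (by rw [e]), fun e => h2 (by rw [e])⟩

theorem segment_corner_edge {y e : A.Dart} (h : A.poly.IsSegment (.corner y) (.edge e)) :
    (∃ q, y = (q, false) ∧ e = (A.nxt q, false)) ∨
    (∃ q r, y = (q, true) ∧ e = (r, true) ∧ A.white q = A.white r ∧ q ≠ r ∧
      q ≠ A.opposite (A.prv r)) :=
  A.edge_corner_cases (Equiv.Perm.SameCycle.symm h.1) h.2.2.2.2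

theorem segment_edge_corner {y e : A.Dart} (h : A.poly.IsSegment (.edge e) (.corner y)) :
    (∃ q, y = (q, false) ∧ e = (A.nxt q, false)) ∨
    (∃ q r, y = (q, true) ∧ e = (r, true) ∧ A.white q = A.white r ∧ q ≠ r ∧
      q ≠ A.opposite (A.prv r)) :=
  A.edge_corner_cases h.1 h.2.2.2.1

theorem segment_edge {x y : A.Dart} (h : A.poly.IsSegment (.edge x) (.edge y)) :
    (∃ q r, x = (q, false) ∧ y = (r, false) ∧ (r = A.nxt q ∨ r = A.prv q)) ∨
    (∃ q r, x = (q, true) ∧ y = (r, true) ∧ A.white q = A.white r ∧ q ≠ r) := by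
  have hne : y ≠ x := fun e => h.2.1 (by rw [e])
  rcases A.sameFace_cases h.1 with ⟨q, r, rfl, rfl, rfl | h1 | h1⟩ | ⟨q, r, rfl, rfl, h1⟩
  · exact absurd rfl hne
  · exact .inl ⟨q, r, rfl, rfl, .inl h1⟩
  · exact .inl ⟨q, r, rfl, rfl, .inr h1⟩
  · exact .inr ⟨q, r, rfl, rfl, h1, fun e => hne (by rw [e])⟩

end LinkDiagram.Direction

end AugLink

/-! ### Excluding short disks that meet an edge or have one boundary segment -/

namespace AugLink

namespace Incidence

variable {S F : Type*} {nxt prv opp : S → S} {w : S → F}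

theorem w_nxt_opp (T : Incidence nxt prv opp w) (q : S) : w (nxt (opp q)) = w q := by rw [← T.w_opp, T.opp_opp]

theorem w_prv_ne (T : Incidence nxt prv opp w) (q : S) : w (prv q) ≠ w q := by
  have := T.w_ne (prv q); rwa [T.nxt_prv] at this

/-- Two triangles share at most one vertex. -/
theorem not_share (T : Incidence nxt prv opp w) {q r : S} (h : opp q = r) (h1 : opp (nxt q) = nxt r ∨ opp (nxt q) = prv r) :
    False := by
  rcases h1 with h1 | h1
  · have e1 := T.w_nxt_opp q
    have e2 := T.w_opp (nxt q)
    rw [h] at e1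
    rw [h1, T.nxt_nxt, e1] at e2
    exact T.w_prv_ne q e2.symm
  · exact T.no_bigon (nxt q) r (by rw [T.prv_nxt, h]) h1

/-- The ideal vertex between two white faces of a triangle. -/
theorem eq_of_whites (T : Incidence nxt prv opp w) {q r : S} (h : w q = w r) (h' : w (opp q) = w (nxt r)) : q = r :=
  T.w_inj _ _ h (by rw [← T.w_opp, h'])

/-- Two triangles with a common vertex do not have the same opposite white face. -/
theorem w_prv_opp_ne (T : Incidence nxt prv opp w) (q : S) : w (prv (opp q)) ≠ w (prv q) := by
  intro h
  have : opp (nxt q) = prv (opp q) :=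
    T.eq_of_whites (by rw [T.w_opp, T.nxt_nxt, h]) (by rw [T.opp_opp, T.nxt_prv, T.w_opp])
  exact T.not_share rfl (.inr this)

/-- The pairs of corners that a segment in a boundary face may join. -/
def VertexSeg (opp : S → S) (x y : S × Bool) : Prop := (y.1 = x.1 ∨ y.1 = opp x.1) ∧ y ≠ x

/-- The pairs of corners, or of edges, that a segment in an interior face may join. -/
def FaceSeg (nxt prv : S → S) (w : S → F) (x y : S × Bool) : Prop :=
  (∃ q r, x = (q, false) ∧ y = (r, false) ∧ (r = nxt q ∨ r = prv q)) ∨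
  (∃ q r, x = (q, true) ∧ y = (r, true) ∧ w q = w r ∧ q ≠ r)

/-- The corners and edges that a segment in an interior face may join. -/
def CornerEdgeSeg (nxt prv opp : S → S) (w : S → F) (y e : S × Bool) : Prop :=
  (∃ q, y = (q, false) ∧ e = (nxt q, false)) ∨
  (∃ q r, y = (q, true) ∧ e = (r, true) ∧ w q = w r ∧ q ≠ r ∧ q ≠ opp (prv r))

/-- The other side of an edge. -/
def flipEdge (nxt prv : S → S) (e : S × Bool) : S × Bool :=
  if e.2 then (prv e.1, false) else (nxt e.1, true)

/-- A face cannot meet an ideal vertex in two corners: the two white faces there differ, and so do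
the three white faces around a triangle. -/
theorem no_loop (T : Incidence nxt prv opp w) {x y : S × Bool} (h1 : VertexSeg opp x y)
    (h2 : FaceSeg nxt prv w y x) : False := by
  obtain ⟨a1, a2, a3, a4, a5, a6, a7, a8, a9⟩ := T
  obtain ⟨q, b⟩ := x
  obtain ⟨q', b'⟩ := y
  obtain ⟨hv, hne⟩ := h1
  rcases h2 with ⟨_, _, e1, e2, h⟩ | ⟨_, _, e1, e2, h, h'⟩ <;> grind

/-- Crossing one edge changes the colour of the face. So one face is a triangle, crossed from a
corner to its opposite edge, and the white face beyond that edge would also meet the corner; but the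
three white faces around a triangle are distinct. -/
theorem no_one_edge (T : Incidence nxt prv opp w) {x y e : S × Bool} (h1 : VertexSeg opp x y)
    (h2 : CornerEdgeSeg nxt prv opp w y e)
    (h3 : CornerEdgeSeg nxt prv opp w x (flipEdge nxt prv e)) : False := by
  obtain ⟨a1, a2, a3, a4, a5, a6, a7, a8, a9⟩ := T
  obtain ⟨hv, hne⟩ := h1
  unfold flipEdge at h3
  rcases h2 with ⟨q, rfl, rfl⟩ | ⟨q, r, rfl, rfl, h4, h5, h6⟩ <;>
  rcases h3 with ⟨q', rfl, h7⟩ | ⟨q', r', rfl, h7, h8, h9, h10⟩ <;>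
  simp at h7 <;> grind

theorem flipEdge_flipEdge (T : Incidence nxt prv opp w) (e : S × Bool) :
    flipEdge nxt prv (flipEdge nxt prv e) = e := by
  obtain ⟨q, _ | _⟩ := e <;> simp [flipEdge, T.nxt_prv, T.prv_nxt]

theorem VertexSeg.symm (T : Incidence nxt prv opp w) {x y : S × Bool} (h : VertexSeg opp x y) :
    VertexSeg opp y x := by
  refine ⟨?_, h.2.symm⟩
  rcases h.1 with h1 | h1
  · exact .inl h1.symm
  · exact .inr (by rw [h1, T.opp_opp])

theorem FaceSeg.symm (T : Incidence nxt prv opp w) {x y : S × Bool} (h : FaceSeg nxt prv w x y) :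
    FaceSeg nxt prv w y x := by
  rcases h with ⟨q, r, rfl, rfl, rfl | rfl⟩ | ⟨q, r, rfl, rfl, h1, h2⟩
  · exact .inl ⟨_, _, rfl, rfl, .inr (T.prv_nxt q).symm⟩
  · exact .inl ⟨_, _, rfl, rfl, .inl (T.nxt_prv q).symm⟩
  · exact .inr ⟨_, _, rfl, rfl, h1.symm, h2.symm⟩

/-- If the middle face is a triangle, its corner between the two crossed edges lies between the same
white faces as the given vertex, so it is that vertex; segments from a corner to an adjacent edge
are not allowed. If the middle face is white, two triangles with a common vertex have the same
opposite white face, against `w_prv_opp_ne`. -/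
theorem no_two_edges (T : Incidence nxt prv opp w) {x y e e' : S × Bool}
    (h1 : VertexSeg opp x y) (h2 : CornerEdgeSeg nxt prv opp w y e)
    (h3 : FaceSeg nxt prv w (flipEdge nxt prv e) e')
    (h4 : CornerEdgeSeg nxt prv opp w x (flipEdge nxt prv e')) : False := by
  obtain ⟨hv, hne⟩ := h1
  unfold flipEdge at h3 h4
  have n := T.w_prv_opp_ne
  obtain ⟨a1, a2, a3, a4, a5, a6, a7, a8, a9⟩ := T
  rcases h2 with ⟨q, rfl, rfl⟩ | ⟨q, r, rfl, rfl, h5, h6, h7⟩ <;>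
  rcases h3 with ⟨s, t, h8, rfl, h10⟩ | ⟨s, t, h8, rfl, h10, h11⟩ <;>
  simp at h8 h4 <;>
  rcases h4 with ⟨q', rfl, h12⟩ | ⟨q', r', rfl, h12, h13, h14, h15⟩ <;> simp at h12 <;> grind

/-- The white faces involved force an ideal vertex to be an end of the crossed edge, which segments
must avoid, or produce a coincidence of white faces that `w_ne` or `w_prv_opp_ne` forbids. -/
theorem no_edge_vertex (T : Incidence nxt prv opp w) {x y e z v : S × Bool}
    (h1 : VertexSeg opp x y) (h2 : CornerEdgeSeg nxt prv opp w y e)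
    (h3 : CornerEdgeSeg nxt prv opp w z (flipEdge nxt prv e))
    (h4 : VertexSeg opp z v) (h5 : FaceSeg nxt prv w v x) : False := by
  obtain ⟨hv, hne⟩ := h1
  obtain ⟨hv', hne'⟩ := h4
  unfold flipEdge at h3
  have n := T.w_prv_opp_ne
  obtain ⟨a1, a2, a3, a4, a5, a6, a7, a8, a9⟩ := T
  rcases h2 with ⟨q, rfl, rfl⟩ | ⟨q, r, rfl, rfl, h6, h7, h8⟩ <;>
  rcases h3 with ⟨q', rfl, h9⟩ | ⟨q', r', rfl, h9, h10, h11, h12⟩ <;> simp at h9 <;>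
  rcases h5 with ⟨s, t, rfl, rfl, h13⟩ | ⟨s, t, rfl, rfl, h13, h14⟩ <;>
  rcases hv with h | h <;> rcases hv' with h' | h' <;> grind

theorem no_vertex_edge (T : Incidence nxt prv opp w) {x y e z v : S × Bool}
    (h1 : VertexSeg opp x y) (h2 : FaceSeg nxt prv w y z) (h3 : VertexSeg opp z v)
    (h4 : CornerEdgeSeg nxt prv opp w v e)
    (h5 : CornerEdgeSeg nxt prv opp w x (flipEdge nxt prv e)) : False :=
  T.no_edge_vertex (VertexSeg.symm T h1) h5 (by rwa [T.flipEdge_flipEdge]) (VertexSeg.symm T h3)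
    (FaceSeg.symm T h2)

end Incidence

end AugLink

/-! ### Disks with two or three boundary segments and no edges -/

namespace AugLink

namespace Incidence

variable {S F : Type*} {nxt prv opp : S → S} {w : S → F}

/-- The next dart around an ideal vertex. -/
def rot (opp : S → S) (x : S × Bool) : S × Bool := if x.2 then (opp x.1, false) else (x.1, true)

/-- The previous dart around an ideal vertex. -/
def rotInv (opp : S → S) (x : S × Bool) : S × Bool :=
  if x.2 then (x.1, false) else (opp x.1, true)

/-- The next corner of a face. -/
def turn (nxt prv opp : S → S) (x : S × Bool) : S × Bool :=
  if x.2 then (opp (prv x.1), true) else (nxt x.1, false)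

/-- The previous corner of a face. -/
def turnInv (nxt prv opp : S → S) (x : S × Bool) : S × Bool :=
  if x.2 then (nxt (opp x.1), true) else (prv x.1, false)

/-- No face is a bigon, so the two neighbours of a corner in its face are different. This keeps the
two ends of a side apart in the definition of `tangent`. -/
theorem turn_ne_turnInv (T : Incidence nxt prv opp w) (x : S × Bool) :
    turn nxt prv opp x ≠ turnInv nxt prv opp x := by
  have n := T.w_prv_opp_ne
  obtain ⟨a1, a2, a3, a4, a5, a6, a7, a8, a9⟩ := T
  obtain ⟨q, _ | _⟩ := x <;> simp [turn, turnInv] <;> grind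

/-- Such a disk runs around a single interior edge: both boundary segments cut off a rectangle
corner at an end of that edge. The two alternatives are the two directions of travel. -/
theorem zero_disk (T : Incidence nxt prv opp w) {x y z v : S × Bool}
    (h1 : VertexSeg opp x y) (h2 : FaceSeg nxt prv w y z) (h3 : VertexSeg opp z v)
    (h4 : FaceSeg nxt prv w v x) :
    (y = rot opp x ∧ v = turnInv nxt prv opp x ∧ z = turn nxt prv opp y) ∨
    (y = rotInv opp x ∧ v = turn nxt prv opp x ∧ z = turnInv nxt prv opp y) := by
  obtain ⟨hv, hne⟩ := h1
  obtain ⟨hv', hne'⟩ := h3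
  have n := T.w_prv_opp_ne
  have m := @T.eq_of_whites
  obtain ⟨a1, a2, a3, a4, a5, a6, a7, a8, a9⟩ := T
  unfold rot rotInv turn turnInv
  rcases h2 with ⟨q, r, rfl, rfl, h6⟩ | ⟨q, r, rfl, rfl, h6, h7⟩ <;>
  rcases h4 with ⟨s, t, rfl, rfl, h8⟩ | ⟨s, t, rfl, rfl, h8, h9⟩ <;>
  rcases hv with h | h <;> rcases hv' with h' | h' <;> simp only at h h' <;> simp <;> grind

theorem faceSeg_shaded {x y : S × Bool} (h : FaceSeg nxt prv w x y) (hx : x.2 = false) :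
    y = turn nxt prv opp x ∨ y = turnInv nxt prv opp x := by
  rcases h with ⟨q, r, rfl, rfl, rfl | rfl⟩ | ⟨q, r, rfl, rfl, h1, h2⟩
  · exact .inl rfl
  · exact .inr rfl
  · simp at hx

set_option maxHeartbeats 4000000 in
/-- The corners `s` and `z` before and after a straight segment on an ideal triangle are on the
same side of the segment. -/
theorem triangle_straight (T : Incidence nxt prv opp w) {x y z v r s : S × Bool}
    (h1 : VertexSeg opp x y) (h2 : FaceSeg nxt prv w y z) (h3 : VertexSeg opp z v)
    (h4 : FaceSeg nxt prv w v r) (h5 : VertexSeg opp r s) (h6 : FaceSeg nxt prv w s x)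
    (hxy : y.2 = x.2) :
    (s = turn nxt prv opp x → z = turnInv nxt prv opp y) ∧
    (s = turnInv nxt prv opp x → z = turn nxt prv opp y) := by
  obtain ⟨hv, hne⟩ := h1
  obtain ⟨hv', hne'⟩ := h3
  obtain ⟨hv'', hne''⟩ := h5
  have n := T.w_prv_opp_ne
  obtain ⟨a1, a2, a3, a4, a5, a6, a7, a8, a9⟩ := T
  unfold turn turnInv
  rcases h2 with ⟨q, q', rfl, rfl, e1⟩ | ⟨q, q', rfl, rfl, e1, e1'⟩ <;>
  rcases h4 with ⟨p, p', rfl, rfl, e2⟩ | ⟨p, p', rfl, rfl, e2, e2'⟩ <;>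
  rcases h6 with ⟨t, t', rfl, rfl, e3⟩ | ⟨t, t', rfl, rfl, e3, e3'⟩ <;>
  simp at hxy <;> rcases hv with h | h <;> rcases hv' with h' | h' <;>
  rcases hv'' with h'' | h'' <;> simp only at h h' h'' <;> simp <;> grind

set_option maxHeartbeats 4000000 in
/-- A segment on an ideal triangle that cuts off a corner of the boundary face. -/
theorem triangle_turn (T : Incidence nxt prv opp w) {x y z v r s : S × Bool}
    (h2 : FaceSeg nxt prv w y z) (h3 : VertexSeg opp z v)
    (h4 : FaceSeg nxt prv w v r) (h5 : VertexSeg opp r s) (h6 : FaceSeg nxt prv w s x) :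
    (y = rot opp x → s = turnInv nxt prv opp x ∨ z = turn nxt prv opp y) ∧
    (y = rotInv opp x → s = turn nxt prv opp x ∨ z = turnInv nxt prv opp y) := by
  obtain ⟨hv', hne'⟩ := h3
  obtain ⟨hv'', hne''⟩ := h5
  have n := T.w_prv_opp_ne
  obtain ⟨a1, a2, a3, a4, a5, a6, a7, a8, a9⟩ := T
  unfold turn turnInv rot rotInv
  rcases h2 with ⟨q, q', rfl, rfl, e1⟩ | ⟨q, q', rfl, rfl, e1, e1'⟩ <;>
  rcases h4 with ⟨p, p', rfl, rfl, e2⟩ | ⟨p, p', rfl, rfl, e2, e2'⟩ <;>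
  rcases h6 with ⟨t, t', rfl, rfl, e3⟩ | ⟨t, t', rfl, rfl, e3, e3'⟩ <;>
  refine ⟨fun h => ?_, fun h => ?_⟩ <;> simp at h <;> rcases hv' with h' | h' <;>
  rcases hv'' with h'' | h'' <;> simp only at h' h'' <;> simp <;> grind

end Incidence

end AugLink

/-! ### Traversing the boundary of a disk, and the classification of short disks -/

namespace AugLink

/-! ### Cyclic sequences -/

theorem Fin.ofNat_add_one (k j : ℕ) :
    Fin.ofNat (k + 1) (j + 1) = Fin.ofNat (k + 1) j + 1 := by
  ext; simp [Fin.val_add]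

theorem Fin.sum_rotate {k : ℕ} {β : Type*} [AddCommMonoid β] (f : Fin (k + 1) → β)
    (p : Fin (k + 1)) :
    ∑ i, f i = ∑ j ∈ Finset.range (k + 1), f (p + Fin.ofNat (k + 1) j) := by
  rw [← Fin.sum_univ_eq_sum_range (fun j => f (p + Fin.ofNat (k + 1) j)),
    ← Equiv.sum_comp (Equiv.addLeft p)]
  refine Finset.sum_congr rfl fun i _ => ?_
  simp

namespace CombMap

variable {X : Type*} (M : CombMap X)

theorem follows_corner {z : X} {t : Option (Side X)} (h : M.Follows (some (.corner z)) t) :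
    ∃ v, t = some (.bdry v) ∧ M.IsSegment (.bdry z) (.bdry v) := by
  rcases t with _ | (x | x | x)
  · exact absurd h (by simp [Follows, flip, Side.Interior])
  · exact absurd h.1 (by simp [flip, OnFace])
  · exact absurd h.1 (by simp [flip, OnFace])
  · exact ⟨x, rfl, h⟩

/-- A step of the boundary of a disk that follows a step into an interior face. -/
theorem follows_of_interior {s : Side X} (hs : (M.flip s).Interior) {t : Option (Side X)}
    (h : M.Follows (some s) t) : t = none ∨
    (∃ e, t = some (.edge e) ∧ M.IsSegment (M.flip s) (.edge e)) ∨
    (∃ z, t = some (.corner z) ∧ M.IsSegment (M.flip s) (.corner z)) := by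
  rcases t with _ | (x | x | x)
  · exact .inl rfl
  · exact .inr (.inl ⟨x, rfl, h⟩)
  · exact .inr (.inr ⟨x, rfl, h⟩)
  · obtain ⟨h1, -⟩ := h
    rcases s with s | s | s <;> simp [flip, OnFace, Side.Interior] at h1 hs

/-- The contribution of a step to `numEdges + numBdry + 6 * numFree`. -/
def cost : Option (Side X) → ℕ
  | some (.edge _) => 1
  | some (.corner _) => 1
  | some (.bdry _) => 0
  | none => 6

namespace AdmDisk

variable {M} (Δ : M.AdmDisk)

/-- The steps of the boundary of a disk, beginning with the step `p`. -/
def stepFrom (p : Fin (Δ.k + 1)) (j : ℕ) : Option (Side X) :=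
  Δ.step (p + Fin.ofNat (Δ.k + 1) j)

theorem stepFrom_zero (p : Fin (Δ.k + 1)) : Δ.stepFrom p 0 = Δ.step p := by
  simp [stepFrom]

theorem stepFrom_succ (p : Fin (Δ.k + 1)) (j : ℕ) :
    Δ.stepFrom p (j + 1) = Δ.step (p + Fin.ofNat (Δ.k + 1) j + 1) := by
  rw [stepFrom, Fin.ofNat_add_one, add_assoc]

theorem follows_stepFrom (p : Fin (Δ.k + 1)) (j : ℕ) :
    M.Follows (Δ.stepFrom p j) (Δ.stepFrom p (j + 1)) := by
  rw [stepFrom_succ]; exact Δ.follows _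

theorem stepFrom_period (p : Fin (Δ.k + 1)) : Δ.stepFrom p (Δ.k + 1) = Δ.step p := by
  have : Fin.ofNat (Δ.k + 1) (Δ.k + 1) = 0 := by ext; simp
  rw [stepFrom, this, add_zero]

theorem after_eq (p : Fin (Δ.k + 1)) : Δ.after p = Δ.stepFrom p 2 := by
  rw [after, stepFrom_succ, Fin.ofNat_add_one Δ.k 0]; simp

theorem before_eq (p : Fin (Δ.k + 1)) : Δ.before p = (Δ.stepFrom p Δ.k).map M.flip := by
  rw [before]
  congr 2
  rw [sub_eq_iff_eq_add, add_assoc, ← Fin.ofNat_add_one]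
  have : Fin.ofNat (Δ.k + 1) (Δ.k + 1) = 0 := by ext; simp
  rw [this, add_zero]

theorem card_filter_eq (p : Fin (Δ.k + 1)) (P : Option (Side X) → Prop) :
    (Finset.univ.filter fun i : Fin (Δ.k + 1) => P (Δ.step i)).card
      = ∑ j ∈ Finset.range (Δ.k + 1), if P (Δ.stepFrom p j) then 1 else 0 := by
  rw [Finset.card_filter, Fin.sum_rotate _ p]; rfl

theorem numFree_eq (p : Fin (Δ.k + 1)) :
    Δ.numFree = ∑ j ∈ Finset.range (Δ.k + 1), if Δ.stepFrom p j = none then 1 else 0 := by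
  rw [numFree, Finset.card_filter, Fin.sum_rotate _ p]; rfl

theorem sum_cost (p : Fin (Δ.k + 1)) :
    Δ.numEdges + Δ.numBdry + 6 * Δ.numFree
      = ∑ j ∈ Finset.range (Δ.k + 1), cost (Δ.stepFrom p j) := by
  rw [numEdges, numBdry, Δ.numFree_eq p, Δ.card_filter_eq p (fun s => ∃ x, s = some (.edge x)),
    Δ.card_filter_eq p (fun s => ∃ x, s = some (.corner x)),
    Finset.mul_sum, ← Finset.sum_add_distrib, ← Finset.sum_add_distrib]
  refine Finset.sum_congr rfl fun j _ => ?_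
  rcases Δ.stepFrom p j with _ | (x | x | x) <;> simp [cost]

theorem numBdry_pos {p : Fin (Δ.k + 1)} {x : X} (h : Δ.step p = some (.corner x)) :
    0 < Δ.numBdry :=
  Finset.card_pos.mpr ⟨p, Finset.mem_filter.mpr ⟨Finset.mem_univ _, x, h⟩⟩

/-- `area ≥ (π / 2) * numBdry` rearranges to exactly this inequality; the weight 6 comes from the `3
π` charged for an arc through the interior. -/
theorem le_relLength (hb : 0 < Δ.numBdry)
    (h : 4 ≤ Δ.numEdges + Δ.numBdry + 6 * Δ.numFree) : Real.pi / 2 ≤ Δ.relLength := by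
  rw [relLength, area, le_div_iff₀ (by exact_mod_cast hb)]
  have h' : (4 : ℝ) ≤ Δ.numEdges + Δ.numBdry + 6 * Δ.numFree := by exact_mod_cast h
  nlinarith [Real.pi_pos]

end AdmDisk

end CombMap

namespace LinkDiagram.Direction

variable {D : Type*} [Finite D] {L : LinkDiagram D} {A : L.Direction}

theorem vertexSeg_of {x y : A.Dart} (h : A.poly.IsSegment (.bdry x) (.bdry y)) :
    Incidence.VertexSeg A.opposite x y := A.segment_bdry h

theorem faceSeg_of_corner {x y : A.Dart} (h : A.poly.IsSegment (.corner x) (.corner y)) :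
    Incidence.FaceSeg A.nxt A.prv A.white x y := A.segment_corner h

theorem faceSeg_of_edge {x y : A.Dart} (h : A.poly.IsSegment (.edge x) (.edge y)) :
    Incidence.FaceSeg A.nxt A.prv A.white x y := A.segment_edge h

theorem cornerEdgeSeg_of {y e : A.Dart} (h : A.poly.IsSegment (.corner y) (.edge e)) :
    Incidence.CornerEdgeSeg A.nxt A.prv A.opposite A.white y e := A.segment_corner_edge h

theorem cornerEdgeSeg_of' {y e : A.Dart} (h : A.poly.IsSegment (.edge e) (.corner y)) :
    Incidence.CornerEdgeSeg A.nxt A.prv A.opposite A.white y e := A.segment_edge_corner h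

theorem poly_α_eq (e : A.Dart) : A.poly.α e = Incidence.flipEdge A.nxt A.prv e := by
  obtain ⟨q, _ | _⟩ := e <;> rfl

/-- The disks that are shorter than `π / 2` have no edges, and two or three boundary segments. -/
theorem disk_cases (T : Incidence A.nxt A.prv A.opposite A.white) (Δ : A.poly.AdmDisk)
    (p : Fin (Δ.k + 1)) {x y : A.Dart} (hx : Δ.step p = some (.corner x))
    (hy : Δ.step (p + 1) = some (.bdry y)) :
    Real.pi / 2 ≤ Δ.relLength ∨
    (Δ.relLength = 0 ∧ ∃ z v, Δ.before p = some (.corner v) ∧ Δ.after p = some (.corner z) ∧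
      A.poly.IsSegment (.bdry x) (.bdry y) ∧ A.poly.IsSegment (.corner y) (.corner z) ∧
      A.poly.IsSegment (.bdry z) (.bdry v) ∧ A.poly.IsSegment (.corner v) (.corner x)) ∨
    (Δ.relLength = Real.pi / 3 ∧ ∃ z v r s, Δ.before p = some (.corner s) ∧
      Δ.after p = some (.corner z) ∧
      A.poly.IsSegment (.bdry x) (.bdry y) ∧ A.poly.IsSegment (.corner y) (.corner z) ∧
      A.poly.IsSegment (.bdry z) (.bdry v) ∧ A.poly.IsSegment (.corner v) (.corner r) ∧
      A.poly.IsSegment (.bdry r) (.bdry s) ∧ A.poly.IsSegment (.corner s) (.corner x)) := by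
  have hb := Δ.numBdry_pos hx
  by_cases h4 : 4 ≤ Δ.numEdges + Δ.numBdry + 6 * Δ.numFree
  · exact .inl (Δ.le_relLength hb h4)
  right
  have hcost := Δ.sum_cost p
  have hE := Δ.card_filter_eq p (fun s => ∃ x, s = some (.edge x))
  have hF := Δ.numFree_eq p
  change Δ.numEdges = _ at hE
  have hrel : Δ.relLength = (Δ.numEdges * (Real.pi / 2) + Real.pi * Δ.numBdry - 2 * Real.pi
    + 3 * Real.pi * Δ.numFree) / Δ.numBdry := rfl
  rw [Δ.after_eq, Δ.before_eq]
  have hper := Δ.stepFrom_period p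
  have hfol := Δ.follows_stepFrom p
  have t0 : Δ.stepFrom p 0 = some (.corner x) := by rw [Δ.stepFrom_zero, hx]
  have t1 : Δ.stepFrom p 1 = some (.bdry y) := by
    rw [Δ.stepFrom_succ]; simpa using hy
  rw [hx] at hper
  generalize Δ.stepFrom p = t at *
  clear hx hy p
  generalize Δ.k = k at *
  -- From here on the total cost is at most 3, and every further edge or boundary segment uses one
  -- unit. The boundary is followed step by step until it closes up or the budget is exceeded; an
  -- arc through the interior exceeds it at once.
  have hle : ∀ m, m ≤ k + 1 → ∑ j ∈ Finset.range m, CombMap.cost (t j) ≤ 3 := fun m hm =>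
    (Finset.sum_le_sum_of_subset (Finset.range_mono hm)).trans (by omega)
  have hxy : A.poly.IsSegment (.bdry x) (.bdry y) := by
    have := hfol 0
    rw [t0, t1] at this
    exact this
  have hxy' := vertexSeg_of hxy
  have f1 := hfol 1
  rw [t1] at f1
  rcases Nat.lt_or_ge k 1 with hk | hk
  · obtain rfl : k = 0 := by omega
    rw [t1] at hper; simp at hper
  rcases A.poly.follows_of_interior (s := .bdry y) trivial f1 with t2 | ⟨e, t2, s2⟩ | ⟨z, t2, s2⟩
  · rcases Nat.lt_or_ge k 2 with hk2 | hk2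
    · obtain rfl : k = 1 := by omega
      rw [t2] at hper; simp at hper
    · have := hle 3 (by omega)
      simp [Finset.sum_range_succ, t0, t1, t2, CombMap.cost] at this
  · exfalso
    rcases Nat.lt_or_ge k 2 with hk2 | hk2
    · obtain rfl : k = 1 := by omega
      rw [t2] at hper; simp at hper
    have f2 := hfol 2
    rw [t2] at f2
    rcases A.poly.follows_of_interior (s := .edge e) trivial f2 with t3 | ⟨e', t3, s3⟩ | ⟨z, t3, s3⟩
    · rcases Nat.lt_or_ge k 3 with hk3 | hk3
      · obtain rfl : k = 2 := by omega
        rw [t3] at hper; simp at hper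
      · have := hle 4 (by omega)
        simp [Finset.sum_range_succ, t0, t1, t2, t3, CombMap.cost] at this
    · rcases Nat.lt_or_ge k 3 with hk3 | hk3
      · obtain rfl : k = 2 := by omega
        rw [t3] at hper; simp at hper
      have f3 := hfol 3
      rw [t3] at f3
      rcases A.poly.follows_of_interior (s := .edge e') trivial f3 with
        t4 | ⟨e'', t4, s4⟩ | ⟨z, t4, s4⟩ <;> rcases Nat.lt_or_ge k 4 with hk4 | hk4
      · obtain rfl : k = 3 := by omega
        rw [t4] at hper; simp at hper
      · have := hle 5 (by omega)
        simp [Finset.sum_range_succ, t0, t1, t2, t3, t4, CombMap.cost] at this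
      · obtain rfl : k = 3 := by omega
        rw [t4] at hper; simp at hper
      · have := hle 5 (by omega)
        simp [Finset.sum_range_succ, t0, t1, t2, t3, t4, CombMap.cost] at this
      · obtain rfl : k = 3 := by omega
        rw [t4] at hper
        simp only [Option.some.injEq, Side.corner.injEq] at hper
        subst hper
        -- The type with two edges and one boundary segment.
        refine T.no_two_edges hxy' (cornerEdgeSeg_of s2) (e' := e') ?_ ?_
        · rw [← poly_α_eq]; exact faceSeg_of_edge s3
        · rw [← poly_α_eq]; exact cornerEdgeSeg_of' s4
      · have := hle 5 (by omega)
        simp [Finset.sum_range_succ, t0, t1, t2, t3, t4, CombMap.cost] at this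
    · rcases Nat.lt_or_ge k 3 with hk3 | hk3
      · obtain rfl : k = 2 := by omega
        rw [t3] at hper
        simp only [Option.some.injEq, Side.corner.injEq] at hper
        subst hper
        refine T.no_one_edge hxy' (cornerEdgeSeg_of s2) ?_
        rw [← poly_α_eq]; exact cornerEdgeSeg_of' s3
      have f3 := hfol 3
      rw [t3] at f3
      obtain ⟨v, t4, s4⟩ := A.poly.follows_corner f3
      rcases Nat.lt_or_ge k 4 with hk4 | hk4
      · obtain rfl : k = 3 := by omega
        rw [t4] at hper; simp at hper
      have f4 := hfol 4
      rw [t4] at f4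
      rcases A.poly.follows_of_interior (s := .bdry v) trivial f4 with
        t5 | ⟨e'', t5, s5⟩ | ⟨z', t5, s5⟩ <;> rcases Nat.lt_or_ge k 5 with hk5 | hk5
      · obtain rfl : k = 4 := by omega
        rw [t5] at hper; simp at hper
      · have := hle 6 (by omega)
        simp [Finset.sum_range_succ, t0, t1, t2, t3, t4, t5, CombMap.cost] at this
      · obtain rfl : k = 4 := by omega
        rw [t5] at hper; simp at hper
      · have := hle 6 (by omega)
        simp [Finset.sum_range_succ, t0, t1, t2, t3, t4, t5, CombMap.cost] at this
      · obtain rfl : k = 4 := by omega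
        rw [t5] at hper
        simp only [Option.some.injEq, Side.corner.injEq] at hper
        subst hper
        refine T.no_edge_vertex hxy' (cornerEdgeSeg_of s2) ?_ (vertexSeg_of s4)
          (faceSeg_of_corner s5)
        rw [← poly_α_eq]; exact cornerEdgeSeg_of' s3
      · have := hle 6 (by omega)
        simp [Finset.sum_range_succ, t0, t1, t2, t3, t4, t5, CombMap.cost] at this
  · rcases Nat.lt_or_ge k 2 with hk2 | hk2
    · obtain rfl : k = 1 := by omega
      rw [t2] at hper
      simp only [Option.some.injEq, Side.corner.injEq] at hper
      subst hper
      exact (T.no_loop hxy' (faceSeg_of_corner s2)).elim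
    have f2 := hfol 2
    rw [t2] at f2
    obtain ⟨v, t3, s3⟩ := A.poly.follows_corner f2
    rcases Nat.lt_or_ge k 3 with hk3 | hk3
    · obtain rfl : k = 2 := by omega
      rw [t3] at hper; simp at hper
    have f3 := hfol 3
    rw [t3] at f3
    rcases A.poly.follows_of_interior (s := .bdry v) trivial f3 with
      t4 | ⟨e, t4, s4⟩ | ⟨r, t4, s4⟩
    · rcases Nat.lt_or_ge k 4 with hk4 | hk4
      · obtain rfl : k = 3 := by omega
        rw [t4] at hper; simp at hper
      · have := hle 5 (by omega)
        simp [Finset.sum_range_succ, t0, t1, t2, t3, t4, CombMap.cost] at this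
    · exfalso
      rcases Nat.lt_or_ge k 4 with hk4 | hk4
      · obtain rfl : k = 3 := by omega
        rw [t4] at hper; simp at hper
      have f4 := hfol 4
      rw [t4] at f4
      rcases A.poly.follows_of_interior (s := .edge e) trivial f4 with
        t5 | ⟨e'', t5, s5⟩ | ⟨z', t5, s5⟩ <;> rcases Nat.lt_or_ge k 5 with hk5 | hk5
      · obtain rfl : k = 4 := by omega
        rw [t5] at hper; simp at hper
      · have := hle 6 (by omega)
        simp [Finset.sum_range_succ, t0, t1, t2, t3, t4, t5, CombMap.cost] at this
      · obtain rfl : k = 4 := by omega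
        rw [t5] at hper; simp at hper
      · have := hle 6 (by omega)
        simp [Finset.sum_range_succ, t0, t1, t2, t3, t4, t5, CombMap.cost] at this
      · obtain rfl : k = 4 := by omega
        rw [t5] at hper
        simp only [Option.some.injEq, Side.corner.injEq] at hper
        subst hper
        refine T.no_vertex_edge hxy' (faceSeg_of_corner s2) (vertexSeg_of s3)
          (cornerEdgeSeg_of s4) ?_
        rw [← poly_α_eq]; exact cornerEdgeSeg_of' s5
      · have := hle 6 (by omega)
        simp [Finset.sum_range_succ, t0, t1, t2, t3, t4, t5, CombMap.cost] at this
    · rcases Nat.lt_or_ge k 4 with hk4 | hk4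
      · obtain rfl : k = 3 := by omega
        rw [t4] at hper
        simp only [Option.some.injEq, Side.corner.injEq] at hper
        subst hper
        simp [Finset.sum_range_succ, -Finset.sum_boole, CombMap.cost, t0, t1, t2, t3] at hE hF hcost
        rw [hE, hF] at hcost
        simp only [mul_zero, add_zero, zero_add] at hcost
        refine .inl ⟨?_, z, v, by rw [t3]; rfl, t2, hxy, s2, s3, s4⟩
        rw [hrel, hE, hcost, hF]; norm_num; try ring
      have f4 := hfol 4
      rw [t4] at f4
      obtain ⟨s, t5, s5⟩ := A.poly.follows_corner f4
      rcases Nat.lt_or_ge k 5 with hk5 | hk5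
      · obtain rfl : k = 4 := by omega
        rw [t5] at hper; simp at hper
      have f5 := hfol 5
      rw [t5] at f5
      rcases A.poly.follows_of_interior (s := .bdry s) trivial f5 with
        t6 | ⟨e'', t6, s6⟩ | ⟨z', t6, s6⟩ <;> rcases Nat.lt_or_ge k 6 with hk6 | hk6
      · obtain rfl : k = 5 := by omega
        rw [t6] at hper; simp at hper
      · have := hle 7 (by omega)
        simp [Finset.sum_range_succ, t0, t1, t2, t3, t4, t5, t6, CombMap.cost] at this
      · obtain rfl : k = 5 := by omega
        rw [t6] at hper; simp at hper
      · have := hle 7 (by omega)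
        simp [Finset.sum_range_succ, t0, t1, t2, t3, t4, t5, t6, CombMap.cost] at this
      · obtain rfl : k = 5 := by omega
        rw [t6] at hper
        simp only [Option.some.injEq, Side.corner.injEq] at hper
        subst hper
        simp [Finset.sum_range_succ, -Finset.sum_boole, CombMap.cost, t0, t1, t2, t3, t4, t5] at hE hF hcost
        rw [hE, hF] at hcost
        simp only [mul_zero, add_zero, zero_add] at hcost
        refine .inr ⟨?_, z, v, r, s, by rw [t5]; rfl, t2, hxy, s2, s3, s4, s5, s6⟩
        rw [hrel, hE, hcost, hF]; norm_num; try ring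
      · have := hle 7 (by omega)
        simp [Finset.sum_range_succ, t0, t1, t2, t3, t4, t5, t6, CombMap.cost] at this

end LinkDiagram.Direction

end AugLink

/-! ### Gluing maps, framings, and the displacement of a curve -/

namespace AugLink

theorem Pos.mirror_mirror (p : Pos) : p.mirror.mirror = p := by cases p <;> rfl

theorem Pos.mirror_next (p : Pos) : p.next.mirror = p.mirror.prev := by cases p <;> rfl

theorem Pos.mirror_prev (p : Pos) : p.prev.mirror = p.mirror.next := by cases p <;> rfl

namespace LinkDiagram

variable {D : Type*} {L : LinkDiagram D}

theorem SameRegion.crossings_eq {d d' : D} (h : L.SameRegion d d') :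
    L.crossings d = L.crossings d' := by
  unfold crossings
  congr 2
  ext x
  exact ⟨fun h' => (h.symm).trans _ _ _ h', fun h' => Relation.EqvGen.trans _ _ _ h h'⟩

theorem sameRegion_row (d : D) : L.SameRegion d (L.row d) := by
  have e : ∀ x, L.SameRegion x (L.σ x) := fun x => .rel _ _ (.inl rfl)
  refine Relation.EqvGen.trans _ _ _ ?_ ((e _).trans _ _ _ (e _))
  by_cases hb : L.IsBigon d
  · rw [L.crossBigon_of hb]
    refine Relation.EqvGen.trans _ (L.α d) _ (.rel _ _ (.inr ⟨hb, rfl⟩)) ?_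
    rw [L.α_eq]
    exact (e _).symm
  · rw [L.crossBigon_of_not hb]; exact .refl _

theorem sameRegion_row_pow (d : D) (k : ℕ) : L.SameRegion d ((L.row ^ k) d) := by
  induction k with
  | zero => exact .refl _
  | succ k ih => rw [pow_succ']; exact ih.trans _ _ _ (L.sameRegion_row _)

namespace Direction

variable [Finite D] (A : L.Direction)

theorem crossings_otherTip (c : A.Tip) : L.crossings (A.otherTip c).1 = L.crossings c.1 := by
  obtain ⟨a, ha, he, hb⟩ := A.exists_row c
  rw [he]
  exact ((L.sameRegion_row_pow _ _).crossings_eq).symm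

theorem halfTwist_otherTip (c : A.Tip) : A.HalfTwist (A.otherTip c) ↔ A.HalfTwist c := by
  unfold HalfTwist; rw [crossings_otherTip]

/-- The gluing of the corners of shaded triangles. -/
def glueShaded (q : A.Shaded) : A.Shaded :=
  if A.HalfTwist q.1 then (A.otherTip q.1, q.2) else (A.otherTip q.1, q.2.mirror)

theorem glueShaded_fst (q : A.Shaded) : (A.glueShaded q).1 = A.otherTip q.1 := by
  unfold glueShaded; split_ifs <;> rfl

theorem glueShaded_glueShaded (q : A.Shaded) : A.glueShaded (A.glueShaded q) = q := by
  by_cases h : A.HalfTwist q.1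
  · simp [glueShaded, h, halfTwist_otherTip, otherTip_otherTip]
  · simp [glueShaded, h, halfTwist_otherTip, otherTip_otherTip, Pos.mirror_mirror]

theorem glueShaded_nxt_of (q : A.Shaded) (h : A.HalfTwist q.1) :
    A.glueShaded (A.nxt q) = A.nxt (A.glueShaded q) := by
  simp [glueShaded, nxt, h]

theorem glueShaded_nxt_of_not (q : A.Shaded) (h : ¬ A.HalfTwist q.1) :
    A.glueShaded (A.nxt q) = A.prv (A.glueShaded q) := by
  simp [glueShaded, nxt, prv, h, Pos.mirror_next]

theorem glueShaded_prv_of (q : A.Shaded) (h : A.HalfTwist q.1) :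
    A.glueShaded (A.prv q) = A.prv (A.glueShaded q) := by
  simp [glueShaded, prv, h]

theorem glueShaded_prv_of_not (q : A.Shaded) (h : ¬ A.HalfTwist q.1) :
    A.glueShaded (A.prv q) = A.nxt (A.glueShaded q) := by
  simp [glueShaded, nxt, prv, h, Pos.mirror_prev]

theorem glue_true (q : A.Shaded) (l : Bool) : A.glue ((q, true), l) = ((q, true), !l) := rfl

theorem glue_false (q : A.Shaded) (l : Bool) : A.glue ((q, false), l) =
    ((A.glueShaded q, false), if A.HalfTwist q.1 then !l else l) := by
  obtain ⟨c, p⟩ := q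
  by_cases h : A.HalfTwist c <;> simp [glue, glueShaded, h]

/-- The gluing of the corners of interior faces. -/
def glueCorner (x : A.Dart) : A.Dart := if x.2 then x else (A.glueShaded x.1, false)

theorem glueCorner_glueCorner (x : A.Dart) : A.glueCorner (A.glueCorner x) = x := by
  obtain ⟨q, _ | _⟩ := x <;> simp [glueCorner, glueShaded_glueShaded]

theorem glueSide_corner (x : A.Dart) : A.glueSide (.corner x) = .corner (A.glueCorner x) := by
  obtain ⟨⟨c, p⟩, _ | _⟩ := x
  · by_cases h : A.HalfTwist c <;> simp [glueSide, glueCorner, glueShaded, h]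
  · rfl

/-- The tracked point is defined by asking whether an arc ends at a specific corner, so gluing must
neither create nor destroy such an end. -/
theorem map_glueSide_eq_iff (β : Option (Side A.Dart)) (x : A.Dart) :
    β.map A.glueSide = some (.corner (A.glueCorner x)) ↔ β = some (.corner x) := by
  constructor
  · intro h
    rcases β with _ | (y | y | y)
    · simp at h
    · obtain ⟨⟨c, p⟩, _ | _⟩ := y <;> simp [glueSide] at h
      split_ifs at h
    · rw [Option.map_some, glueSide_corner, Option.some.injEq, Side.corner.injEq] at h
      rw [← A.glueCorner_glueCorner y, h, glueCorner_glueCorner]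
    · obtain ⟨⟨c, p⟩, _ | _⟩ := y <;> simp [glueSide] at h
      split_ifs at h
  · rintro rfl
    rw [Option.map_some, glueSide_corner]

/-- A set of ideal vertices that lie on a common boundary torus, with a choice, at every vertex, of
one of its two shaded corners: entering the boundary rectangle there is going upwards. -/
structure Framing where
  on : A.Shaded → Prop
  fw : A.Shaded → Bool
  on_opp : ∀ q, on q → on (A.opposite q)
  on_glue : ∀ q, on q → on (A.glueShaded q)
  fw_opp : ∀ q, on q → fw (A.opposite q) = !fw q
  fw_glue : ∀ q, on q → fw (A.glueShaded q) = !fw q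

theorem unitStep_zero : unitStep 0 = (0, 1) := by simp [unitStep]

theorem unitStep_one : unitStep 1 = (1, 0) := by
  have h : (1 : ZMod 4) ≠ 0 := by decide
  simp [unitStep, h]

theorem unitStep_two : unitStep 2 = (0, -1) := by
  have h : (2 : ZMod 4) ≠ 0 := by decide
  have h' : (2 : ZMod 4) ≠ 1 := by decide
  simp [unitStep, h, h']

theorem unitStep_three : unitStep 3 = (-1, 0) := by
  have h : (3 : ZMod 4) ≠ 0 := by decide
  have h1 : (3 : ZMod 4) ≠ 1 := by decide
  have h2 : (3 : ZMod 4) ≠ 2 := by decide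
  simp [unitStep, h, h1, h2]

theorem unitStep_add_two (e : ZMod 4) : unitStep (e + 2) = -unitStep e := by
  have : ∀ e : ZMod 4, e = 0 ∨ e = 1 ∨ e = 2 ∨ e = 3 := by decide
  have h1 : (1 : ZMod 4) + 2 = 3 := by decide
  have h2 : (2 : ZMod 4) + 2 = 0 := by decide
  have h3 : (3 : ZMod 4) + 2 = 1 := by decide
  rcases this e with rfl | rfl | rfl | rfl
  · simp [unitStep_zero, unitStep_two]
  · simp [h1, unitStep_one, unitStep_three]
  · simp [h2, unitStep_zero, unitStep_two]
  · simp [h3, unitStep_one, unitStep_three]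

namespace Framing

variable {A} (R : A.Framing)

/-- The direction in which a curve enters a boundary rectangle through the side `x`. -/
def dir (x : A.Dart) (l : Bool) : ZMod 4 :=
  if x.2 then (if R.fw x.1 = l then 1 else 3) else (if R.fw x.1 then 0 else 2)

/-- The outward normal at the side `x` of a boundary rectangle. -/
def out (x : A.Dart) (l : Bool) : ℤ × ℤ :=
  if x.2 then (if R.fw x.1 = l then (-1, 0) else (1, 0))
  else (if R.fw x.1 then (0, -1) else (0, 1))

theorem out_eq (x : A.Dart) (l : Bool) : R.out x l = unitStep (R.dir x l + 2) := by
  rw [unitStep_add_two]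
  unfold out dir
  split_ifs <;> simp [unitStep_zero, unitStep_one, unitStep_two, unitStep_three]

theorem on_opp_iff (q : A.Shaded) : R.on (A.opposite q) ↔ R.on q :=
  ⟨fun h => by simpa [A.opposite_opposite] using R.on_opp _ h, R.on_opp q⟩

theorem on_glue_iff (q : A.Shaded) : R.on (A.glueShaded q) ↔ R.on q :=
  ⟨fun h => by simpa [A.glueShaded_glueShaded] using R.on_glue _ h, R.on_glue q⟩

theorem on_of_sameTorus {z x : A.Dart × Bool} (h : A.SameTorus z x) :
    R.on z.1.1 ↔ R.on x.1.1 := by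
  induction h with
  | rel x y h =>
    obtain ⟨⟨q, _ | _⟩, l⟩ := x
    · rcases h with rfl | rfl
      · rfl
      · rw [A.glue_false]; exact (R.on_glue_iff q).symm
    · rcases h with rfl | rfl
      · exact (R.on_opp_iff q).symm
      · rfl
  | refl => rfl
  | symm _ _ _ ih => exact ih.symm
  | trans _ _ _ _ _ ih1 ih2 => exact ih1.trans ih2

theorem dir_glue {y x : A.Dart} {l l' : Bool} (hy : R.on y.1) (h : A.glue (y, l) = (x, l')) :
    R.dir x l' = R.dir y l + 2 := by
  have e1 : (1 : ZMod 4) + 2 = 3 := by decide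
  have e2 : (3 : ZMod 4) + 2 = 1 := by decide
  have e3 : (2 : ZMod 4) + 2 = 0 := by decide
  obtain ⟨q, _ | _⟩ := y
  · rw [A.glue_false] at h
    obtain ⟨rfl, rfl⟩ := Prod.mk.inj h
    have := R.fw_glue q hy
    cases hq : R.fw q <;> simp [dir, this, hq, e3]
  · rw [A.glue_true] at h
    obtain ⟨rfl, rfl⟩ := Prod.mk.inj h
    cases hq : R.fw q <;> cases l <;> simp [dir, hq, e1, e2]

/-- `dir` of the exit side plus a half turn is the direction of leaving. So the framing makes the
local turns telescope along the curve. -/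
theorem turn_eq {g : A.Seg} (hg : R.on g.enter.1)
    (h : A.poly.IsSegment (.bdry g.enter) (.bdry g.exit)) :
    A.turn g = R.dir g.exit g.level + 2 - R.dir g.enter g.level := by
  obtain ⟨h1, h2⟩ := A.segment_bdry h
  obtain ⟨l, ⟨q, b⟩, ⟨q', b'⟩⟩ := g
  simp only at h1 h2 hg
  have hne : A.opposite q ≠ q := fun h => by
    have := R.fw_opp q hg
    rw [h] at this
    cases hq : R.fw q <;> simp [hq] at this
  have ho := R.fw_opp q hg
  unfold turn
  simp only
  rcases h1 with rfl | rfl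
  · cases b <;> cases b' <;> simp at h2 <;>
      cases l <;> cases hq : R.fw q' <;>
      simp [dir, hq, ho, A.poly_σ_true, A.poly_σ_false, A.poly_σ_inv_true, A.poly_σ_inv_false, hne.symm, hne] <;> decide
  · cases b <;> cases b' <;>
      cases l <;> cases hq : R.fw q <;>
      simp [dir, hq, ho, A.poly_σ_true, A.poly_σ_false, A.poly_σ_inv_true, A.poly_σ_inv_false, hne.symm, hne] <;> decide

/-- The displacement of a closed curve is the sum of its steps. -/
theorem disp_eq_sum {z : A.Dart × Bool} (hz : R.on z.1.1) (γ : A.Curve) (hs : A.IsSimplicial γ)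
    (ht : A.OnTorus z γ) :
    (A.startDir γ = R.dir (γ.seg 0).enter (γ.seg 0).level →
      A.disp γ = ∑ i, R.out (γ.seg i).exit (γ.seg i).level) ∧
    (A.startDir γ = R.dir (γ.seg 0).enter (γ.seg 0).level + 2 →
      A.disp γ = -∑ i, R.out (γ.seg i).exit (γ.seg i).level) := by
  have hon : ∀ i, R.on (γ.seg i).enter.1 := fun i => (R.on_of_sameTorus (ht i)).mp hz
  have hon' : ∀ i, R.on (γ.seg i).exit.1 := fun i => by
    rcases (A.segment_bdry (hs i).1).1 with h | h
    · rw [h]; exact hon i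
    · rw [h]; exact R.on_opp _ (hon i)
  have key : ∀ i, ∑ j ∈ Finset.univ.filter (· ≤ i), A.turn (γ.seg j)
      = R.dir (γ.seg i).exit (γ.seg i).level + 2 - R.dir (γ.seg 0).enter (γ.seg 0).level := by
    intro i
    induction i using Fin.induction with
    | zero =>
      have : (Finset.univ.filter (· ≤ (0 : Fin (γ.m + 1)))) = {0} := by
        ext j; simp
      rw [this, Finset.sum_singleton, R.turn_eq (hon 0) (hs 0).1]
    | succ i ih =>
      have : (Finset.univ.filter (· ≤ i.succ))
          = insert i.succ (Finset.univ.filter (· ≤ i.castSucc)) := by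
        ext j
        simp only [Finset.mem_filter, Finset.mem_univ, true_and, Finset.mem_insert, Fin.le_def,
          Fin.ext_iff, Fin.val_succ, Fin.val_castSucc]
        omega
      rw [this, Finset.sum_insert (by simp [Fin.le_def]), ih, R.turn_eq (hon _) (hs _).1]
      have h := R.dir_glue (hon' i.castSucc) (hs i.castSucc).2
      rw [Fin.coeSucc_eq_succ] at h
      rw [h]; ring
  unfold disp
  constructor <;> intro h0
  · refine Finset.sum_congr rfl fun i _ => ?_
    rw [key, h0, R.out_eq]
    congr 1; ring
  · rw [← Finset.sum_neg_distrib]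
    refine Finset.sum_congr rfl fun i _ => ?_
    rw [key, h0, R.out_eq, ← unitStep_add_two]
    congr 1; ring

/-- `startDir` ignores orientation, so it agrees with the framing only up to a half turn; this is
the source of the sign. -/
theorem disp_eq {z : A.Dart × Bool} (hz : R.on z.1.1) (γ : A.Curve) (hs : A.IsSimplicial γ)
    (ht : A.OnTorus z γ) :
    A.disp γ = ∑ i, R.out (γ.seg i).exit (γ.seg i).level ∨
      A.disp γ = -∑ i, R.out (γ.seg i).exit (γ.seg i).level := by
  have h0 : A.startDir γ = R.dir (γ.seg 0).enter (γ.seg 0).level ∨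
      A.startDir γ = R.dir (γ.seg 0).enter (γ.seg 0).level + 2 := by
    have e2 : (3 : ZMod 4) + 2 = 1 := by decide
    have e3 : (2 : ZMod 4) + 2 = 0 := by decide
    unfold startDir dir
    split_ifs <;> simp [e2, e3]
  obtain ⟨h1, h2⟩ := R.disp_eq_sum hz γ hs ht
  exact h0.imp h1 h2

end Framing

end Direction

end LinkDiagram

end AugLink

/-! ### The tracked point and the lower bound for the length -/

namespace AugLink

namespace LinkDiagram.Direction

open Incidence

namespace Framing

variable {D : Type*} {L : LinkDiagram D} [Finite D] {A : L.Direction} (R : A.Framing)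

/-- The position, along the side `x` of a boundary rectangle, of the point that is tracked when a
curve crosses this side: the end of the side towards which the disk runs through the adjacent
face to the next ideal vertex, or else the midpoint. -/
def tangent (x : A.Dart) (β : Option (Side A.Dart)) (l : Bool) : ℤ × ℤ :=
  if β = some (.corner (Incidence.turn A.nxt A.prv A.opposite x)) then R.out (rotInv A.opposite x) l
  else if β = some (.corner (turnInv A.nxt A.prv A.opposite x)) then
    -R.out (rotInv A.opposite x) l
  else 0

/-- Twice the position of the tracked point relative to the centre of the rectangle. -/
def offset (x : A.Dart) (β : Option (Side A.Dart)) (l : Bool) : ℤ × ℤ :=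
  R.out x l + R.tangent x β l

/-- Both rectangles see the same point of their common side. Their centres differ by the outward
normal, which counts twice because offsets are doubled. A half-twist glues triangles by a rotation,
the other case by a reflection; each carries the ends of the side to the matching ends. -/
theorem offset_glue {y x : A.Dart} {l l' : Bool} (hy : R.on y.1) (h : A.glue (y, l) = (x, l'))
    (β : Option (Side A.Dart)) :
    R.offset x (β.map A.glueSide) l' = R.offset y β l - 2 • R.out y l := by
  obtain ⟨q, _ | _⟩ := y
  · rw [A.glue_false] at h
    obtain ⟨rfl, rfl⟩ := Prod.mk.inj h
    have h1 := R.fw_glue q hy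
    have h2 := R.fw_opp q hy
    have h3 := R.fw_opp _ (R.on_glue q hy)
    rw [h1, Bool.not_not] at h3
    have hne : A.nxt q ≠ A.prv q := by
      obtain ⟨c, _ | _ | _⟩ := q <;> simp [nxt, prv, Pos.next, Pos.prev]
    have e1 := A.map_glueSide_eq_iff β (A.nxt q, false)
    have e2 := A.map_glueSide_eq_iff β (A.prv q, false)
    by_cases ht : A.HalfTwist q.1
    · simp only [glueCorner, A.glueShaded_nxt_of q ht, A.glueShaded_prv_of q ht,
        Bool.false_eq_true, if_false] at e1 e2
      simp only [offset, tangent, Incidence.turn, turnInv, rotInv, out, h1, h2, h3, ht, e1, e2,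
        Bool.false_eq_true, if_false, if_true]
      by_cases b1 : β = some (.corner (A.nxt q, false))
      · cases hq : R.fw q <;> cases l <;> simp [b1]
      · by_cases b2 : β = some (.corner (A.prv q, false))
        · cases hq : R.fw q <;> cases l <;> simp [b2, hne.symm]
        · cases hq : R.fw q <;> cases l <;> simp [b1, b2]
    · simp only [glueCorner, A.glueShaded_nxt_of_not q ht, A.glueShaded_prv_of_not q ht,
        Bool.false_eq_true, if_false] at e1 e2
      simp only [offset, tangent, Incidence.turn, turnInv, rotInv, out, h1, h2, h3, ht, e1, e2,
        Bool.false_eq_true, if_false]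
      by_cases b1 : β = some (.corner (A.nxt q, false))
      · cases hq : R.fw q <;> cases l <;> simp [b1, hne]
      · by_cases b2 : β = some (.corner (A.prv q, false))
        · cases hq : R.fw q <;> cases l <;> simp [b2, hne.symm]
        · cases hq : R.fw q <;> cases l <;> simp [b1, b2]
  · rw [A.glue_true] at h
    obtain ⟨rfl, rfl⟩ := Prod.mk.inj h
    have e1 := A.map_glueSide_eq_iff β (Incidence.turn A.nxt A.prv A.opposite (q, true))
    have e2 := A.map_glueSide_eq_iff β (turnInv A.nxt A.prv A.opposite (q, true))
    have g1 : A.glueCorner (Incidence.turn A.nxt A.prv A.opposite (q, true))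
      = Incidence.turn A.nxt A.prv A.opposite (q, true) := rfl
    have g2 : A.glueCorner (turnInv A.nxt A.prv A.opposite (q, true))
      = turnInv A.nxt A.prv A.opposite (q, true) := rfl
    rw [g1] at e1
    rw [g2] at e2
    simp only [offset, tangent, e1, e2]
    have h1 : R.out (q, true) (!l) = -R.out (q, true) l := by
      cases hq : R.fw q <;> cases l <;> simp [out, hq]
    have h2 : R.out (rotInv A.opposite (q, true)) (!l) = R.out (rotInv A.opposite (q, true)) l := rfl
    rw [h1, h2, two_smul]; abel

theorem out_rot_rot {x : A.Dart} (hx : R.on x.1) (l : Bool) :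
    R.out (A.opposite x.1, x.2) l = -R.out x l := by
  have h := R.fw_opp _ hx
  obtain ⟨q, _ | _⟩ := x <;> cases hq : R.fw q <;> cases l <;> simp [out, hq, h]

theorem out_rotInv {x : A.Dart} (hx : R.on x.1) (l : Bool) :
    R.out (rotInv A.opposite x) l = -R.out (rot A.opposite x) l := by
  have h := R.fw_opp _ hx
  obtain ⟨q, _ | _⟩ := x <;> cases hq : R.fw q <;> cases l <;> simp [out, hq, h, rot, rotInv]

theorem out_shaded (q : A.Shaded) (l : Bool) :
    R.out (q, false) l = (0, 1) ∨ R.out (q, false) l = (0, -1) := by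
  cases hq : R.fw q <;> simp [out, hq]

theorem out_white (q : A.Shaded) (l : Bool) :
    R.out (q, true) l = (1, 0) ∨ R.out (q, true) l = (-1, 0) := by
  by_cases hq : R.fw q = l <;> simp [out, hq]

theorem rotInv_rot (x : A.Dart) : rotInv A.opposite (rot A.opposite x) = x := by
  obtain ⟨q, _ | _⟩ := x <;> simp [rot, rotInv, A.opposite_opposite]

theorem rot_rotInv (x : A.Dart) : rot A.opposite (rotInv A.opposite x) = x := by
  obtain ⟨q, _ | _⟩ := x <;> simp [rot, rotInv, A.opposite_opposite]

/-- The two coordinates of the outward normals at two adjacent sides. -/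
theorem out_cases (x : A.Dart) (l : Bool) :
    (x.2 = false ∧ (R.out x l = (0, 1) ∨ R.out x l = (0, -1)) ∧
      (R.out (rot A.opposite x) l = (1, 0) ∨ R.out (rot A.opposite x) l = (-1, 0))) ∨
    (x.2 = true ∧ (R.out x l = (1, 0) ∨ R.out x l = (-1, 0)) ∧
      (R.out (rot A.opposite x) l = (0, 1) ∨ R.out (rot A.opposite x) l = (0, -1))) := by
  obtain ⟨q, _ | _⟩ := x
  · exact .inl ⟨rfl, R.out_shaded _ _, R.out_white _ _⟩
  · exact .inr ⟨rfl, R.out_white _ _, R.out_shaded _ _⟩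

/-- The possible values of `tangent`. -/
theorem tangent_cases {x : A.Dart} (hx : R.on x.1) (β : Option (Side A.Dart)) (l : Bool) :
    R.tangent x β l = R.out (rot A.opposite x) l ∨ R.tangent x β l = -R.out (rot A.opposite x) l ∨
      R.tangent x β l = 0 := by
  have := R.out_rotInv hx l
  unfold tangent
  split_ifs
  · exact .inr (.inl this)
  · exact .inl (by rw [this, neg_neg])
  · exact .inr (.inr rfl)

theorem abs_offset_le {x : A.Dart} (hx : R.on x.1) (β : Option (Side A.Dart)) (l : Bool) :
    |(R.offset x β l).1| ≤ 1 ∧ |(R.offset x β l).2| ≤ 1 := by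
  unfold offset
  rcases R.out_cases x l with ⟨-, h1 | h1, h2 | h2⟩ | ⟨-, h1 | h1, h2 | h2⟩ <;>
    rcases R.tangent_cases hx β l with h3 | h3 | h3 <;> rw [h3, h1] <;> simp [h2]

theorem tangent_turn (x : A.Dart) (l : Bool) :
    R.tangent x (some (.corner (Incidence.turn A.nxt A.prv A.opposite x))) l
      = R.out (rotInv A.opposite x) l := by simp [tangent]

theorem tangent_turnInv (T : Incidence A.nxt A.prv A.opposite A.white) (x : A.Dart) (l : Bool) :
    R.tangent x (some (.corner (turnInv A.nxt A.prv A.opposite x))) l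
      = -R.out (rotInv A.opposite x) l := by
  have := (T.turn_ne_turnInv x).symm
  simp [tangent, this]

/-- The tracked point does not move at a disk of length zero. -/
theorem offset_zero (T : Incidence A.nxt A.prv A.opposite A.white) {x y z v : A.Dart} (l : Bool)
    (hx : R.on x.1) (hy : R.on y.1)
    (h1 : A.poly.IsSegment (.bdry x) (.bdry y)) (h2 : A.poly.IsSegment (.corner y) (.corner z))
    (h3 : A.poly.IsSegment (.bdry z) (.bdry v)) (h4 : A.poly.IsSegment (.corner v) (.corner x)) :
    R.offset y (some (.corner z)) l = R.offset x (some (.corner v)) l := by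
  rcases T.zero_disk (vertexSeg_of h1) (faceSeg_of_corner h2) (vertexSeg_of h3)
    (faceSeg_of_corner h4) with ⟨rfl, rfl, rfl⟩ | ⟨hy', rfl, rfl⟩
  · rw [offset, offset, R.tangent_turn, R.tangent_turnInv T, R.out_rotInv hx, rotInv_rot]; abel
  · have hx' : x = rot A.opposite y := by rw [hy', rot_rotInv]
    rw [offset, offset, R.tangent_turn, R.tangent_turnInv T, R.out_rotInv hy, ← hy', ← hx']; abel

/-- The motion of the tracked point at an ideal triangle. -/
theorem offset_triangle (T : Incidence A.nxt A.prv A.opposite A.white) {x y z v r s : A.Dart}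
    (l : Bool) (hx : R.on x.1) (hy : R.on y.1)
    (h1 : A.poly.IsSegment (.bdry x) (.bdry y)) (h2 : A.poly.IsSegment (.corner y) (.corner z))
    (h3 : A.poly.IsSegment (.bdry z) (.bdry v)) (h4 : A.poly.IsSegment (.corner v) (.corner r))
    (h5 : A.poly.IsSegment (.bdry r) (.bdry s)) (h6 : A.poly.IsSegment (.corner s) (.corner x)) :
    2 * |(R.offset y (some (.corner z)) l - R.offset x (some (.corner s)) l).1| +
      |(R.offset y (some (.corner z)) l - R.offset x (some (.corner s)) l).2| ≤ 4 := by
  have g1 := vertexSeg_of h1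
  have g2 := faceSeg_of_corner h2
  have g3 := vertexSeg_of h3
  have g4 := faceSeg_of_corner h4
  have g5 := vertexSeg_of h5
  have g6 := faceSeg_of_corner h6
  by_cases hxy : y.2 = x.2
  · have hy' : y = (A.opposite x.1, x.2) := by
      rcases g1.1 with h | h
      · exact absurd (Prod.ext h hxy) g1.2
      · exact Prod.ext h hxy
    have ho : R.out y l = -R.out x l := by rw [hy', R.out_rot_rot hx]
    have hr : R.out (rotInv A.opposite y) l = -R.out (rotInv A.opposite x) l := by
      rw [R.out_rotInv hx, R.out_rotInv hy, hy']
      have := R.out_rot_rot (x := rot A.opposite x) (l := l) (by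
        obtain ⟨q, _ | _⟩ := x
        · exact hx
        · exact R.on_opp _ hx)
      rw [← this]
      obtain ⟨q, _ | _⟩ := x <;> rfl
    obtain ⟨t1, t2⟩ := T.triangle_straight g1 g2 g3 g4 g5 g6 hxy
    obtain ⟨t3, t4⟩ := T.triangle_straight (VertexSeg.symm T g1) (FaceSeg.symm T g6)
      (VertexSeg.symm T g5) (FaceSeg.symm T g4) (VertexSeg.symm T g3) (FaceSeg.symm T g2) hxy.symm
    have ht : R.tangent y (some (.corner z)) l = R.tangent x (some (.corner s)) l := by
      by_cases c1 : s = Incidence.turn A.nxt A.prv A.opposite x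
      · rw [t1 c1, c1, R.tangent_turn, R.tangent_turnInv T, hr, neg_neg]
      · by_cases c2 : s = turnInv A.nxt A.prv A.opposite x
        · rw [t2 c2, c2, R.tangent_turn, R.tangent_turnInv T, hr]
        · have c3 := mt t3 c2
          have c4 := mt t4 c1
          simp [tangent, c1, c2, c3, c4]
    rw [offset, offset, ht, ho]
    rcases R.out_cases x l with ⟨-, e1 | e1, -⟩ | ⟨-, e1 | e1, -⟩ <;> rw [e1] <;> simp
  · obtain ⟨t1, t2⟩ := T.triangle_turn g2 g3 g4 g5 g6
    -- One of two adjacent sides lies on a triangle, which has only two other corners, so the mark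
    -- on that side is always an end. If it is the cut-off corner, the point moves along the white
    -- side. Otherwise `triangle_turn` puts the other mark at the cut-off corner and the point moves
    -- along the shaded side.
    have main : ∀ {x y s z : A.Dart}, R.on x.1 → R.on y.1 → y = rot A.opposite x →
        (s = turnInv A.nxt A.prv A.opposite x ∨ z = Incidence.turn A.nxt A.prv A.opposite y) →
        FaceSeg A.nxt A.prv A.white s x → FaceSeg A.nxt A.prv A.white y z →
        2 * |(R.offset y (some (.corner z)) l - R.offset x (some (.corner s)) l).1| +
        |(R.offset y (some (.corner z)) l - R.offset x (some (.corner s)) l).2| ≤ 4 := by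
      intro x y s z hx hy hyx hsz g6 g2
      have r1 : R.out (rotInv A.opposite x) l = -R.out y l := by rw [R.out_rotInv hx, hyx]
      have r2 : rotInv A.opposite y = x := by rw [hyx, rotInv_rot]
      have tz : R.tangent y (some (.corner z)) l = R.out x l ∨
          R.tangent y (some (.corner z)) l = -R.out x l ∨ R.tangent y (some (.corner z)) l = 0 := by
        have := R.tangent_cases hy (some (.corner z)) l
        rw [← neg_neg (R.out (rot A.opposite y) l), ← R.out_rotInv hy, r2, neg_neg] at this
        tauto
      have ts := R.tangent_cases hx (some (.corner s)) l
      rw [← hyx] at ts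
      have u1 : s = turnInv A.nxt A.prv A.opposite x →
          R.tangent x (some (.corner s)) l = R.out y l := by
        rintro rfl; rw [R.tangent_turnInv T, r1, neg_neg]
      have u2 : z = Incidence.turn A.nxt A.prv A.opposite y →
          R.tangent y (some (.corner z)) l = R.out x l := by
        rintro rfl; rw [R.tangent_turn, r2]
      have u3 : x.2 = false → s = Incidence.turn A.nxt A.prv A.opposite x ∨
          s = turnInv A.nxt A.prv A.opposite x :=
        faceSeg_shaded (FaceSeg.symm T g6)
      have u4 : y.2 = false → z = Incidence.turn A.nxt A.prv A.opposite y ∨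
          z = turnInv A.nxt A.prv A.opposite y := faceSeg_shaded g2
      have u5 : s = Incidence.turn A.nxt A.prv A.opposite x →
          R.tangent x (some (.corner s)) l = -R.out y l := by
        rintro rfl; rw [R.tangent_turn, r1]
      have u6 : z = turnInv A.nxt A.prv A.opposite y →
          R.tangent y (some (.corner z)) l = -R.out x l := by
        rintro rfl; rw [R.tangent_turnInv T, r2]
      have hc := R.out_cases x l
      rw [← hyx] at hc
      simp only [offset]
      rcases hc with ⟨hx2, e1, e2⟩ | ⟨hx2, e1, e2⟩
      · rcases u3 hx2 with c | c
        · have hz : z = Incidence.turn A.nxt A.prv A.opposite y := by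
            rcases hsz with h | h
            · exact absurd (c.symm.trans h) (T.turn_ne_turnInv x)
            · exact h
          rw [u5 c, u2 hz]
          rcases e1 with e1 | e1 <;> rcases e2 with e2 | e2 <;> rw [e1, e2] <;> simp
        · rw [u1 c]
          rcases tz with tz | tz | tz <;> rw [tz] <;>
            rcases e1 with e1 | e1 <;> rcases e2 with e2 | e2 <;> rw [e1, e2] <;> simp
      · have hy2 : y.2 = false := by
          obtain ⟨q, _ | _⟩ := x
          · simp at hx2
          · rw [hyx]; rfl
        rcases u4 hy2 with c | c
        · rw [u2 c]
          rcases ts with ts | ts | ts <;> rw [ts] <;>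
            rcases e1 with e1 | e1 <;> rcases e2 with e2 | e2 <;> rw [e1, e2] <;> simp
        · have hs : s = turnInv A.nxt A.prv A.opposite x := by
            rcases hsz with h | h
            · exact h
            · exact absurd (h.symm.trans c) (T.turn_ne_turnInv y)
          rw [u6 c, u1 hs]
          rcases e1 with e1 | e1 <;> rcases e2 with e2 | e2 <;> rw [e1, e2] <;> simp
    have hyx : y = rot A.opposite x ∨ y = rotInv A.opposite x := by
      obtain ⟨q, b⟩ := x
      obtain ⟨q', b'⟩ := y
      rcases g1.1 with h | h <;> simp only at h hxy <;> subst h <;> cases b <;> cases b' <;>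
        simp [rot, rotInv] at hxy ⊢
    rcases hyx with h | h
    · exact main hx hy h (t1 h) g6 g2
    -- The opposite turn is the same disk traversed backwards, which negates the motion.
    · have h' : x = rot A.opposite y := by rw [h, rot_rotInv]
      have := main hy hx h' ((t2 h).symm) (FaceSeg.symm T g2) (FaceSeg.symm T g6)
      rw [← neg_sub (R.offset x (some (.corner s)) l), Prod.fst_neg, Prod.snd_neg, abs_neg,
        abs_neg]
      exact this

/-- The length of a disk bounds the motion of the tracked point. -/
theorem offset_le_relLength (T : Incidence A.nxt A.prv A.opposite A.white)
    (Δ : A.poly.AdmDisk) (p : Fin (Δ.k + 1)) {x y : A.Dart} (l : Bool)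
    (hx : R.on x.1) (hy : R.on y.1)
    (hx' : Δ.step p = some (.corner x)) (hy' : Δ.step (p + 1) = some (.bdry y)) :
    (2 * |((R.offset y (Δ.after p) l - R.offset x (Δ.before p) l).1 : ℝ)| +
      |((R.offset y (Δ.after p) l - R.offset x (Δ.before p) l).2 : ℝ)|) * (Real.pi / 12)
        ≤ Δ.relLength ∧
    |((R.offset y (Δ.after p) l - R.offset x (Δ.before p) l).2 : ℝ)| * (Real.pi / 6)
        ≤ Δ.relLength := by
  have hpi := Real.pi_pos
  obtain ⟨a1, a2⟩ := R.abs_offset_le hx (Δ.before p) l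
  obtain ⟨b1, b2⟩ := R.abs_offset_le hy (Δ.after p) l
  have c1 : |(R.offset y (Δ.after p) l - R.offset x (Δ.before p) l).1| ≤ 2 := by
    rw [Prod.fst_sub]; rw [abs_le] at *; constructor <;> linarith [a1.1, a1.2, b1.1, b1.2]
  have c2 : |(R.offset y (Δ.after p) l - R.offset x (Δ.before p) l).2| ≤ 2 := by
    rw [Prod.snd_sub]; rw [abs_le] at *; constructor <;> linarith [a2.1, a2.2, b2.1, b2.2]
  -- The constants are exact in the extreme cases: `(2 * 2 + 2) * π / 12 = π / 2` for a general
  -- disk, and `4 * π / 12 = 2 * π / 6 = π / 3` for an ideal triangle.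
  rcases disk_cases T Δ p hx' hy' with h | ⟨h, z, v, hb, ha, h1, h2, h3, h4⟩ |
    ⟨h, z, v, r, s, hb, ha, h1, h2, h3, h4, h5, h6⟩
  · generalize R.offset y (Δ.after p) l - R.offset x (Δ.before p) l = w at *
    have c1' : |(w.1 : ℝ)| ≤ 2 := by exact_mod_cast c1
    have c2' : |(w.2 : ℝ)| ≤ 2 := by exact_mod_cast c2
    constructor <;> nlinarith
  · rw [hb, ha, R.offset_zero T l hx hy h1 h2 h3 h4, h]
    simp
  · have c3 := R.offset_triangle T l hx hy h1 h2 h3 h4 h5 h6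
    rw [← hb, ← ha] at c3
    generalize R.offset y (Δ.after p) l - R.offset x (Δ.before p) l = w at *
    have c2' : |(w.2 : ℝ)| ≤ 2 := by exact_mod_cast c2
    have c3' : 2 * |(w.1 : ℝ)| + |(w.2 : ℝ)| ≤ 4 := by exact_mod_cast c3
    rw [h]
    constructor <;> nlinarith

/-- The displacement of a closed curve, up to sign. -/
def total (γ : A.Curve) : ℤ × ℤ := ∑ i, R.out (γ.seg i).exit (γ.seg i).level

theorem total_le (T : Incidence A.nxt A.prv A.opposite A.white) {z : A.Dart × Bool}
    (hz : R.on z.1.1) (γ : A.Curve) (hs : A.IsSimplicial γ) (ht : A.OnTorus z γ)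
    (H : A.InwardExtension γ) :
    |((R.total γ).1 : ℝ)| * (Real.pi / 3) + |((R.total γ).2 : ℝ)| * (Real.pi / 6)
      ≤ ∑ i, (H.disk i).relLength ∧
    |((R.total γ).2 : ℝ)| * (Real.pi / 3) ≤ ∑ i, (H.disk i).relLength := by
  have hpi := Real.pi_pos
  have hon : ∀ i, R.on (γ.seg i).enter.1 := fun i => (R.on_of_sameTorus (ht i)).mp hz
  have hon' : ∀ i, R.on (γ.seg i).exit.1 := fun i => by
    rcases (A.segment_bdry (hs i).1).1 with h | h
    · rw [h]; exact hon i
    · rw [h]; exact R.on_opp _ (hon i)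
  set a : Fin (γ.m + 1) → ℤ × ℤ := fun i =>
    R.offset (γ.seg i).exit ((H.disk i).after (H.pos i)) (γ.seg i).level
  set b : Fin (γ.m + 1) → ℤ × ℤ := fun i =>
    R.offset (γ.seg i).enter ((H.disk i).before (H.pos i)) (γ.seg i).level
  have hab : ∀ i, b (i + 1) = a i - 2 • R.out (γ.seg i).exit (γ.seg i).level := by
    intro i
    simp only [a, b]
    rw [H.agree i, ← R.offset_glue (hon' i) (hs i).2]
  -- Around the closed curve the jumps between rectangle centres are compensated by the motion of
  -- the point inside the rectangles.
  have hsum : 2 • R.total γ = ∑ i, (a i - b i) := by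
    have h1 : ∑ i, b (i + 1) = ∑ i, b i := Equiv.sum_comp (Equiv.addRight 1) b
    have h2 : ∑ i, b (i + 1) = ∑ i, a i - 2 • R.total γ := by
      rw [Finset.sum_congr rfl fun i _ => hab i, Finset.sum_sub_distrib, total, Finset.smul_sum]
    rw [Finset.sum_sub_distrib, ← h1, h2]; abel
  have s1 : 2 * |((R.total γ).1 : ℝ)| ≤ ∑ i, |((a i - b i).1 : ℝ)| := by
    have : (2 * (R.total γ).1 : ℝ) = ∑ i, ((a i - b i).1 : ℝ) := by
      have := congrArg Prod.fst hsum
      rw [Prod.fst_sum] at this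
      exact_mod_cast this
    rw [← abs_two, ← abs_mul, this]
    exact Finset.abs_sum_le_sum_abs _ _
  have s2 : 2 * |((R.total γ).2 : ℝ)| ≤ ∑ i, |((a i - b i).2 : ℝ)| := by
    have : (2 * (R.total γ).2 : ℝ) = ∑ i, ((a i - b i).2 : ℝ) := by
      have := congrArg Prod.snd hsum
      rw [Prod.snd_sum] at this
      exact_mod_cast this
    rw [← abs_two, ← abs_mul, this]
    exact Finset.abs_sum_le_sum_abs _ _
  have key := fun i => R.offset_le_relLength T (H.disk i) (H.pos i) (γ.seg i).level (hon i)
    (hon' i) (H.enter i) (H.exit i)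
  have k1 := Finset.sum_le_sum fun i (_ : i ∈ Finset.univ) => (key i).1
  have k2 := Finset.sum_le_sum fun i (_ : i ∈ Finset.univ) => (key i).2
  rw [← Finset.sum_mul] at k1 k2
  rw [Finset.sum_add_distrib, ← Finset.mul_sum] at k1
  constructor
  · refine le_trans ?_ k1
    nlinarith
  · refine le_trans ?_ k2
    nlinarith

end Framing

end LinkDiagram.Direction

end AugLink

/-! ### Slopes on crossing circles -/

namespace AugLink

namespace LinkDiagram.Direction

variable {D : Type*} {L : LinkDiagram D} [Finite D] (A : L.Direction)

theorem isSegment_bdry {x y : A.Dart} (h : y.1 = x.1 ∨ y.1 = A.opposite x.1) (hne : y ≠ x) :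
    A.poly.IsSegment (.bdry x) (.bdry y) := by
  refine ⟨?_, by simpa using hne, by simp [CombMap.flip], id, id⟩
  have step : ∀ x, A.poly.SameVertex x (A.poly.σ x) :=
    fun x => Equiv.Perm.sameCycle_apply_right.mpr (.refl _ _)
  have key : ∀ q, A.poly.SameVertex (q, false) (A.opposite q, false) := fun q => by
    have h := (step (q, false)).trans (step _)
    rwa [A.poly_σ_false, A.poly_σ_true] at h
  have key' : ∀ x : A.Dart, A.poly.SameVertex (x.1, false) x := by
    rintro ⟨q, _ | _⟩
    · exact .refl _ _
    · exact step (q, false)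
  change A.poly.SameVertex x y
  rcases h with h | h
  · exact (key' x).symm.trans (h ▸ key' y)
  · exact ((key' x).symm.trans (key x.1)).trans (h ▸ key' y)

/-- A disk that cuts off a boundary segment by an arc through the interior. -/
def freeDisk (x y : A.Dart) (h : A.poly.IsSegment (.bdry x) (.bdry y)) : A.poly.AdmDisk where
  k := 2
  step := ![some (.corner x), some (.bdry y), none]
  follows := by
    intro i
    fin_cases i
    · exact h
    · trivial
    · trivial

/-- An inward extension by disks with arcs through the interior. -/
def freeExtension (γ : A.Curve) (hs : A.IsSimplicial γ) : A.InwardExtension γ where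
  disk i := A.freeDisk _ _ (hs i).1
  pos _ := (0 : Fin 3)
  enter _ := rfl
  exit _ := rfl
  agree _ := rfl

/-- The infimum of the empty set would be the default value `0`, so some inward extension is needed;
disks with an arc through the interior always provide one. -/
theorem le_curveLength {γ : A.Curve} (hs : A.IsSimplicial γ) {r : ℝ}
    (h : ∀ H : A.InwardExtension γ, r ≤ ∑ i, (H.disk i).relLength) : r ≤ A.curveLength γ := by
  refine le_csInf ⟨_, A.freeExtension γ hs, rfl⟩ ?_
  rintro _ ⟨H, rfl⟩
  exact h H

namespace Framing

variable {A} (R : A.Framing)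

theorem le_curveLength (T : Incidence A.nxt A.prv A.opposite A.white) {z : A.Dart × Bool}
    (hz : R.on z.1.1) (γ : A.Curve) (hs : A.IsSimplicial γ) (ht : A.OnTorus z γ) :
    |((A.disp γ).1 : ℝ)| * (Real.pi / 3) + |((A.disp γ).2 : ℝ)| * (Real.pi / 6)
      ≤ A.curveLength γ ∧
    |((A.disp γ).2 : ℝ)| * (Real.pi / 3) ≤ A.curveLength γ := by
  have h1 : |((A.disp γ).1 : ℝ)| = |((R.total γ).1 : ℝ)| := by
    rcases R.disp_eq hz γ hs ht with h | h <;> rw [h] <;> simp [total]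
  have h2 : |((A.disp γ).2 : ℝ)| = |((R.total γ).2 : ℝ)| := by
    rcases R.disp_eq hz γ hs ht with h | h <;> rw [h] <;> simp [total]
  rw [h1, h2]
  exact ⟨A.le_curveLength hs fun H => (R.total_le T hz γ hs ht H).1,
    A.le_curveLength hs fun H => (R.total_le T hz γ hs ht H).2⟩

end Framing

/-- The framing of the torus of a crossing circle. -/
def circleFraming (c : A.Tip) : A.Framing where
  on q := q.2 = .circ ∧ (q.1 = c ∨ q.1 = A.otherTip c)
  fw q := decide (q.1 = c)
  on_opp := by
    rintro ⟨t, p⟩ ⟨h, h'⟩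
    simp only at h h'; subst h
    rw [A.opposite_circ]
    rcases h' with rfl | rfl <;> simp [A.otherTip_otherTip]
  on_glue := by
    rintro ⟨t, p⟩ ⟨h, h'⟩
    simp only at h h'; subst h
    rcases h' with rfl | rfl <;> simp [glueShaded_fst, A.otherTip_otherTip] <;>
    · unfold glueShaded; split_ifs <;> rfl
  fw_opp := by
    rintro ⟨t, p⟩ ⟨h, h'⟩
    simp only at h h'; subst h
    rw [A.opposite_circ]
    rcases h' with rfl | rfl <;> simp [A.otherTip_otherTip, A.otherTip_ne]
  fw_glue := by
    rintro ⟨t, p⟩ ⟨h, h'⟩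
    rw [glueShaded_fst]
    rcases h' with h' | h' <;> simp only at h' <;> subst h' <;>
      simp [A.otherTip_otherTip, A.otherTip_ne]

theorem circleFraming_on (c : A.Tip) : (A.circleFraming c).on (c, .circ) := ⟨rfl, .inl rfl⟩

theorem circle_sameTorus (c : A.Tip) (t : A.Tip) (h : t = c ∨ t = A.otherTip c) (b l : Bool) :
    A.SameTorus (A.circleTorus c) (((t, .circ), b), l) := by
  have step : ∀ q l, A.SameTorus ((q, false), l) ((q, true), l) := fun q l => .rel _ _ (.inl rfl)
  have step' : ∀ q l, A.SameTorus ((q, true), l) ((A.opposite q, false), l) :=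
    fun q l => .rel _ _ (.inl rfl)
  have step'' : ∀ q l, A.SameTorus ((q, true), l) ((q, true), !l) := fun q l => .rel _ _ (.inr rfl)
  have e1 : ∀ l, A.SameTorus (A.circleTorus c) (((c, .circ), true), l) := by
    rintro (_ | _)
    · exact step'' _ _
    · exact .refl _
  have e2 : ∀ l, A.SameTorus (A.circleTorus c) (((A.otherTip c, .circ), false), l) := fun l =>
    (e1 l).trans _ _ _ (step' (c, .circ) l)
  rcases h with rfl | rfl <;> cases b
  · exact (e1 l).trans _ _ _ ((step _ l).symm)
  · exact e1 l
  · exact e2 l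
  · exact (e2 l).trans _ _ _ (step _ l)

theorem onTorus_circle (c : A.Tip) (γ : A.Curve)
    (h : ∀ i, (A.circleFraming c).on (γ.seg i).enter.1) : A.OnTorus (A.circleTorus c) γ := by
  intro i
  have := h i
  generalize (γ.seg i).enter = x at *
  obtain ⟨⟨t, p⟩, b⟩ := x
  obtain ⟨rfl, h⟩ := this
  exact A.circle_sameTorus c t h b _

theorem glue_circ_false (t : A.Tip) (l : Bool) : A.glue (((t, .circ), false), l) =
    (((A.otherTip t, .circ), false), if A.HalfTwist t then !l else l) := by
  rw [glue_false]
  unfold glueShaded; split_ifs <;> rfl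

theorem isSimplicial_pair {g h : A.Seg} (hg : A.poly.IsSegment (.bdry g.enter) (.bdry g.exit))
    (hh : A.poly.IsSegment (.bdry h.enter) (.bdry h.exit))
    (e : A.glue (g.exit, g.level) = (h.enter, h.level))
    (e' : A.glue (h.exit, h.level) = (g.enter, g.level)) : A.IsSimplicial ⟨1, ![g, h]⟩ := by
  refine Fin.forall_fin_two.mpr ⟨⟨hg, e⟩, ⟨hh, ?_⟩⟩
  have h0 : ((1 : Fin (1 + 1)) + 1) = 0 := by decide
  simp only [h0]
  exact e'

theorem disp_circleLongitude (c : A.Tip) : A.disp (A.circleLongitude c) = (2, 0) := by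
  have hne := A.otherTip_ne c
  have hs : A.IsSimplicial (A.circleLongitude c) :=
    A.isSimplicial_pair (A.isSegment_bdry (.inr rfl) (by simpa using hne))
      (A.isSegment_bdry (.inr (by simp [A.opposite_circ, A.otherTip_otherTip]))
        (by simpa using hne.symm)) rfl rfl
  have ht := A.onTorus_circle c (A.circleLongitude c)
    (Fin.forall_fin_two.mpr ⟨⟨rfl, .inl rfl⟩, ⟨rfl, .inr rfl⟩⟩)
  rw [((A.circleFraming c).disp_eq_sum (A.circleFraming_on c) _ hs ht).1
    (by simp [startDir, circleLongitude, Framing.dir, circleFraming])]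
  change ∑ i : Fin 2, _ = _
  rw [Fin.sum_univ_two]
  simp [circleLongitude, Framing.out, circleFraming, hne]

/-- The framing calls entering at `c` upwards. The curves used here start at the other tip, hence
downwards, while `startDir` calls that direction `𝐰`. -/
theorem disp_eq_neg_total (c : A.Tip) (γ : A.Curve) (hs : A.IsSimplicial γ)
    (h : ∀ i, (A.circleFraming c).on (γ.seg i).enter.1)
    (h0 : (γ.seg 0).enter = ((A.otherTip c, .circ), false)) :
    A.disp γ = -(A.circleFraming c).total γ := by
  have e2 : (2 : ZMod 4) + 2 = 0 := by decide
  refine ((A.circleFraming c).disp_eq_sum (A.circleFraming_on c) _ hs (A.onTorus_circle c γ h)).2 ?_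
  simp [startDir, h0, Framing.dir, circleFraming, A.otherTip_ne, e2]

theorem disp_circleMeridian (c : A.Tip) : A.disp (A.circleMeridian c) = (A.residue c, 1) := by
  have hne := A.otherTip_ne c
  have opp : ∀ b b', A.poly.IsSegment (.bdry ((A.otherTip c, .circ), b)) (.bdry ((c, .circ), b')) :=
    fun b b' => A.isSegment_bdry (.inr (by simp [A.opposite_circ, A.otherTip_otherTip]))
      (by simp [hne.symm])
  unfold circleMeridian residue
  split_ifs with h1 h2
  · rw [A.disp_eq_neg_total c]
    · change -∑ i : Fin 2, _ = _
      rw [Fin.sum_univ_two]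
      simp [Framing.out, circleFraming]
    · exact A.isSimplicial_pair (opp _ _) (A.isSegment_bdry (.inl rfl) (by simp)) rfl
        ((A.glue_circ_false c _).trans (by simp [h1]))
    · exact Fin.forall_fin_two.mpr ⟨⟨rfl, .inr rfl⟩, ⟨rfl, .inl rfl⟩⟩
    · rfl
  · rw [A.disp_eq_neg_total c]
    · change -∑ i : Fin 2, _ = _
      rw [Fin.sum_univ_two]
      simp [Framing.out, circleFraming, hne]
    · exact A.isSimplicial_pair (A.isSegment_bdry (.inl rfl) (by simp)) (opp _ _) rfl
        ((A.glue_circ_false c _).trans (by simp [h1]))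
    · exact Fin.forall_fin_two.mpr ⟨⟨rfl, .inr rfl⟩, ⟨rfl, .inr rfl⟩⟩
    · rfl
  · rw [A.disp_eq_neg_total c]
    · change -∑ i : Fin 1, _ = _
      simp [Framing.out, circleFraming]
    · intro i
      change Fin 1 at i
      rw [Subsingleton.elim i 0]
      exact ⟨opp _ _, (A.glue_circ_false c _).trans (by simp [h1])⟩
    · intro i
      change Fin 1 at i
      rw [Subsingleton.elim i 0]
      exact ⟨rfl, .inr rfl⟩
    · rfl

theorem circleSlope_eq (c : A.Tip) (q : ℤ) : A.circleSlope c q = (A.residue c + 2 * q, 1) := by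
  rw [circleSlope, disp_circleMeridian, disp_circleLongitude]
  ext
  · simp; ring
  · simp

/-- The end of the twist region that is reached from `t` after passing it `i` times. -/
def tipAt (t : A.Tip) (i : ℕ) : A.Tip := if Even i then t else A.otherTip t

theorem tipAt_succ (t : A.Tip) (i : ℕ) : A.tipAt t (i + 1) = A.otherTip (A.tipAt t i) := by
  by_cases h : Even i <;> simp [tipAt, h, Nat.even_add_one, A.otherTip_otherTip]

/-- A curve that represents a surgery slope on a crossing circle: it runs along the circle `m`
times through one of the polyhedra, and passes once through the crossing disk. -/
def circleCurve (c t : A.Tip) (m : ℕ) : A.Curve where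
  m := m
  seg i :=
    { level := decide (Even i.1)
      enter := if i.1 = 0 then ((A.otherTip c, .circ), false)
        else ((A.tipAt t (i.1 - 1), .circ), true)
      exit := if i.1 = m then ((c, .circ), false) else ((A.tipAt t i.1, .circ), true) }

theorem tipAt_cases {c t : A.Tip} (h : t = c ∨ t = A.otherTip c) (i : ℕ) :
    A.tipAt t i = c ∨ A.tipAt t i = A.otherTip c := by
  unfold tipAt
  rcases h with rfl | rfl <;> split_ifs <;> simp [A.otherTip_otherTip]

/-- The polyhedron changes at each white side, and once more at the crossing disk exactly when there
is a half-twist. The parity condition is what lets the curve close up. -/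
theorem circleCurve_simplicial {c t : A.Tip} (h : t = c ∨ t = A.otherTip c) (m : ℕ)
    (hm : Odd m ↔ A.HalfTwist c) : A.IsSimplicial (A.circleCurve c t m) := by
  have seg : ∀ {u v : A.Tip} {b b' : Bool}, (u = c ∨ u = A.otherTip c) →
      (v = c ∨ v = A.otherTip c) → ((v, Pos.circ), b') ≠ ((u, Pos.circ), b) →
      A.poly.IsSegment (.bdry ((u, .circ), b)) (.bdry ((v, .circ), b')) := by
    intro u v b b' hu hv hne
    refine A.isSegment_bdry ?_ hne
    rw [A.opposite_circ]
    rcases hu with rfl | rfl <;> rcases hv with rfl | rfl <;> simp [A.otherTip_otherTip]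
  have hne := A.otherTip_ne c
  intro i
  obtain ⟨i, hi⟩ := i
  change i < m + 1 at hi
  constructor
  · simp only [circleCurve]
    split_ifs with h1 h2 h2
    · exact seg (.inr rfl) (.inl rfl) (by simpa using hne.symm)
    · exact seg (.inr rfl) (A.tipAt_cases h i) (by simp)
    · exact seg (A.tipAt_cases h _) (.inl rfl) (by simp)
    · refine seg (A.tipAt_cases h _) (A.tipAt_cases h i) ?_
      obtain ⟨j, rfl⟩ := Nat.exists_eq_succ_of_ne_zero h1
      simpa [A.tipAt_succ] using A.otherTip_ne _
  · by_cases him : i = m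
    · subst him
      have hz : (((⟨i, hi⟩ : Fin (i + 1)) + 1 : Fin (i + 1)) : ℕ) = 0 := by
        have : (⟨i, hi⟩ : Fin (i + 1)) + 1 = 0 := Fin.last_add_one i
        rw [this]; rfl
      change (((⟨i, hi⟩ : Fin ((A.circleCurve c t i).m + 1)) + 1 :) : ℕ) = 0 at hz
      generalize (⟨i, hi⟩ : Fin ((A.circleCurve c t i).m + 1)) + 1 = j at hz ⊢
      simp only [circleCurve, if_true, hz]
      rw [glue_circ_false]
      by_cases hh : A.HalfTwist c
      · simp [hh, hm.mpr hh]
      · simp [hh, Nat.not_odd_iff_even.mp (mt hm.mp hh)]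
    · have hz : (((⟨i, hi⟩ : Fin (m + 1)) + 1 : Fin (m + 1)) : ℕ) = i + 1 :=
        Fin.val_add_one_of_lt (Fin.lt_last_iff_ne_last.mpr (by simpa [Fin.ext_iff] using him))
      change (((⟨i, hi⟩ : Fin ((A.circleCurve c t m).m + 1)) + 1 :) : ℕ) = i + 1 at hz
      generalize (⟨i, hi⟩ : Fin ((A.circleCurve c t m).m + 1)) + 1 = j at hz ⊢
      simp only [circleCurve, if_neg him, hz, Nat.succ_ne_zero, if_false, Nat.add_sub_cancel]
      rw [glue_true]
      simp [Nat.even_add_one, -Nat.not_even_iff_odd]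

theorem circleCurve_onTorus {c t : A.Tip} (h : t = c ∨ t = A.otherTip c) (m : ℕ) :
    A.OnTorus (A.circleTorus c) (A.circleCurve c t m) := by
  refine A.onTorus_circle c _ fun i => ?_
  simp only [circleCurve]
  split_ifs
  · exact ⟨rfl, .inr rfl⟩
  · exact ⟨rfl, A.tipAt_cases h _⟩

theorem disp_circleCurve {c t : A.Tip} (h : t = c ∨ t = A.otherTip c) (m : ℕ)
    (hm : Odd m ↔ A.HalfTwist c) :
    A.disp (A.circleCurve c t m) = (if t = c then (m : ℤ) else -m, 1) := by
  have hne := A.otherTip_ne c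
  have e2 : (2 : ZMod 4) + 2 = 0 := by decide
  rw [((A.circleFraming c).disp_eq_sum (A.circleFraming_on c) _ (A.circleCurve_simplicial h m hm)
    (A.circleCurve_onTorus h m)).2 (by
      simp [startDir, circleCurve, Framing.dir, circleFraming, hne, e2])]
  change -∑ i : Fin (m + 1), _ = _
  have : ∀ i : Fin m, (A.circleFraming c).out ((A.circleCurve c t m).seg i.castSucc).exit
      ((A.circleCurve c t m).seg i.castSucc).level = if t = c then (-1, 0) else (1, 0) := by
    intro i
    have := i.2.ne
    rcases h with rfl | rfl <;> by_cases hi : Even i.1 <;>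
      simp [circleCurve, this, Framing.out, tipAt, hi, circleFraming, hne, A.otherTip_otherTip]
  rw [Fin.sum_univ_castSucc, Finset.sum_congr rfl fun i _ => this i]
  split_ifs <;> simp [circleCurve, Framing.out, circleFraming]

/-- The displacement has first coordinate `N = residue + 2 q`, whose parity is that of the
half-twist. Its absolute value is the number of steps along the circle, and its sign chooses the tip
`t`, hence the direction. This rules out an empty infimum in `slopeLength`. -/
theorem exists_circleCurve (c : A.Tip) (q : ℤ) : ∃ γ, A.IsSimplicial γ ∧
    A.OnTorus (A.circleTorus c) γ ∧ A.disp γ = A.circleSlope c q := by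
  set N := A.residue c + 2 * q with hN
  have hm : Odd N.natAbs ↔ A.HalfTwist c := by
    rw [Int.natAbs_odd, hN, residue]
    split_ifs with h1 h2 <;> simp only [h1, iff_true, iff_false]
    · exact ⟨q - 1, by ring⟩
    · exact ⟨q, by ring⟩
    · rw [Int.not_odd_iff_even]; exact ⟨q, by ring⟩
  rw [circleSlope_eq, ← hN]
  rcases le_total 0 N with h | h
  · refine ⟨_, A.circleCurve_simplicial (.inl rfl) _ hm, A.circleCurve_onTorus (.inl rfl) _, ?_⟩
    rw [A.disp_circleCurve (.inl rfl) _ hm, if_pos rfl]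
    congr 1; omega
  · refine ⟨_, A.circleCurve_simplicial (.inr rfl) _ hm, A.circleCurve_onTorus (.inr rfl) _, ?_⟩
    rw [A.disp_circleCurve (.inr rfl) _ hm, if_neg (A.otherTip_ne c)]
    congr 1; omega

/-- The combinatorial length of a surgery slope on a crossing circle. -/
theorem lt_slopeLength_circle (T : Incidence A.nxt A.prv A.opposite A.white) (c : A.Tip) (q : ℤ) :
    (A.crossingsAfter c q : ℝ) * Real.pi / 3
      < A.slopeLength (A.circleTorus c) (A.circleSlope c q) := by
  have hpi := Real.pi_pos
  obtain ⟨γ, hs, ht, hd⟩ := A.exists_circleCurve c q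
  -- The extra `π / 6` is paid for passing through the crossing disk. A multiple `k ≠ 0` of the
  -- slope only enlarges both coordinates.
  refine lt_of_lt_of_le (b := (A.crossingsAfter c q : ℝ) * (Real.pi / 3) + Real.pi / 6)
    (by linarith) (le_csInf ⟨_, γ, hs, ht, ⟨1, one_ne_zero, by rw [hd, one_smul]⟩, rfl⟩ ?_)
  rintro _ ⟨γ, hs, ht, ⟨k, hk, hd⟩, rfl⟩
  have key := ((A.circleFraming c).le_curveLength T (A.circleFraming_on c) γ hs ht).1
  rw [circleSlope_eq] at hd
  have hk : (1 : ℝ) ≤ |(k : ℝ)| := by exact_mod_cast Int.one_le_abs hk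
  have h2 : ((A.disp γ).2 : ℝ) = k := by rw [hd]; simp
  have h1 : |((A.disp γ).1 : ℝ)| = |(k : ℝ)| * A.crossingsAfter c q := by
    rw [hd, crossingsAfter, Nat.cast_natAbs, Int.cast_abs, ← abs_mul]; simp
  rw [h1, h2] at key
  have : (0 : ℝ) ≤ A.crossingsAfter c q * (Real.pi / 3) := by positivity
  nlinarith

end LinkDiagram.Direction

end AugLink

/-! ### Strands passing through a twist region -/

namespace AugLink

namespace LinkDiagram

variable {D : Type*} {L : LinkDiagram D}

theorem α_σ_of_isBigon {d : D} (h : L.IsBigon d) : L.α (L.σ d) = L.φ d := by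
  have h1 : L.α (L.φ d) = L.σ d := by rw [L.α_eq, h.1]
  rw [← h1, L.α_invol]

namespace Direction

variable [Finite D] (A : L.Direction)

/-- The twist region of `c` consists of the crossings along the row of bigons that starts there. -/
theorem sameRegion_iff (c : A.Tip) (a : ℕ) (ha : 0 < a) (he : (A.otherTip c).1 = (L.row ^ a) c.1)
    (hb : ∀ j, 0 < j → j < a → L.IsBigon ((L.row ^ j) c.1)) (d : D) :
    L.SameRegion c.1 d ↔ ∃ j, 0 < j ∧ j ≤ a ∧ L.SameVertex d ((L.row ^ j) c.1) := by
  have hι := L.crossBigon_of_not c.2.2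
  have hx : ∀ j, (L.row ^ (j + 1)) c.1 = L.σ (L.σ (L.crossBigon ((L.row ^ j) c.1))) := fun j => by
    rw [pow_succ', Equiv.Perm.mul_apply, L.row_apply]
  have hσ : ∀ x y, L.SameVertex (L.σ x) y ↔ L.SameVertex x y := fun x y =>
    Equiv.Perm.sameCycle_apply_left
  have hσ' : ∀ x y, L.SameVertex x (L.σ y) ↔ L.SameVertex x y := fun x y =>
    Equiv.Perm.sameCycle_apply_right
  set U : D → Prop := fun d => ∃ j, 0 < j ∧ j ≤ a ∧ L.SameVertex d ((L.row ^ j) c.1) with hU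
  have hUσ : ∀ d, U (L.σ d) ↔ U d := fun d => by simp only [hU, hσ]
  have hφ : ∀ u, L.IsBigon u → U u → U (L.φ u) := by
    rintro u hu ⟨j, h0, hj, hv⟩
    obtain ⟨j, rfl⟩ := Nat.exists_eq_succ_of_ne_zero h0.ne'
    rw [← L.crossBigon_of hu]
    rcases A.eq_of_sameVertex (A.row_pow_mem c.2.1 _) (A.bigon_mem _ hu) hv.symm with h | h
    · have hja : j + 1 ≠ a := by
        rintro rfl
        rw [← he] at h
        exact (A.otherTip c).2.2 (h ▸ hu)
      refine ⟨j + 2, by omega, by omega, ?_⟩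
      rw [hx, hσ', hσ', h]
      exact .refl _ _
    · rw [Nat.succ_eq_add_one, hx, L.four] at h
      have hj0 : j ≠ 0 := by
        rintro rfl
        rw [pow_zero, Equiv.Perm.one_apply, hι] at h
        exact c.2.2 (h ▸ hu)
      refine ⟨j, by omega, by omega, ?_⟩
      rw [h, L.crossBigon_crossBigon]
      exact .refl _ _
  have hUα : ∀ u, L.IsBigon u → (U (L.α u) ↔ U u) := by
    intro u hu
    rw [L.α_eq, hUσ]
    refine ⟨fun h => ?_, hφ u hu⟩
    have := hφ _ (L.bigon_face hu) h
    rwa [hu.1] at this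
  have hc : U c.1 := by
    refine ⟨1, one_pos, ha, ?_⟩
    rw [hx 0, hσ', hσ', pow_zero, Equiv.Perm.one_apply, hι]
    exact .refl _ _
  constructor
  · intro h
    have : ∀ {x y}, L.SameRegion x y → (U x ↔ U y) := by
      intro x y h
      induction h with
      | rel x y h =>
        rcases h with rfl | ⟨hb, rfl⟩
        · exact (hUσ _).symm
        · exact (hUα _ hb).symm
      | refl => rfl
      | symm _ _ _ ih => exact ih.symm
      | trans _ _ _ _ _ ih1 ih2 => exact ih1.trans ih2
    exact (this h).mp hc
  · rintro ⟨j, -, -, hv⟩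
    refine (L.sameRegion_row_pow c.1 j).trans _ _ _ ?_
    have e : ∀ x, L.SameRegion x (L.σ x) := fun x => .rel _ _ (.inl rfl)
    rcases L.sameVertex_cases hv.symm with h | h | h | h <;> rw [h]
    · exact .refl _
    · exact e _
    · exact (e _).trans _ _ _ (e _)
    · exact ((e _).trans _ _ _ (e _)).trans _ _ _ (e _)

/-- This links the parity in `HalfTwist` to the length of the row. It remains to see that the
crossings along the row are distinct. -/
theorem crossings_eq_of_row (c : A.Tip) (a : ℕ) (ha : 0 < a)
    (he : (A.otherTip c).1 = (L.row ^ a) c.1)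
    (hb : ∀ j, 0 < j → j < a → L.IsBigon ((L.row ^ j) c.1)) : L.crossings c.1 = a := by
  have hι := L.crossBigon_of_not c.2.2
  have hι' := L.crossBigon_of_not (A.otherTip c).2.2
  -- The walk from `c` reaches the other tip after `a` steps and retraces the row. A return to `c`
  -- before step `2 * a` would make `c` a bigon or equal to the other tip.
  have hper : ∀ n, 0 < n → n < 2 * a → (L.row ^ n) c.1 ≠ c.1 := by
    intro n h0 hn h
    rcases lt_trichotomy n a with hna | rfl | hna
    · exact c.2.2 (h ▸ hb n h0 hna)
    · exact A.otherTip_ne c (Subtype.ext (he.trans h))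
    · have h1 := L.crossBigon_row_pow (n - a) ((L.row ^ (2 * a - n)) c.1)
      rw [← Equiv.Perm.mul_apply (L.row ^ (n - a)) (L.row ^ (2 * a - n)), ← pow_add,
        show n - a + (2 * a - n) = a by omega, ← he, hι', he, ← Equiv.Perm.mul_apply,
        ← pow_add, show n - a + a = n by omega, h] at h1
      exact c.2.2 (h1 ▸ L.isBigon_crossBigon.mpr (hb _ (by omega) (by omega)))
  have hinj : ∀ i j, 0 < i → i < j → j ≤ a →
      ¬ L.SameVertex ((L.row ^ i) c.1) ((L.row ^ j) c.1) := by
    intro i j hi hij hj hv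
    rcases A.eq_of_sameVertex (A.row_pow_mem c.2.1 _) (A.row_pow_mem c.2.1 _) hv with h | h
    · refine hper (j - i) (by omega) (by omega) ((L.row ^ i).injective ?_)
      rw [← Equiv.Perm.mul_apply, ← pow_add, show i + (j - i) = j by omega, h]
    · obtain ⟨i, rfl⟩ := Nat.exists_eq_succ_of_ne_zero hi.ne'
      rw [Nat.succ_eq_add_one, pow_succ' _ i, Equiv.Perm.mul_apply, L.row_apply, L.four] at h
      have h1 := L.crossBigon_row_pow i c.1
      rw [← h, hι, ← Equiv.Perm.mul_apply, ← pow_add] at h1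
      exact hper _ (by omega) (by omega) h1
  have hset : (Quotient.mk (Equiv.Perm.SameCycle.setoid L.σ)) '' {d' | L.SameRegion c.1 d'} =
      (fun j => Quotient.mk (Equiv.Perm.SameCycle.setoid L.σ) ((L.row ^ j) c.1)) ''
        (Finset.Icc 1 a : Set ℕ) := by
    ext v
    constructor
    · rintro ⟨d, hd, rfl⟩
      obtain ⟨j, h0, hj, hv⟩ := (A.sameRegion_iff c a ha he hb d).mp hd
      exact ⟨j, by simp; omega, Quotient.sound hv.symm⟩
    · rintro ⟨j, -, rfl⟩
      exact ⟨_, L.sameRegion_row_pow c.1 j, rfl⟩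
  rw [crossings, hset, Set.InjOn.ncard_image, Set.ncard_coe_finset, Nat.card_Icc,
    Nat.add_sub_cancel]
  intro i hi j hj h
  simp only [Finset.coe_Icc, Set.mem_Icc] at hi hj
  have hv : L.SameVertex ((L.row ^ i) c.1) ((L.row ^ j) c.1) := Quotient.exact h
  rcases lt_trichotomy i j with h' | h' | h'
  · exact absurd hv (hinj i j (by omega) h' (by omega))
  · exact h'
  · exact absurd hv.symm (hinj j i (by omega) h' (by omega))

/-- The dart at the corner `x` of a row of bigons, on one of the two sides of the row. -/
def strandAt (x : D) : Pos → D
  | .circ => x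
  | .fst => x
  | .snd => L.σ x

theorem dartOf_eq (q : A.Shaded) : A.dartOf q = strandAt (L := L) q.1.1 q.2 := by
  obtain ⟨c, _ | _ | _⟩ := q <;> rfl

/-- At every crossing inside the row the strand changes sides. Hence only the parity of the number
of crossings decides where it leaves, which is the case distinction in `glueShaded`. -/
theorem walk_strandAt {x : D} (h : L.IsBigon x) {p : Pos} (hp : p ≠ .circ) :
    L.walk (strandAt (L := L) x p) = strandAt (L := L) (L.row x) p.mirror := by
  rw [L.row_apply, L.crossBigon_of h]
  cases p
  · exact absurd rfl hp
  · change L.σ (L.σ (L.α x)) = _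
    rw [L.α_eq]; rfl
  · change L.σ (L.σ (L.α (L.σ x))) = _
    rw [α_σ_of_isBigon h]; rfl

theorem not_external_strandAt {x : D} (h : L.IsBigon x) (p : Pos) :
    ¬ L.External (strandAt (L := L) x p) := by
  cases p
  · exact fun he => he.1 h
  · exact fun he => he.1 h
  · intro he
    have := he.2
    change ¬ L.IsBigon (L.α (L.σ x)) at this
    rw [α_σ_of_isBigon h] at this
    exact this (L.bigon_face h)

theorem glueShaded_snd_ne {q : A.Shaded} (h : q.2 ≠ .circ) : (A.glueShaded q).2 ≠ .circ := by
  obtain ⟨c, p⟩ := q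
  unfold glueShaded
  split_ifs
  · exact h
  · cases p <;> simp_all [Pos.mirror]

/-- Following the link from the edge of a shaded triangle through the twist region at its end
corresponds to the gluing of the shaded triangles. -/
theorem firstReturn_walk (q : A.Shaded) (h : q.2 ≠ .circ) :
    (firstReturn L.walk L.External ⟨L.α (A.dartOf q), external_α (A.external_dartOf q)⟩).1
      = A.dartOf (A.glueShaded q) := by
  obtain ⟨c, p⟩ := q
  simp only at h
  obtain ⟨a, ha, he, hb⟩ := A.exists_row c
  have hcr := A.crossings_eq_of_row c a ha he hb
  have hx : ∀ j, (L.row ^ (j + 1)) c.1 = L.row ((L.row ^ j) c.1) := fun j => by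
    rw [pow_succ', Equiv.Perm.mul_apply]
  have hm : ∀ p : Pos, p ≠ .circ → p.mirror ≠ .circ := by intro p; cases p <;> simp [Pos.mirror]
  have key : ∀ j, 0 < j → j ≤ a → (L.walk ^ j) (L.α (A.dartOf (c, p))) =
      strandAt (L := L) ((L.row ^ j) c.1) (if Odd j then p else p.mirror) := by
    intro j h0 hj
    induction j with
    | zero => exact absurd h0 (lt_irrefl _)
    | succ j ih =>
      rcases Nat.eq_zero_or_pos j with rfl | hj0
      · rw [if_pos (by decide), pow_one, pow_one, L.row_apply, L.crossBigon_of_not c.2.2, dartOf_eq]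
        change L.σ (L.σ (L.α (L.α _))) = _
        rw [L.α_invol]
        cases p <;> rfl
      · rw [pow_succ', Equiv.Perm.mul_apply, ih hj0 (by omega), hx]
        rw [walk_strandAt (hb j hj0 (by omega)) (by split_ifs <;> simp [h, hm])]
        congr 1
        by_cases ho : Odd j
        · have : ¬ Odd (j + 1) := by rw [Nat.odd_add_one]; exact not_not.mpr ho
          rw [if_pos ho, if_neg this]
        · have : Odd (j + 1) := by rw [Nat.odd_add_one]; exact ho
          rw [if_neg ho, if_pos this, Pos.mirror_mirror]
  have hend : (L.walk ^ a) (L.α (A.dartOf (c, p))) = A.dartOf (A.glueShaded (c, p)) := by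
    rw [key a ha le_rfl, ← he, dartOf_eq]
    unfold glueShaded HalfTwist
    simp only [hcr]
    split_ifs <;> rfl
  rw [← hend]
  refine firstReturn_eq _ _ _ a ha ?_ ?_
  · simp only; rw [hend]; exact A.external_dartOf _
  · intro j h0 hj
    simp only; rw [key j h0 hj.le]
    exact not_external_strandAt (hb j h0 hj) _

end Direction

end LinkDiagram

end AugLink

/-! ### Slopes on the components of the link -/

namespace AugLink

namespace LinkDiagram

variable {D : Type*} (L : LinkDiagram D)

/-- Reversing an edge reverses the walk: `walk` is the product of the involutions `σ * σ` and `α`.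
-/
theorem α_walk_pow (k : ℤ) (d : D) : L.α ((L.walk ^ k) d) = (L.walk ^ (-k)) (L.α d) := by
  have h1 : L.α * L.walk * L.α⁻¹ = L.walk⁻¹ := by
    rw [eq_inv_iff_mul_eq_one]
    ext x
    have hi : L.α⁻¹ = L.α := by
      ext y; rw [Equiv.Perm.inv_eq_iff_eq, L.α_invol]
    simp [hi, walk, L.α_invol, L.four]
  have h2 : L.α * L.walk ^ k * L.α⁻¹ = L.walk ^ (-k) := by
    rw [← conj_zpow, h1, inv_zpow']
  have := congrArg (fun f : Equiv.Perm D => f (L.α d)) h2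
  simpa using this

/-- A component of the link is not its own reverse. -/
theorem not_sameCycle_walk_α (d : D) : ¬ L.walk.SameCycle d (L.α d) := by
  rintro ⟨k, hk⟩
  have h : ∀ j : ℤ, L.α ((L.walk ^ j) d) = (L.walk ^ (k - j)) d := fun j => by
    rw [L.α_walk_pow, ← hk, ← Equiv.Perm.mul_apply, ← zpow_add]; congr 2; ring
  rcases Int.even_or_odd' k with ⟨j, rfl | rfl⟩
  · have := h j
    rw [show 2 * j - j = j by ring] at this
    exact L.α_ne _ this
  · have := h j
    rw [show 2 * j + 1 - j = 1 + j by ring, zpow_add, zpow_one, Equiv.Perm.mul_apply] at this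
    exact L.two_ne _ this.symm

variable {L}

theorem sameCycle_walk_α {d d' : D} (h : L.walk.SameCycle d d') :
    L.walk.SameCycle (L.α d) (L.α d') := by
  obtain ⟨k, rfl⟩ := h
  exact ⟨-k, (L.α_walk_pow k d).symm⟩

namespace Direction

variable [Finite D] (A : L.Direction)

theorem sameCycle_glueShaded (q : A.Shaded) (h : q.2 ≠ .circ) :
    L.walk.SameCycle (L.α (A.dartOf q)) (A.dartOf (A.glueShaded q)) := by
  obtain ⟨k, -, hk, -⟩ := firstReturn_spec L.walk L.External
    ⟨L.α (A.dartOf q), external_α (A.external_dartOf q)⟩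
  rw [A.firstReturn_walk q h] at hk
  exact ⟨k, by rw [hk]; simp⟩

/-- The framing of the torus of the component of the link through the dart `d`. -/
def strandFraming (d : D) : A.Framing where
  on q := q.2 ≠ .circ ∧
    (L.walk.SameCycle d (A.dartOf q) ∨ L.walk.SameCycle d (L.α (A.dartOf q)))
  fw q := decide (L.walk.SameCycle d (A.dartOf q))
  on_opp := by
    rintro q ⟨h, h'⟩
    refine ⟨mt (A.opposite_snd_circ q).mp h, ?_⟩
    rw [A.dartOf_opposite q h, L.α_invol]
    exact h'.symm
  on_glue := by
    rintro q ⟨h, h'⟩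
    refine ⟨A.glueShaded_snd_ne h, ?_⟩
    have h1 := A.sameCycle_glueShaded q h
    rcases h' with h' | h'
    · have := sameCycle_walk_α h1
      rw [L.α_invol] at this
      exact .inr (h'.trans this)
    · exact .inl (h'.trans h1)
  fw_opp := by
    rintro q ⟨h, h'⟩
    rw [A.dartOf_opposite q h]
    by_cases h1 : L.walk.SameCycle d (A.dartOf q)
    · have : ¬ L.walk.SameCycle d (L.α (A.dartOf q)) :=
        fun h2 => L.not_sameCycle_walk_α _ (h1.symm.trans h2)
      simp [h1, this]
    · simp [h1, h'.resolve_left h1]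
  fw_glue := by
    rintro q ⟨h, h'⟩
    have h3 := A.sameCycle_glueShaded q h
    by_cases h1 : L.walk.SameCycle d (A.dartOf q)
    · have : ¬ L.walk.SameCycle d (A.dartOf (A.glueShaded q)) :=
        fun h2 => L.not_sameCycle_walk_α _ ((h1.symm.trans h2).trans h3.symm)
      simp [h1, this]
    · simp [h1, (h'.resolve_left h1).trans h3]

/-- Moving along the link to the next edge of the diagram that is on no bigon, together with the
change of the polyhedra. -/
def advance : Equiv.Perm (A.Shaded × Bool) where
  toFun s := (A.glueShaded (A.opposite s.1),
    if A.HalfTwist (A.opposite s.1).1 then !s.2 else s.2)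
  invFun s := (A.opposite (A.glueShaded s.1), if A.HalfTwist s.1.1 then !s.2 else s.2)
  left_inv := by
    rintro ⟨q, l⟩
    simp only [A.glueShaded_glueShaded, A.opposite_opposite, A.glueShaded_fst, A.halfTwist_otherTip]
    split_ifs <;> simp
  right_inv := by
    rintro ⟨q, l⟩
    simp only [A.glueShaded_glueShaded, A.opposite_opposite, A.glueShaded_fst, A.halfTwist_otherTip]
    split_ifs <;> simp

/-- Passing from one polyhedron to the other one. -/
def swap : Equiv.Perm (A.Shaded × Bool) where
  toFun s := (s.1, !s.2)
  invFun s := (s.1, !s.2)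
  left_inv := by rintro ⟨q, l⟩; simp
  right_inv := by rintro ⟨q, l⟩; simp

theorem commute_advance_swap : Commute A.advance A.swap := by
  ext1 s
  obtain ⟨q, l⟩ := s
  simp only [advance, swap, Equiv.Perm.mul_apply, Equiv.coe_fn_mk]
  split_ifs <;> rfl

theorem swap_zpow_fst (k : ℤ) (s : A.Shaded × Bool) : ((A.swap ^ k) s).1 = s.1 := by
  induction k using Int.induction_on with
  | zero => rfl
  | succ k ih => rw [add_comm, zpow_add, zpow_one, Equiv.Perm.mul_apply]; exact ih
  | pred k ih =>
    rw [sub_eq_add_neg, add_comm, zpow_add, zpow_neg_one, Equiv.Perm.mul_apply]; exact ih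

theorem even_of_swap_zpow (k : ℤ) (s : A.Shaded × Bool) (h : (A.swap ^ k) s = s) : Even k := by
  have h2 : A.swap ^ (2 : ℤ) = 1 := by
    ext1 s
    rw [zpow_ofNat, pow_two]
    simp [swap]
  rcases Int.even_or_odd' k with ⟨j, rfl | rfl⟩
  · exact even_two_mul j
  · rw [zpow_add, zpow_mul, h2, one_zpow, one_mul, zpow_one] at h
    exact absurd (congrArg Prod.snd h) (by simp [swap])

namespace Framing

variable {A} (R : A.Framing)

/-- The corner at an ideal vertex through which one enters when going upwards. -/
def corner (q : A.Shaded) : A.Shaded := if R.fw q then q else A.opposite q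

theorem corner_opposite {q : A.Shaded} (h : R.on q) : R.corner (A.opposite q) = R.corner q := by
  unfold corner
  rw [R.fw_opp q h]
  cases hq : R.fw q <;> simp [A.opposite_opposite]

/-- The effect of leaving a boundary rectangle. -/
theorem corner_glue {y x : A.Dart} {l l' : Bool} (hy : R.on y.1) (h : A.glue (y, l) = (x, l')) :
    (R.corner x.1, l') =
      (A.advance ^ (R.out y l).2) ((A.swap ^ (R.out y l).1) (R.corner y.1, l)) := by
  obtain ⟨q, _ | _⟩ := y
  · rw [A.glue_false] at h
    obtain ⟨rfl, rfl⟩ := Prod.mk.inj h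
    have h1 := R.fw_glue q hy
    cases hq : R.fw q
    · simp [out, corner, hq, h1, advance, A.opposite_opposite]
    · simp only [out, corner, hq, h1]
      simp [advance]
  · rw [A.glue_true] at h
    obtain ⟨rfl, rfl⟩ := Prod.mk.inj h
    by_cases hq : R.fw q = l <;> simp [out, hq, swap]

/-- Going around a closed curve one comes back to the same place. -/
theorem advance_total {z : A.Dart × Bool} (hz : R.on z.1.1) (γ : A.Curve)
    (hs : A.IsSimplicial γ) (ht : A.OnTorus z γ) :
    (A.advance ^ (R.total γ).2) ((A.swap ^ (R.total γ).1)
      (R.corner (γ.seg 0).enter.1, (γ.seg 0).level)) =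
      (R.corner (γ.seg 0).enter.1, (γ.seg 0).level) := by
  have hon : ∀ i, R.on (γ.seg i).enter.1 := fun i => (R.on_of_sameTorus (ht i)).mp hz
  have hon' : ∀ i, R.on (γ.seg i).exit.1 := fun i => by
    rcases (A.segment_bdry (hs i).1).1 with h | h
    · rw [h]; exact hon i
    · rw [h]; exact R.on_opp _ (hon i)
  have hc : ∀ i, R.corner (γ.seg i).exit.1 = R.corner (γ.seg i).enter.1 := fun i => by
    rcases (A.segment_bdry (hs i).1).1 with h | h
    · rw [h]
    · rw [h, R.corner_opposite (hon i)]
  set s : Fin (γ.m + 1) → A.Shaded × Bool := fun i =>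
    (R.corner (γ.seg i).enter.1, (γ.seg i).level)
  set o : Fin (γ.m + 1) → ℤ × ℤ := fun i => R.out (γ.seg i).exit (γ.seg i).level
  have hstep : ∀ i, s (i + 1) = (A.advance ^ (o i).2) ((A.swap ^ (o i).1) (s i)) := by
    intro i
    simp only [s, o]
    rw [R.corner_glue (hon' i) (hs i).2, hc]
  have hcomm : ∀ (v w : ℤ × ℤ) (t : A.Shaded × Bool),
      (A.advance ^ v.2) ((A.swap ^ v.1) ((A.advance ^ w.2) ((A.swap ^ w.1) t))) =
        (A.advance ^ (w + v).2) ((A.swap ^ (w + v).1) t) := by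
    intro v w t
    have h1 := (A.commute_advance_swap.zpow_zpow w.2 v.1).eq
    simp only [← Equiv.Perm.mul_apply]
    congr 1
    rw [Prod.snd_add, Prod.fst_add, add_comm w.2, add_comm w.1, zpow_add, zpow_add]
    simp only [mul_assoc]
    rw [← mul_assoc (A.swap ^ v.1) (A.advance ^ w.2), ← h1, mul_assoc]
  have key : ∀ j : ℕ, s (Fin.ofNat (γ.m + 1) j) =
      (A.advance ^ (∑ i ∈ Finset.range j, o (Fin.ofNat (γ.m + 1) i)).2)
        ((A.swap ^ (∑ i ∈ Finset.range j, o (Fin.ofNat (γ.m + 1) i)).1) (s 0)) := by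
    intro j
    induction j with
    | zero => simp
    | succ j ih => rw [Fin.ofNat_add_one, hstep, ih, hcomm, Finset.sum_range_succ]
  have h1 := key (γ.m + 1)
  have h2 : Fin.ofNat (γ.m + 1) (γ.m + 1) = 0 := by ext; simp
  have h3 : ∑ i ∈ Finset.range (γ.m + 1), o (Fin.ofNat (γ.m + 1) i) = R.total γ := by
    rw [total, Fin.sum_rotate _ 0]
    exact Finset.sum_congr rfl fun i _ => by rw [zero_add]
  rw [h2, h3] at h1
  exact h1.symm

end Framing

/-- The shaded corners on the external edges of a component of the link. -/
theorem exists_advance (m : ℕ) (s : A.Shaded × Bool) (h : s.1.2 ≠ .circ)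
    (he : L.External ((L.walk ^ m) (A.dartOf s.1))) :
    ∃ k : ℕ, (L.walk ^ m) (A.dartOf s.1) = A.dartOf ((A.advance ^ k) s).1 := by
  induction m using Nat.strong_induction_on generalizing s with
  | _ m ih =>
    rcases Nat.eq_zero_or_pos m with rfl | hm
    · exact ⟨0, rfl⟩
    · obtain ⟨j, hj, hr, hmin⟩ := firstReturn_spec L.walk L.External
        ⟨A.dartOf s.1, A.external_dartOf s.1⟩
      have hop : (A.opposite s.1).2 ≠ .circ := mt (A.opposite_snd_circ s.1).mp h
      have hr' : A.dartOf (A.advance s).1 = (L.walk ^ j) (A.dartOf s.1) := by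
        rw [← hr]
        have h1 := A.firstReturn_walk _ hop
        simp only [A.dartOf_opposite s.1 h, L.α_invol] at h1
        exact h1.symm
      have hjm : j ≤ m := by
        by_contra hlt
        exact hmin m hm (by omega) he
      have e : (L.walk ^ m) (A.dartOf s.1) = (L.walk ^ (m - j)) (A.dartOf (A.advance s).1) := by
        rw [hr', ← Equiv.Perm.mul_apply, ← pow_add, Nat.sub_add_cancel hjm]
      rw [e] at he ⊢
      obtain ⟨k, hk⟩ := ih (m - j) (by omega) _ (A.glueShaded_snd_ne hop) he
      exact ⟨k + 1, by rw [hk, pow_succ, Equiv.Perm.mul_apply]⟩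

/-- The orbit under `advance` meets every external dart of the oriented component. If it repeats
after `n` steps, `n` darts suffice to list them all. -/
theorem visits_le (s : A.Shaded × Bool) (h : s.1.2 ≠ .circ) (n : ℕ) (hn : 0 < n)
    (hs : ((A.advance ^ n) s).1 = s.1) : L.visits (A.dartOf s.1) ≤ n := by
  -- The level never influences the shaded corner, so the hypothesis, which disregards the level,
  -- can be iterated.
  have hfst : ∀ (k : ℕ) (s t : A.Shaded × Bool), s.1 = t.1 →
      ((A.advance ^ k) s).1 = ((A.advance ^ k) t).1 := by
    intro k
    induction k with
    | zero => exact fun _ _ h => h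
    | succ k ih =>
      intro s t h
      rw [pow_succ, Equiv.Perm.mul_apply, Equiv.Perm.mul_apply]
      refine ih _ _ ?_
      simp only [advance, Equiv.coe_fn_mk, h]
  have hmod : ∀ k : ℕ, ((A.advance ^ k) s).1 = ((A.advance ^ (k % n)) s).1 := by
    intro k
    induction k using Nat.strong_induction_on with
    | _ k ih =>
      by_cases hk : k < n
      · rw [Nat.mod_eq_of_lt hk]
      · rw [Nat.mod_eq_sub_mod (by omega), ← ih (k - n) (by omega)]
        conv_lhs => rw [← Nat.sub_add_cancel (not_lt.mp hk), pow_add, Equiv.Perm.mul_apply]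
        exact hfst _ _ _ hs
  have hsub : {d' | L.walk.SameCycle (A.dartOf s.1) d' ∧ L.External d'} ⊆
      (fun k => A.dartOf ((A.advance ^ k) s).1) '' (Finset.range n : Set ℕ) := by
    rintro d' ⟨hc, he⟩
    obtain ⟨m, -, -, rfl⟩ := hc.exists_pow_eq''
    obtain ⟨k, hk⟩ := A.exists_advance m s h he
    exact ⟨k % n, by simpa using Nat.mod_lt _ hn, by rw [hk]; simp only [hmod k]⟩
  refine (Set.ncard_le_ncard hsub ((Finset.finite_toSet _).image _)).trans ?_
  refine (Set.ncard_image_le (Finset.finite_toSet _)).trans ?_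
  rw [Set.ncard_coe_finset, Finset.card_range]

theorem visits_eq {d d' : D} (h : L.walk.SameCycle d d') : L.visits d = L.visits d' := by
  unfold visits
  congr 1
  ext x
  exact and_congr_left fun _ => ⟨fun h' => h.symm.trans h', fun h' => h.trans h'⟩

theorem strandFraming_on (d : D) (hd : L.External d) : (A.strandFraming d).on (A.locate d hd) :=
  ⟨A.locate_ne_circ d hd, .inl (by rw [A.dartOf_locate])⟩

theorem disp_strandMeridian (d : D) (hd : L.External d) :
    A.IsSimplicial (A.strandMeridian d hd) ∧
    A.OnTorus (A.strandTorus d hd) (A.strandMeridian d hd) ∧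
    A.disp (A.strandMeridian d hd) = (2, 0) := by
  have hon := A.strandFraming_on d hd
  have hop := (A.strandFraming d).fw_opp _ hon
  have hfw : (A.strandFraming d).fw (A.locate d hd) = true := by
    simp [strandFraming, A.dartOf_locate, Equiv.Perm.SameCycle.refl]
  rw [hfw] at hop
  have hne : A.opposite (A.locate d hd) ≠ A.locate d hd := by
    intro h
    rw [h, hfw] at hop
    simp at hop
  have hs : A.IsSimplicial (A.strandMeridian d hd) :=
    A.isSimplicial_pair (A.isSegment_bdry (.inr rfl) (by simpa using hne))
      (A.isSegment_bdry (.inr (by simp [A.opposite_opposite])) (by simpa using hne.symm)) rfl rfl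
  have ht : A.OnTorus (A.strandTorus d hd) (A.strandMeridian d hd) := by
    refine Fin.forall_fin_two.mpr ⟨.refl _, ?_⟩
    refine .trans _ ((A.opposite (A.locate d hd), false), true) _ (.rel _ _ (.inl rfl)) ?_
    exact .trans _ ((A.opposite (A.locate d hd), true), true) _ (.rel _ _ (.inl rfl))
      (.rel _ _ (.inr rfl))
  refine ⟨hs, ht, ?_⟩
  rw [((A.strandFraming d).disp_eq_sum hon _ hs ht).1
    (by simp [startDir, strandMeridian, Framing.dir, hfw])]
  change ∑ i : Fin 2, _ = _
  rw [Fin.sum_univ_two]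
  simp [strandMeridian, Framing.out, hfw, hop]

/-- By `advance_total`, a closed curve brings its starting state back under `advance ^ b * swap ^
a`. If `b = 0`, the level is restored only for even `a`. Otherwise the shaded corner is restored
after `|b|` advances, and `visits_le` applies. -/
theorem strand_total (d : D) (hd : L.External d) (γ : A.Curve) (hs : A.IsSimplicial γ)
    (ht : A.OnTorus (A.strandTorus d hd) γ) :
    (((A.strandFraming d).total γ).2 = 0 → Even ((A.strandFraming d).total γ).1) ∧
    (((A.strandFraming d).total γ).2 ≠ 0 →
      L.visits d ≤ ((A.strandFraming d).total γ).2.natAbs) := by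
  set R := A.strandFraming d
  have hz := A.strandFraming_on d hd
  have key := R.advance_total (z := A.strandTorus d hd) hz γ hs ht
  have hon : R.on (γ.seg 0).enter.1 := (R.on_of_sameTorus (ht 0)).mp hz
  set s := (R.corner (γ.seg 0).enter.1, (γ.seg 0).level) with hsdef
  constructor
  · intro h0
    rw [h0, zpow_zero, Equiv.Perm.one_apply] at key
    exact A.even_of_swap_zpow _ _ key
  · intro h0
    -- The upward corner carries a dart oriented along the component of `d`, not against it, so the
    -- visits are counted for the right orientation.
    have hcor : R.on s.1 ∧ R.fw s.1 = true := by
      simp only [hsdef, Framing.corner]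
      split_ifs with h
      · exact ⟨hon, h⟩
      · exact ⟨R.on_opp _ hon, by rw [R.fw_opp _ hon]; simpa using h⟩
    have hcyc : L.walk.SameCycle d (A.dartOf s.1) := of_decide_eq_true hcor.2
    rw [visits_eq hcyc]
    generalize R.total γ = v at *
    have hk : ((A.advance ^ v.2) s).1 = s.1 := by
      have h1 := congrArg Prod.fst key
      rw [← Equiv.Perm.mul_apply, (A.commute_advance_swap.zpow_zpow v.2 v.1).eq,
        Equiv.Perm.mul_apply, swap_zpow_fst] at h1
      exact h1
    have hk' : ((A.advance ^ (-v.2)) s).1 = s.1 := by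
      have h1 := congrArg (A.advance ^ (-v.2)) key
      rw [← Equiv.Perm.mul_apply, ← zpow_add, neg_add_cancel, zpow_zero,
        Equiv.Perm.one_apply] at h1
      rw [← h1, swap_zpow_fst]
    refine A.visits_le s hcor.1.1 _ (Int.natAbs_pos.mpr h0) ?_
    rw [← zpow_natCast]
    rcases Int.natAbs_eq v.2 with h | h
    · rwa [← h]
    · rwa [show ((v.2.natAbs : ℕ) : ℤ) = -v.2 by omega]

/-- The combinatorial length of a slope on the torus of a component of the link. -/
theorem le_slopeLength_strand (T : Incidence A.nxt A.prv A.opposite A.white) (d : D)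
    (hd : L.External d) (x : ℤ × ℤ) (hx : A.IsNontrivialSlope d hd x) :
    (L.visits d : ℝ) * Real.pi / 3 ≤ A.slopeLength (A.strandTorus d hd) x := by
  have hpi := Real.pi_pos
  obtain ⟨⟨⟨γ, hs, ht, hγ⟩, -, hprim⟩, hne1, hne2⟩ := hx
  obtain ⟨ms, mt, md⟩ := A.disp_strandMeridian d hd
  rw [md] at hne1 hne2
  have hz := A.strandFraming_on d hd
  have htot : ∀ γ, A.IsSimplicial γ → A.OnTorus (A.strandTorus d hd) γ →
      A.disp γ = (A.strandFraming d).total γ ∨ A.disp γ = -(A.strandFraming d).total γ :=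
    fun γ hs ht => (A.strandFraming d).disp_eq hz γ hs ht
  -- A slope with no vertical part is a multiple of `(2, 0)`. This is the displacement of the
  -- meridian and lies in the lattice, so primitivity makes the slope the meridian up to sign.
  have hx2 : x.2 ≠ 0 := by
    intro h0
    have hx : x = (A.strandFraming d).total γ ∨ x = -(A.strandFraming d).total γ := by
      rcases hγ with h | h <;> rcases htot γ hs ht with h' | h' <;> rw [h'] at h
      · exact .inl h.symm
      · exact .inr h.symm
      · exact .inr (by rw [h, neg_neg])
      · exact .inl (neg_injective h).symm
    have he : Even x.1 := by
      have := (A.strand_total d hd γ hs ht).1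
      rcases hx with h | h <;> rw [h] at h0 ⊢
      · exact this h0
      · simp only [Prod.snd_neg, neg_eq_zero, Prod.fst_neg, even_neg] at h0 ⊢
        exact this h0
    obtain ⟨a, ha⟩ := he
    have hxa : x = a • ((2, 0) : ℤ × ℤ) := by
      ext
      · simp [ha]; ring
      · simp [h0]
    rcases hprim _ ⟨_, ms, mt, .inl md⟩ a hxa with rfl | rfl
    · exact hne1 (by rw [hxa, one_smul])
    · exact hne2 (by rw [hxa, neg_smul, one_smul])
  refine le_csInf ?_ ?_
  · rcases hγ with h | h
    · exact ⟨_, γ, hs, ht, ⟨1, one_ne_zero, by rw [h, one_smul]⟩, rfl⟩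
    · exact ⟨_, γ, hs, ht, ⟨-1, by norm_num, by rw [h, neg_smul, one_smul]⟩, rfl⟩
  · rintro _ ⟨γ, hs, ht, ⟨k, hk, hd'⟩, rfl⟩
    have key := ((A.strandFraming d).le_curveLength T (z := A.strandTorus d hd) hz γ hs ht).2
    have h2 : (A.disp γ).2 ≠ 0 := by
      rw [hd']; simp [hk, hx2]
    have h3 : (A.disp γ).2.natAbs = ((A.strandFraming d).total γ).2.natAbs := by
      rcases htot γ hs ht with h | h <;> rw [h] <;> simp
    have h4 := (A.strand_total d hd γ hs ht).2 (by
      intro h; rw [h] at h3; exact h2 (by simpa using h3))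
    rw [← h3] at h4
    have h5 : (L.visits d : ℝ) ≤ |((A.disp γ).2 : ℝ)| := by
      rw [← Int.cast_abs, ← Nat.cast_natAbs]; exact_mod_cast h4
    nlinarith

end Direction

end LinkDiagram

end AugLink

end

theorem mainTheorem6 {D : Type*} [Finite D] (L : AugLink.LinkDiagram D)
    (hprime : L.IsPrime) (htwist : L.IsTwistReduced) (htwo : L.TwoRegions) (A : L.Direction) :
    (∀ (d : D) (hd : L.External d) (x : ℤ × ℤ), A.IsNontrivialSlope d hd x →
      (L.visits d : ℝ) * Real.pi / 3 ≤ A.slopeLength (A.strandTorus d hd) x) ∧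
    (∀ (c : A.Tip) (q : ℤ),
      (A.crossingsAfter c q : ℝ) * Real.pi / 3
        < A.slopeLength (A.circleTorus c) (A.circleSlope c q)) :=
  ⟨fun d hd x => A.le_slopeLength_strand (A.incidence hprime htwist htwo) d hd x,
    fun c q => A.lt_slopeLength_circle (A.incidence hprime htwist htwo) c q⟩
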